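/- There exist a constant $C$, an algorithm $\mathcal{A}$ and a polynomial $p$ such that the following holds for all positive integers $k$ and $t$ and every finite simple graph $G$ of maximum degree at most $t$. Given $G$ (by its adjacency matrix) and $k$, the algorithm $\mathcal{A}$ halts after at most $p(|V(G)|)$ steps and outputs - either an induced packing of $k$ cycles in $G$, that is, $k$ pairwise vertex-disjoint cycles of $G$ such that no edge of $G$ joins two distinct ones of them, - or a set $X\subseteq V(G)$ with $|X|\le C\,t\,k\log k$ such that $G-X$ is a forest. Here an algorithm is a program for the unit-cost random access machine whose arithmetic operations are addition and truncated subtraction of natural numbers. The constant $C$, the algorithm and the polynomial do not depend on $k$, $t$ or $G$. -/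

import Mathlib

/-! ### Random access machines

Programs for a unit-cost random access machine with addition and truncated subtraction, but without
multiplication, written with structured control flow. The memory consists of arrays with two
indices; a program is a fixed finite text, so it mentions finitely many arrays only.
Each operation lengthens the largest number in use by at most one bit, and so the machine
and multitape Turing machines simulate each other with polynomial overhead. -/

namespace RAM

/-- A memory state: `m a i j` is the natural number stored in the cell `[i][j]` of the array `a`. -/
abbrev Mem : Type := ℕ → ℕ → ℕ → ℕ

/-- Store `x` in the cell `[i][j]` of the array `a`. -/
def Mem.write (m : Mem) (a i j x : ℕ) : Mem :=
  fun a₁ i₁ j₁ => if a₁ = a ∧ i₁ = i ∧ j₁ = j then x else m a₁ i₁ j₁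

/-- Expressions: constants, reading a cell `[i][j]` of an array (with computed indices `i`, `j`),
addition and truncated subtraction. -/
inductive Expr : Type where
  | lit (c : ℕ)
  | get (a : ℕ) (i j : Expr)
  | add (e₁ e₂ : Expr)
  | sub (e₁ e₂ : Expr)

/-- The value of an expression. -/
def Expr.eval (m : Mem) : Expr → ℕ
  | lit c => c
  | get a i j => m a (i.eval m) (j.eval m)
  | add e₁ e₂ => e₁.eval m + e₂.eval m
  | sub e₁ e₂ => e₁.eval m - e₂.eval m

/-- The number of steps taken to evaluate an expression: one for each operation in it. -/
def Expr.cost : Expr → ℕ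
  | lit _ => 1
  | get _ i j => i.cost + j.cost + 1
  | add e₁ e₂ => e₁.cost + e₂.cost + 1
  | sub e₁ e₂ => e₁.cost + e₂.cost + 1

/-- Programs: do nothing, the assignment `a[i][j] := e`, sequential composition, branching on
whether `e` is nonzero, and repeating `p` as long as `e` is nonzero. -/
inductive Prog : Type where
  | skip
  | set (a : ℕ) (i j e : Expr)
  | seq (p q : Prog)
  | ite (e : Expr) (p q : Prog)
  | loop (e : Expr) (p : Prog)

/-- `Exec p m s m'`: started in the memory state `m`, the program `p` halts after exactly `s` steps
in the memory state `m'`. Each executed command, each test, and each operation in an evaluated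
expression counts. -/
inductive Exec : Prog → Mem → ℕ → Mem → Prop
  | skip (m : Mem) : Exec .skip m 1 m
  | set (m : Mem) (a : ℕ) (i j e : Expr) :
      Exec (.set a i j e) m (i.cost + j.cost + e.cost + 1)
        (m.write a (i.eval m) (j.eval m) (e.eval m))
  | seq {p q : Prog} {m₁ m₂ m₃ : Mem} {s₁ s₂ : ℕ} (h₁ : Exec p m₁ s₁ m₂) (h₂ : Exec q m₂ s₂ m₃) :
      Exec (.seq p q) m₁ (s₁ + s₂) m₃
  | ite_pos {e : Expr} {p q : Prog} {m₁ m₂ : Mem} {s : ℕ} (he : e.eval m₁ ≠ 0)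
      (h : Exec p m₁ s m₂) : Exec (.ite e p q) m₁ (e.cost + 1 + s) m₂
  | ite_neg {e : Expr} {p q : Prog} {m₁ m₂ : Mem} {s : ℕ} (he : e.eval m₁ = 0)
      (h : Exec q m₁ s m₂) : Exec (.ite e p q) m₁ (e.cost + 1 + s) m₂
  | loop_done {e : Expr} {p : Prog} {m : Mem} (he : e.eval m = 0) :
      Exec (.loop e p) m (e.cost + 1) m
  | loop_step {e : Expr} {p : Prog} {m₁ m₂ m₃ : Mem} {s₁ s₂ : ℕ} (he : e.eval m₁ ≠ 0)
      (h₁ : Exec p m₁ s₁ m₂) (h₂ : Exec (.loop e p) m₂ s₂ m₃) :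
      Exec (.loop e p) m₁ (e.cost + 1 + s₁ + s₂) m₃

/-- Started in the memory state `m`, the program `p` halts after at most `T` steps in the memory
state `m'`. -/
def HaltsWithin (p : Prog) (m : Mem) (T : ℕ) (m' : Mem) : Prop :=
  ∃ s ≤ T, Exec p m s m'

end RAM

/-- A family of cycles of `G` (closed walks without repeated vertices, of length at least three)
that is an induced packing: distinct members share no vertex and no edge of `G` joins them. -/
def IsInducedCyclePacking {V : Type*} (G : SimpleGraph V) {k : ℕ}
    (F : Fin k → Σ v : V, G.Walk v v) : Prop :=
  (∀ c, (F c).2.IsCycle) ∧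
    ∀ c d, c ≠ d → ∀ x ∈ (F c).2.support, ∀ y ∈ (F d).2.support, x ≠ y ∧ ¬ G.Adj x y

/-- The initial memory: array `0` holds the number `n` of vertices in its cell `[0][0]`, array `1`
holds `k` in its cell `[0][0]`, array `2` holds the adjacency matrix of `G`, and all other cells
are `0`. -/
def inputMem {n : ℕ} (G : SimpleGraph (Fin n)) [DecidableRel G.Adj] (k : ℕ) : RAM.Mem :=
  fun a i j =>
    if a = 0 ∧ i = 0 ∧ j = 0 then n
    else if a = 1 ∧ i = 0 ∧ j = 0 then k
    else if a = 2 ∧ ∃ u v : Fin n, (u : ℕ) = i ∧ (v : ℕ) = j ∧ G.Adj u v then 1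
    else 0

/-- The final memory `m` answers with the family `F` of `k` cycles: the cell `[0][0]` of array `3`
is `1`, the cell `[0][c]` of array `4` is the length of the cycle number `c`, and the row `c` of
array `5` lists the vertices of that cycle in order, the first one being repeated at the end. -/
def OutputsCycles {n : ℕ} {G : SimpleGraph (Fin n)} {k : ℕ} (m : RAM.Mem)
    (F : Fin k → Σ v : Fin n, G.Walk v v) : Prop :=
  m 3 0 0 = 1 ∧ ∀ c : Fin k, m 4 0 c = (F c).2.length ∧
    ∀ j ≤ (F c).2.length, m 5 c j = ((F c).2.getVert j : ℕ)

/-- The final memory `m` answers with the vertex set `X`: the cell `[0][0]` of array `3` is `0`, and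
the row `0` of array `6` is the characteristic vector of `X`. -/
def OutputsVertexSet {n : ℕ} (m : RAM.Mem) (X : Finset (Fin n)) : Prop :=
  m 3 0 0 = 0 ∧ ∀ v : Fin n, m 6 0 v = if v ∈ X then 1 else 0

/-! Call `U` closed relative to `F` when every vertex of `U` has two neighbours in `U ∪ F`. Relative
to `∅`, a nonempty closed set is one of minimum degree at least two, so `Cyc G ∅ M` says that `M`
contains a cycle; relative to a forest `F`, paths outside `F` attached to `F` at both ends count as
well.

Reduction to bounded degree. An induced subgraph `S` is grown together with a set `X ⊆ S` of marked
vertices, keeping `F = S \ X` acyclic. Let `W` consist of the vertices outside `S` without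
neighbours in `X`. While `W` contains a nonempty closed set relative to `F`, take such a set `P`
that no exchange of two of its vertices for one vertex of `W` keeps cyclic. This local minimality
bounds the degrees around `P` by constants. Add `P` to `S`, and mark one vertex of `P` and all ends
of edges between `P` and `F`, at most 21 vertices (`Frame.step`). Marked vertices get no further
neighbours in `S`, so `S` keeps maximum degree at most 20. At the end `X` and its neighbours meet
every cycle of `G` (`Frame.acyclic_outside`), and there are at most `2 * t * X.card` of them. If `Z`
meets all cycles in `S`, then `X.card ≤ 861 * Z.card` (`Frame.card_le`): each step either adds a
piece not joined to `F`, which needs its own vertex of `Z`, or raises the excess of edges over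
vertices, and in bounded degree this excess is linear in `Z.card`.

Packing in bounded degree. It remains to find `k` cycles in `S`, or a `Z` of size `O(k log k)`. In
the core of what is left, a search tree that measures depth by vertices of degree at least three
branches like a binary tree, so it closes a cycle with logarithmically many such vertices
(`Grown.two_pow_le`, `Grown.close`). Cycle vertices of degree two have no neighbours off the cycle,
so deleting the cycle and its neighbourhood can be charged to logarithmically many vertices
(`IsCycSeq.exists_hits`). If the core is exhausted after `c < k` rounds, the charged vertices form
`Z`. The logarithm is taken of a multiple of `Z.card` itself, and `hits_bound` resolves this
implicit inequality.

Running time. Exchanges shrink `P`, extensions enlarge `S`, rounds shrink the core; each loop runs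
at most `2n + 3` times per entry. The predicate `WP` carries correctness together with a polynomial
time bound read off the program text. -/

namespace CycleCore

set_option linter.unusedSectionVars false

/-! ### Closed sets and cores -/

variable {V : Type*} [DecidableEq V] (G : SimpleGraph V) [DecidableRel G.Adj]

/-- The number of neighbours of `v` in `A`. -/
def nb (A : Finset V) (v : V) : ℕ := (A.filter (G.Adj v)).card

/-- Every vertex of `U` has at least two neighbours in `U ∪ F`. -/
def Closed (F U : Finset V) : Prop := ∀ u ∈ U, 2 ≤ nb G (U ∪ F) u

/-- `M` has a nonempty subset that is closed relative to `F`. -/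
def Cyc (F M : Finset V) : Prop := ∃ U ⊆ M, U.Nonempty ∧ Closed G F U

open Classical in
/-- The largest subset of `M` that is closed relative to `F`. -/
noncomputable def core (F M : Finset V) : Finset V :=
  M.filter fun v => ∃ U ⊆ M, v ∈ U ∧ Closed G F U

/-- Twice the number of edges inside `M` or between `M` and `F`. -/
def en (F M : Finset V) : ℕ := ∑ v ∈ M, (nb G M v + 2 * nb G F v)

variable {G}

theorem nb_mono {A B : Finset V} (h : A ⊆ B) (v : V) : nb G A v ≤ nb G B v :=
  Finset.card_le_card (Finset.filter_subset_filter _ h)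

theorem nb_union {A B : Finset V} (h : Disjoint A B) (v : V) :
    nb G (A ∪ B) v = nb G A v + nb G B v := by
  unfold nb
  rw [Finset.filter_union, Finset.card_union_of_disjoint]
  exact Finset.disjoint_filter_filter h

theorem nb_union_le (A B : Finset V) (v : V) : nb G (A ∪ B) v ≤ nb G A v + nb G B v := by
  unfold nb
  rw [Finset.filter_union]
  exact Finset.card_union_le _ _

theorem nb_insert {A : Finset V} {u : V} (h : u ∉ A) (v : V) :
    nb G (insert u A) v = nb G A v + if G.Adj v u then 1 else 0 := by
  unfold nb
  rw [Finset.filter_insert]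
  split_ifs with hv
  · rw [Finset.card_insert_of_notMem (by simp [h])]
  · rfl

theorem nb_eq_sum (A : Finset V) (v : V) : nb G A v = ∑ u ∈ A, if G.Adj v u then 1 else 0 := by
  unfold nb
  rw [Finset.card_filter]

theorem nb_pos {A : Finset V} {v : V} : 0 < nb G A v ↔ ∃ u ∈ A, G.Adj v u := by
  unfold nb
  rw [Finset.card_pos]
  simp [Finset.Nonempty, Finset.mem_filter]

theorem nb_eq_zero {A : Finset V} {v : V} : nb G A v = 0 ↔ ∀ u ∈ A, ¬ G.Adj v u := by
  unfold nb
  rw [Finset.card_eq_zero, Finset.filter_eq_empty_iff]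

theorem sum_nb_comm (A B : Finset V) : ∑ v ∈ A, nb G B v = ∑ v ∈ B, nb G A v := by
  simp only [nb_eq_sum]
  rw [Finset.sum_comm]
  simp only [G.adj_comm]

theorem nb_le_card (A : Finset V) (v : V) : nb G A v ≤ A.card := Finset.card_filter_le _ _

theorem nb_erase_self (A : Finset V) (v : V) : nb G (A.erase v) v = nb G A v := by
  unfold nb
  congr 1
  ext u
  simp only [Finset.mem_filter, Finset.mem_erase]
  constructor
  · rintro ⟨⟨_, h⟩, h'⟩; exact ⟨h, h'⟩
  · rintro ⟨h, h'⟩; exact ⟨⟨h'.ne', h⟩, h'⟩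

theorem nb_sdiff_add (A Z : Finset V) (v : V) : nb G A v ≤ nb G (A \ Z) v + Z.card := by
  refine (nb_mono (B := (A \ Z) ∪ Z) ?_ v).trans ((nb_union_le _ _ v).trans ?_)
  · intro x hx; by_cases h : x ∈ Z <;> simp [hx, h]
  · exact Nat.add_le_add_left (nb_le_card _ _) _

theorem Cyc.mono {F M M' : Finset V} (h : M ⊆ M') (hc : Cyc G F M) : Cyc G F M' := by
  obtain ⟨U, hU, h1, h2⟩ := hc
  exact ⟨U, hU.trans h, h1, h2⟩

theorem mem_core {F M : Finset V} {v : V} :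
    v ∈ core G F M ↔ v ∈ M ∧ ∃ U ⊆ M, v ∈ U ∧ Closed G F U := by
  simp [core]

theorem core_subset (F M : Finset V) : core G F M ⊆ M := by
  intro v hv
  exact (mem_core.1 hv).1

theorem subset_core {F M U : Finset V} (h : U ⊆ M) (hU : Closed G F U) : U ⊆ core G F M := by
  intro v hv
  exact mem_core.2 ⟨h hv, U, h, hv, hU⟩

/-- Closedness survives unions, since enlarging `U` only adds neighbours, and the core is the union
of all closed subsets. -/
theorem core_closed (F M : Finset V) : Closed G F (core G F M) := by
  intro v hv
  obtain ⟨-, U, h, hv, hU⟩ := mem_core.1 hv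
  exact (hU v hv).trans (nb_mono (Finset.union_subset_union_left (subset_core h hU)) v)

theorem core_nonempty {F M : Finset V} : (core G F M).Nonempty ↔ Cyc G F M := by
  constructor
  · intro h
    exact ⟨_, core_subset F M, h, core_closed F M⟩
  · rintro ⟨U, h, hne, hU⟩
    exact hne.mono (subset_core h hU)

/-- Identifies the outcome of peeling: a closed set that peeling has not brought below the core is
the core. -/
theorem core_eq {F M N : Finset V} (h1 : N ⊆ M) (h2 : Closed G F N)
    (h3 : core G F M ⊆ N) : N = core G F M :=
  (subset_core h1 h2).antisymm h3

/-- Removing a vertex of small degree does not change the core. -/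
theorem core_erase {F M : Finset V} {v : V} (h : nb G (M ∪ F) v ≤ 1) :
    core G F (M.erase v) = core G F M := by
  apply Finset.Subset.antisymm
  · exact subset_core ((core_subset _ _).trans (Finset.erase_subset _ _)) (core_closed _ _)
  · refine subset_core ?_ (core_closed _ _)
    intro u hu
    refine Finset.mem_erase.2 ⟨?_, core_subset _ _ hu⟩
    rintro rfl
    have := core_closed _ _ u hu
    have h2 := nb_mono (G := G)
      (Finset.union_subset_union_left (t := F) (core_subset (G := G) F M)) u
    omega

/-! ### Counting edges in sets with and without cycles -/

/-- An edge inside `M` is counted from both ends and an edge to `F` with factor two, so a new vertex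
contributes twice its number of neighbours, whichever side they lie on. -/
theorem en_insert {F M : Finset V} {u : V} (hM : u ∉ M) (hd : Disjoint (insert u M) F) :
    en G F (insert u M) = en G F M + 2 * nb G (M ∪ F) u := by
  have hd' : Disjoint M F := hd.mono_left (Finset.subset_insert _ _)
  unfold en
  rw [Finset.sum_insert hM, nb_union hd', nb_insert hM]
  have : ∑ v ∈ M, (nb G (insert u M) v + 2 * nb G F v)
      = ∑ v ∈ M, (nb G M v + 2 * nb G F v) + nb G M u := by
    rw [nb_eq_sum M u, ← Finset.sum_add_distrib]
    refine Finset.sum_congr rfl fun v _ => ?_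
    rw [nb_insert hM]
    simp only [G.adj_comm v u]
    ring
  rw [this]
  simp only [SimpleGraph.irrefl, if_false]
  ring

theorem en_erase {F M : Finset V} {u : V} (hM : u ∈ M) (hd : Disjoint M F) :
    en G F M = en G F (M.erase u) + 2 * nb G (M ∪ F) u := by
  have h := en_insert (G := G) (F := F) (M := M.erase u) (u := u) (by simp)
    (by rwa [Finset.insert_erase hM])
  rw [Finset.insert_erase hM] at h
  rw [h]
  congr 2
  have hu : u ∉ F := Finset.disjoint_left.1 hd hM
  rw [← nb_erase_self (M ∪ F) u, Finset.erase_union_distrib, Finset.erase_eq_of_notMem hu]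

/-- `M` can be peeled to the empty set, each time removing a vertex that has at most one neighbour
in the current set and `F`; hence there is at most one edge per vertex. -/
theorem en_le_of_not_cyc {F M : Finset V} (hd : Disjoint M F) (h : ¬ Cyc G F M) :
    en G F M ≤ 2 * M.card := by
  induction M using Finset.strongInduction with
  | H M ih =>
    rcases M.eq_empty_or_nonempty with rfl | hne
    · simp [en]
    · have : ¬ Closed G F M := fun hc => h ⟨M, subset_rfl, hne, hc⟩
      unfold Closed at this
      push Not at this
      obtain ⟨u, hu, hlt⟩ := this
      have h1 := ih (M.erase u) (Finset.erase_ssubset hu) (hd.mono_left (Finset.erase_subset _ _))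
        (fun hc => h (hc.mono (Finset.erase_subset _ _)))
      rw [en_erase hu hd]
      have := Finset.card_erase_add_one hu
      omega

/-- With `F = ∅` the last vertex peeled has no edge left: the bound of a forest, one edge fewer than
vertices. -/
theorem en_add_two_le_of_not_cyc {M : Finset V} (hne : M.Nonempty) (h : ¬ Cyc G ∅ M) :
    en G ∅ M + 2 ≤ 2 * M.card := by
  induction M using Finset.strongInduction with
  | H M ih =>
    have : ¬ Closed G ∅ M := fun hc => h ⟨M, subset_rfl, hne, hc⟩
    unfold Closed at this
    push Not at this
    obtain ⟨u, hu, hlt⟩ := this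
    rw [en_erase hu (by simp)]
    have hcard := Finset.card_erase_add_one hu
    rcases (M.erase u).eq_empty_or_nonempty with he | hne'
    · have h0 : nb G (M ∪ ∅) u = 0 := by
        rw [← nb_erase_self, Finset.union_empty, he]; simp [nb]
      rw [h0, he]; rw [he] at hcard; simp [en] at *; omega
    · have h1 := ih (M.erase u) (Finset.erase_ssubset hu) hne'
        (fun hc => h (hc.mono (Finset.erase_subset _ _)))
      omega

theorem en_empty (M : Finset V) : en G ∅ M = ∑ v ∈ M, nb G M v := by simp [en, nb]

theorem en_eq_sum_add {F M : Finset V} (hd : Disjoint M F) :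
    en G F M = ∑ v ∈ M, nb G (M ∪ F) v + ∑ v ∈ M, nb G F v := by
  unfold en
  rw [← Finset.sum_add_distrib]
  refine Finset.sum_congr rfl fun v _ => ?_
  rw [nb_union hd]; ring

/-- The degree sum counts edges to `F` only once whereas `en` counts them twice; this surplus makes
a piece attached to `F` raise the edge excess. -/
theorem Closed.le_en {F P : Finset V} (hd : Disjoint P F) (h : Closed G F P) :
    2 * P.card + ∑ v ∈ P, nb G F v ≤ en G F P := by
  rw [en_eq_sum_add hd]
  have := Finset.card_nsmul_le_sum P (fun v => nb G (P ∪ F) v) 2 h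
  simp only [smul_eq_mul] at this
  omega

theorem en_union {A B : Finset V} (hd : Disjoint A B) :
    en G ∅ (A ∪ B) = en G ∅ A + en G A B := by
  rw [en_empty, en_empty, Finset.sum_union hd]
  unfold en
  simp only [nb_union hd, Finset.sum_add_distrib, ← Finset.mul_sum]
  rw [sum_nb_comm A B]
  ring

/-- A set of vertices that meets every closed subset of `S` bounds the number of edges. -/
theorem en_le_of_hits {S Z : Finset V} {D : ℕ} (hD : ∀ s ∈ S, nb G S s ≤ D)
    (hZ : ¬ Cyc G ∅ (S \ Z)) : en G ∅ S ≤ 2 * S.card + 2 * D * Z.card := by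
  have h1 := en_le_of_not_cyc (by simp) hZ
  have hu : (S \ Z) ∪ (S ∩ Z) = S := Finset.sdiff_union_inter S Z
  have hd : Disjoint (S \ Z) (S ∩ Z) := Finset.disjoint_sdiff_inter S Z
  have h2 := en_union (G := G) hd
  rw [hu] at h2
  have h3 : en G (S \ Z) (S ∩ Z) ≤ 2 * (D * (S ∩ Z).card) := by
    have : ∀ v ∈ S ∩ Z, nb G (S ∩ Z) v + 2 * nb G (S \ Z) v ≤ 2 * D := by
      intro v hv
      have h := hD v (Finset.mem_inter.1 hv).1
      rw [← hu, nb_union hd] at h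
      omega
    refine (Finset.sum_le_card_nsmul _ _ _ this).trans (le_of_eq ?_)
    rw [smul_eq_mul]; ring
  have h4 : (S ∩ Z).card ≤ Z.card := Finset.card_le_card Finset.inter_subset_right
  have h5 : (S \ Z).card ≤ S.card := Finset.card_le_card Finset.sdiff_subset
  have h6 : D * (S ∩ Z).card ≤ D * Z.card := Nat.mul_le_mul_left _ h4
  rw [mul_assoc]
  omega

/-! ### Locally minimal closed sets have bounded degrees -/

/-- `P` is a subset of `W` with nonempty core (relative to `F`), and exchanging two of its vertices
for one vertex of `W` destroys the core. -/
structure LocMin (G : SimpleGraph V) [DecidableRel G.Adj] (F W P : Finset V) : Prop where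
  sub : P ⊆ W
  cyc : Cyc G F P
  exch : ∀ p₁ ∈ P, ∀ p₂ ∈ P, p₁ ≠ p₂ → ∀ w ∈ W,
    ¬ Cyc G F (insert w ((P.erase p₁).erase p₂))

theorem not_cyc_empty (F : Finset V) : ¬ Cyc G F ∅ := by
  rintro ⟨U, hU, hne, -⟩
  exact hne.ne_empty (Finset.subset_empty.1 hU)

/-- Deleting one vertex is the degenerate exchange that removes `p` and `q` and puts `q` back. -/
theorem LocMin.not_cyc_erase {F W P : Finset V} (h : LocMin G F W P) {p : V} (hp : p ∈ P) :
    ¬ Cyc G F (P.erase p) := by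
  rcases (P.erase p).eq_empty_or_nonempty with he | ⟨q, hq⟩
  · rw [he]; exact not_cyc_empty F
  · have hq' := Finset.mem_erase.1 hq
    have := h.exch p hp q hq'.2 hq'.1.symm q (h.sub hq'.2)
    rwa [Finset.insert_erase hq] at this

/-- A nonempty closed subset of `P` cannot miss a vertex of `P`, so it is all of `P`. -/
theorem LocMin.closed {F W P : Finset V} (h : LocMin G F W P) : Closed G F P := by
  obtain ⟨U, hU, hne, hc⟩ := h.cyc
  have : U = P := by
    by_contra hne'
    obtain ⟨p, hp, hpU⟩ := Finset.exists_of_ssubset (hU.ssubset_of_ne hne')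
    exact h.not_cyc_erase hp ⟨U, fun x hx => Finset.mem_erase.2 ⟨fun e => hpU (e ▸ hx), hU hx⟩,
      hne, hc⟩
  rwa [this] at hc

/-- A vertex `w` with two neighbours in `F` is closed by itself, and could replace any two vertices
of `P`. -/
theorem LocMin.nb_le_one {F W P : Finset V} (h : LocMin G F W P) (hP : 2 ≤ P.card) {w : V}
    (hw : w ∈ W) : nb G F w ≤ 1 := by
  by_contra hlt
  obtain ⟨p₁, hp₁, p₂, hp₂, hne⟩ := Finset.one_lt_card.1 hP
  refine h.exch p₁ hp₁ p₂ hp₂ hne w hw ⟨{w}, by simp, by simp, ?_⟩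
  intro u hu
  rw [Finset.mem_singleton.1 hu]
  have := nb_mono (G := G) (Finset.subset_union_right (s₁ := {w}) (s₂ := F)) w
  omega

/-- Without `q` at most one edge per vertex remains, so all edges of `P` beyond that are at `q`: one
vertex of small degree bounds the total degree excess of `P` and its number of edges to `F`. -/
theorem LocMin.sum_le {F W P : Finset V} (h : LocMin G F W P) (hd : Disjoint W F) {q : V}
    (hq : q ∈ P) : ∑ v ∈ P, nb G (P ∪ F) v + ∑ v ∈ P, nb G F v + 2 ≤
      2 * P.card + 2 * nb G (P ∪ F) q := by
  have hd' := hd.mono_left h.sub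
  have h1 := en_le_of_not_cyc (hd'.mono_left (Finset.erase_subset q P)) (h.not_cyc_erase hq)
  have h2 := en_erase (G := G) hq hd'
  rw [en_eq_sum_add hd'] at h2
  have := Finset.card_erase_add_one hq
  omega

/-- For at most four vertices the bounds are trivial, given at most one neighbour in `F` each.
Otherwise some vertex has degree two, and `sum_le` for it leaves a total excess of at most two. -/
theorem LocMin.degree_le_of_two_le {F W P : Finset V} (h : LocMin G F W P) (hd : Disjoint W F)
    (hP : 2 ≤ P.card) {p : V} (hp : p ∈ P) :
    nb G (P ∪ F) p ≤ 4 ∧ ∑ v ∈ P, nb G F v ≤ 4 := by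
  have hd' := hd.mono_left h.sub
  have hF : ∀ v ∈ P, nb G F v ≤ 1 := fun v hv => h.nb_le_one hP (h.sub hv)
  have hle : ∀ v ∈ P, nb G (P ∪ F) v ≤ P.card := by
    intro v hv
    have h1 := nb_le_card (G := G) (P.erase v) v
    rw [nb_erase_self] at h1
    have := Finset.card_erase_add_one hv
    have := hF v hv
    rw [nb_union hd']
    omega
  have hcr : ∑ v ∈ P, nb G F v ≤ P.card := by
    simpa using Finset.sum_le_card_nsmul P (fun v => nb G F v) 1 hF
  by_cases h4 : P.card ≤ 4
  · exact ⟨(hle p hp).trans h4, hcr.trans h4⟩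
  -- If the least degree were `d ≥ 3`, then `sum_le` at a vertex of degree `d` would give `(|P| -
  -- 2)(d - 2) ≤ 2`, which is impossible for `|P| ≥ 5`.
  have hq : ∃ q ∈ P, nb G (P ∪ F) q ≤ 2 := by
    by_contra hno
    push Not at hno
    obtain ⟨q, hq, hmin⟩ := Finset.exists_min_image P (fun v => nb G (P ∪ F) v) ⟨p, hp⟩
    have h1 := h.sum_le hd hq
    have h2 := Finset.card_nsmul_le_sum P (fun v => nb G (P ∪ F) v) _ hmin
    rw [smul_eq_mul] at h2
    have h3 := hno q hq
    obtain ⟨c, hc⟩ := Nat.exists_eq_add_of_le (show 5 ≤ P.card by omega)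
    obtain ⟨d, hd⟩ := Nat.exists_eq_add_of_le (show 3 ≤ nb G (P ∪ F) q by omega)
    rw [hd, hc] at h1 h2
    have h5 : (5 + c) * (3 + d) = 15 + 5 * d + 3 * c + c * d := by ring
    rw [h5] at h2
    omega
  obtain ⟨q, hq, hq2⟩ := hq
  have h1 := h.sum_le hd hq
  have h2 := Finset.add_sum_erase P (fun v => nb G (P ∪ F) v) hp
  have h3 := Finset.card_nsmul_le_sum (P.erase p) (fun v => nb G (P ∪ F) v) 2
    (fun v hv => h.closed v (Finset.mem_of_mem_erase hv))
  have := Finset.card_erase_add_one hp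
  simp only [smul_eq_mul] at h2 h3
  omega

/-- `P` has `en` at least `2|P|`. Deleting two vertices of degree at most 4 lowers it by at most 16,
and after adding `w` it may be at most `2(|P| - 1)`. So `w` sends at most 7 edges to the rest, and
at most 2 to the deleted vertices. -/
theorem LocMin.nb_le_nine {F W P : Finset V} (h : LocMin G F W P) (hd : Disjoint W F)
    (hP : 2 ≤ P.card) {w : V} (hw : w ∈ W) (hwP : w ∉ P) : nb G P w ≤ 9 := by
  obtain ⟨p₁, hp₁, p₂, hp₂, hne⟩ := Finset.one_lt_card.1 hP
  have hp₂' : p₂ ∈ P.erase p₁ := Finset.mem_erase.2 ⟨hne.symm, hp₂⟩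
  have hd' := hd.mono_left h.sub
  have hd₁ := hd'.mono_left (Finset.erase_subset p₁ P)
  have hd₂ := hd₁.mono_left (Finset.erase_subset p₂ (P.erase p₁))
  have hsub : (P.erase p₁).erase p₂ ⊆ P := (Finset.erase_subset _ _).trans (Finset.erase_subset _ _)
  have hdi : Disjoint (insert w ((P.erase p₁).erase p₂)) F := by
    refine hd.mono_left ?_
    exact Finset.insert_subset hw (hsub.trans h.sub)
  have h1 := en_le_of_not_cyc hdi (h.exch p₁ hp₁ p₂ hp₂ hne w hw)
  have hwn : w ∉ (P.erase p₁).erase p₂ := fun hh => hwP (hsub hh)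
  rw [en_insert hwn hdi, Finset.card_insert_of_notMem hwn] at h1
  have h2 := en_erase (G := G) hp₁ hd'
  have h3 := en_erase (G := G) hp₂' hd₁
  have h4 := h.closed.le_en hd'
  have h5 := (h.degree_le_of_two_le hd hP hp₁).1
  have h6 := (h.degree_le_of_two_le hd hP hp₂).1
  have h7 := nb_mono (G := G)
    (Finset.union_subset_union_left (t := F) (Finset.erase_subset p₁ P)) p₂
  have h8 : nb G P w ≤ nb G ((P.erase p₁).erase p₂ ∪ F) w + 2 := by
    have := nb_sdiff_add (G := G) P {p₁, p₂} w
    have hc : ({p₁, p₂} : Finset V).card ≤ 2 := Finset.card_le_two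
    have hs : P \ {p₁, p₂} ⊆ (P.erase p₁).erase p₂ ∪ F := by
      intro x; simp; tauto
    have := nb_mono (G := G) hs w
    omega
  have := Finset.card_erase_add_one hp₁
  have := Finset.card_erase_add_one hp₂'
  omega

/-! ### The bounded-degree frame and its marked vertices -/

variable (G) in
/-- The invariant of the construction of an induced subgraph `S` of bounded degree with a set `X` of
marked vertices. -/
structure Frame (S X : Finset V) : Prop where
  sub : X ⊆ S
  acyc : ¬ Cyc G ∅ (S \ X)
  deg_free : ∀ s ∈ S \ X, nb G S s ≤ 10
  deg : ∀ s ∈ S, nb G S s ≤ 20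
  out : ∀ w, w ∉ S → nb G X w = 0 → nb G (S \ X) w ≤ 10
  count : ∃ e f : ℕ, X.card ≤ 21 * (e + f) ∧ 2 * S.card + e ≤ en G ∅ S ∧
    ∀ Z, ¬ Cyc G ∅ (S \ Z) → f ≤ (Z ∩ S).card

theorem Frame.empty : Frame G ∅ ∅ where
  sub := subset_rfl
  acyc := by simpa using not_cyc_empty (G := G) (∅ : Finset V)
  deg_free := by simp
  deg := by simp
  out := by simp [nb]
  count := ⟨0, 0, by simp, by simp [en], by simp⟩

/-- Degrees at most 20 give `e ≤ 40 * Z.card`, and `f ≤ Z.card`; hence the factor `861 = 21 * 41`.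
-/
theorem Frame.card_le {S X : Finset V} (h : Frame G S X) {Z : Finset V}
    (hZ : ¬ Cyc G ∅ (S \ Z)) : X.card ≤ 861 * Z.card := by
  obtain ⟨e, f, h1, h2, h3⟩ := h.count
  have h4 := en_le_of_hits h.deg hZ
  have h5 := h3 Z hZ
  have h6 : (Z ∩ S).card ≤ Z.card := Finset.card_le_card Finset.inter_subset_left
  omega

/-- Marking both ends of every edge between `P` and the free part keeps the free part a disjoint
union of an old forest and a proper part of `P`, with no edges between them. Free vertices keep
degree at most 10; a vertex that gains neighbours gains at most 10 and becomes marked, and marked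
vertices gain none because `W` avoids the neighbours of `X`. -/
theorem Frame.step {S X P W : Finset V} {p : V} (h : Frame G S X)
    (hW : ∀ w, w ∈ W ↔ w ∉ S ∧ nb G X w = 0) (hP : LocMin G (S \ X) W P) (hp : p ∈ P) :
    Frame G (S ∪ P) (insert p (X ∪ (P.filter (fun v => 0 < nb G (S \ X) v) ∪
      (S \ X).filter (fun v => 0 < nb G P v)))) := by
  obtain ⟨F, hF⟩ : ∃ F, F = S \ X := ⟨_, rfl⟩
  rw [← hF] at hP ⊢
  have hFS : F ⊆ S := by rw [hF]; exact Finset.sdiff_subset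
  have hdW : Disjoint W F := by
    rw [Finset.disjoint_left]
    intro w hw hwF
    exact ((hW w).1 hw).1 (hFS hwF)
  have hdP : Disjoint P F := hdW.mono_left hP.sub
  have hPS : Disjoint S P := by
    rw [Finset.disjoint_right]
    intro w hw
    exact ((hW w).1 (hP.sub hw)).1
  have hPX : ∀ v ∈ P, nb G X v = 0 := fun v hv => ((hW v).1 (hP.sub hv)).2
  have hSFX : S = F ∪ X := by rw [hF, Finset.sdiff_union_of_subset h.sub]
  have hdFX : Disjoint F X := by rw [hF]; exact Finset.sdiff_disjoint
  have hnbS : ∀ v ∈ P, nb G S v = nb G F v := by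
    intro v hv
    rw [hSFX, nb_union hdFX, hPX v hv, add_zero]
  have hXP : ∀ v ∈ X, nb G P v = 0 := by
    intro v hv
    rw [nb_eq_zero]
    intro u hu ha
    exact nb_eq_zero.1 (hPX u hu) v hv ha.symm
  -- bounds on degrees
  have hone : P.card = 1 → P = {p} := by
    intro hc
    obtain ⟨q, rfl⟩ := Finset.card_eq_one.1 hc
    rw [Finset.mem_singleton.1 hp]
  have hPpos : 0 < P.card := Finset.card_pos.2 ⟨p, hp⟩
  have hpout : ∀ w ∈ W, nb G F w ≤ 10 := by
    intro w hw
    rw [hF]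
    exact h.out w ((hW w).1 hw).1 ((hW w).1 hw).2
  -- A single-vertex `P` is not covered by the local minimality bounds; there the field `out` limits
  -- the neighbours in `F` to 10.
  have hdeg : (∀ v ∈ P, nb G (P ∪ F) v ≤ 10) ∧ ∑ v ∈ P, nb G F v ≤ 10 := by
    by_cases h2 : 2 ≤ P.card
    · refine ⟨fun v hv => ((hP.degree_le_of_two_le hdW h2 hv).1).trans (by norm_num), ?_⟩
      exact ((hP.degree_le_of_two_le hdW h2 hp).2).trans (by norm_num)
    · have hs := hone (by omega)
      have hb := hpout p (hP.sub hp)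
      refine ⟨fun v hv => ?_, by rw [hs]; simpa using hb⟩
      rw [hs] at hv ⊢
      rw [Finset.mem_singleton.1 hv, ← Finset.insert_eq, nb_insert]
      · simpa using hb
      · exact Finset.disjoint_left.1 hdP hp
  obtain ⟨hdeg, hcross⟩ := hdeg
  have hcross' : ∑ v ∈ F, nb G P v ≤ 10 := by rwa [← sum_nb_comm]
  have hFP : ∀ v ∈ F, nb G P v ≤ 10 := fun v hv =>
    (Finset.single_le_sum (f := fun v => nb G P v) (fun _ _ => Nat.zero_le _) hv).trans hcross'
  obtain ⟨X', hX'⟩ : ∃ X', X' = insert p (X ∪ (P.filter (fun v => 0 < nb G F v) ∪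
      F.filter (fun v => 0 < nb G P v))) := ⟨_, rfl⟩
  rw [← hX']
  have memX' : ∀ v, v ∈ X' ↔ v = p ∨ v ∈ X ∨ (v ∈ P ∧ 0 < nb G F v) ∨ (v ∈ F ∧ 0 < nb G P v) := by
    intro v; rw [hX']; simp
  have hXX' : X ⊆ X' := fun v hv => (memX' v).2 (Or.inr (Or.inl hv))
  have hfree : ∀ v, v ∈ (S ∪ P) \ X' → (v ∈ P ∧ v ≠ p ∧ nb G F v = 0) ∨ (v ∈ F ∧ nb G P v = 0) := by
    intro v hv
    have hv' := Finset.mem_sdiff.1 hv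
    rw [memX'] at hv'
    push Not at hv'
    obtain ⟨h1, h2, h3, h4, h5⟩ := hv'
    rcases Finset.mem_union.1 h1 with h1 | h1
    · have hvF : v ∈ F := by rw [hF]; exact Finset.mem_sdiff.2 ⟨h1, h3⟩
      exact Or.inr ⟨hvF, Nat.le_zero.1 (h5 hvF)⟩
    · exact Or.inl ⟨h1, h2, Nat.le_zero.1 (h4 h1)⟩
  have hPnb : ∀ v ∈ P, nb G (S ∪ P) v ≤ 10 := by
    intro v hv
    have := hdeg v hv
    rw [nb_union hPS, hnbS v hv]
    rw [nb_union hdP] at this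
    omega
  refine ⟨?_, ?_, ?_, ?_, ?_, ?_⟩
  · intro v hv
    rcases (memX' v).1 hv with rfl | hv | hv | hv
    · exact Finset.mem_union_right _ hp
    · exact Finset.mem_union_left _ (h.sub hv)
    · exact Finset.mem_union_right _ hv.1
    · exact Finset.mem_union_left _ (hFS hv.1)
  · rintro ⟨U, hU, hne, hc⟩
    -- No edge joins the free vertices of `P` to those of `F`, so each part of a closed set is
    -- closed by itself; the part in `P` misses `p`.
    by_cases hUP : (U ∩ P).Nonempty
    · refine hP.not_cyc_erase hp ⟨U ∩ P, ?_, hUP, ?_⟩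
      · intro v hv
        have hv' := Finset.mem_inter.1 hv
        rcases hfree v (hU hv'.1) with h1 | h1
        · exact Finset.mem_erase.2 ⟨h1.2.1, h1.1⟩
        · exact absurd h1.1 (Finset.disjoint_left.1 hdP hv'.2)
      · intro v hv
        have hv' := Finset.mem_inter.1 hv
        refine (hc v hv'.1).trans ?_
        unfold nb
        refine Finset.card_le_card ?_
        intro u hu
        simp only [Finset.union_empty, Finset.mem_filter] at hu
        simp only [Finset.mem_filter, Finset.mem_union, Finset.mem_inter]
        refine ⟨?_, hu.2⟩
        rcases hfree u (hU hu.1) with h1 | h1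
        · exact Or.inl ⟨hu.1, h1.1⟩
        · exact Or.inr h1.1
    · rw [Finset.not_nonempty_iff_eq_empty] at hUP
      refine h.acyc ⟨U, ?_, hne, hc⟩
      intro v hv
      rcases hfree v (hU hv) with h1 | h1
      · have : v ∈ U ∩ P := Finset.mem_inter.2 ⟨hv, h1.1⟩
        rw [hUP] at this
        simp at this
      · rw [← hF]; exact h1.1
  · intro v hv
    rcases hfree v hv with h1 | h1
    · exact hPnb v h1.1
    · rw [nb_union hPS, h1.2]
      exact h.deg_free v (hF ▸ h1.1)
  · intro v hv
    rcases Finset.mem_union.1 hv with h1 | h1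
    · rw [nb_union hPS]
      by_cases hvX : v ∈ X
      · rw [hXP v hvX]; exact h.deg v h1
      · have hvF : v ∈ F := by rw [hF]; exact Finset.mem_sdiff.2 ⟨h1, hvX⟩
        have := h.deg_free v (hF ▸ hvF)
        have := hFP v hvF
        omega
    · exact (hPnb v h1).trans (by norm_num)
  · intro w hw hwX
    have hwS : w ∉ S := fun hh => hw (Finset.mem_union_left _ hh)
    have hwP : w ∉ P := fun hh => hw (Finset.mem_union_right _ hh)
    have hwX0 : nb G X w = 0 := Nat.le_zero.1 ((nb_mono hXX' w).trans hwX.le)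
    have hwW : w ∈ W := (hW w).2 ⟨hwS, hwX0⟩
    by_cases h2 : 2 ≤ P.card
    · have hs : (S ∪ P) \ X' ⊆ P ∪ F := by
        intro v hv
        rcases hfree v hv with h1 | h1
        · exact Finset.mem_union_left _ h1.1
        · exact Finset.mem_union_right _ h1.1
      refine (nb_mono hs w).trans ?_
      rw [nb_union hdP]
      have := hP.nb_le_one h2 hwW
      have := hP.nb_le_nine hdW h2 hwW hwP
      omega
    -- If `P = {p}`, its only vertex is marked, so nothing new becomes free and the old bound
    -- persists.
    · have hs : (S ∪ P) \ X' ⊆ F := by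
        intro v hv
        rcases hfree v hv with h1 | h1
        · have := h1.1
          rw [hone (by omega)] at this
          exact absurd (Finset.mem_singleton.1 this) h1.2.1
        · exact h1.1
      exact (nb_mono hs w).trans (hpout w hwW)
  · obtain ⟨e, f, h1, h2, h3⟩ := h.count
    -- One vertex `p`, and at most 10 ends of crossing edges on either side.
    have hcard : X'.card ≤ X.card + 21 := by
      have hA : (P.filter (fun v => 0 < nb G F v)).card ≤ 10 := by
        refine le_trans ?_ hcross
        rw [Finset.card_filter]
        refine Finset.sum_le_sum fun v _ => ?_
        split_ifs <;> omega
      have hB : (F.filter (fun v => 0 < nb G P v)).card ≤ 10 := by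
        refine le_trans ?_ hcross'
        rw [Finset.card_filter]
        refine Finset.sum_le_sum fun v _ => ?_
        split_ifs <;> omega
      rw [hX']
      refine (Finset.card_insert_le _ _).trans ?_
      have := Finset.card_union_le X (P.filter (fun v => 0 < nb G F v) ∪
        F.filter (fun v => 0 < nb G P v))
      have := Finset.card_union_le (P.filter (fun v => 0 < nb G F v))
        (F.filter (fun v => 0 < nb G P v))
      omega
    have hcS : (S ∪ P).card = S.card + P.card := Finset.card_union_of_disjoint hPS
    have hen : en G ∅ (S ∪ P) = en G ∅ S + en G F P := by
      rw [Finset.union_comm, en_union hPS.symm]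
      have : ∀ A B : Finset V, en G B A = en G ∅ A + 2 * ∑ v ∈ A, nb G B v := by
        intro A B
        rw [en_empty, en, Finset.sum_add_distrib, Finset.mul_sum]
      have e1 := en_union (G := G) hPS.symm
      have e2 := en_union (G := G) hPS
      rw [Finset.union_comm] at e2
      rw [this P F, ← Finset.sum_congr rfl hnbS, ← this P S]
      omega
    have hcl := hP.closed.le_en hdP
    have hmono : ∀ Z, ¬ Cyc G ∅ ((S ∪ P) \ Z) → ¬ Cyc G ∅ (S \ Z) := by
      intro Z hZ hcy
      exact hZ (hcy.mono (Finset.sdiff_subset_sdiff Finset.subset_union_left subset_rfl))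
    -- Without edges to `F` the set `P` is closed on its own and needs a vertex of `Z`, raising `f`;
    -- with such an edge the excess `e` rises.
    by_cases hc0 : ∑ v ∈ P, nb G F v = 0
    · refine ⟨e, f + 1, by omega, by omega, fun Z hZ => ?_⟩
      have h4 := h3 Z (hmono Z hZ)
      have h5 : (Z ∩ P).Nonempty := by
        by_contra hno
        rw [Finset.not_nonempty_iff_eq_empty] at hno
        refine hZ ⟨P, ?_, ⟨p, hp⟩, ?_⟩
        · intro v hv
          refine Finset.mem_sdiff.2 ⟨Finset.mem_union_right _ hv, fun hvZ => ?_⟩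
          have : v ∈ Z ∩ P := Finset.mem_inter.2 ⟨hvZ, hv⟩
          rw [hno] at this
          simp at this
        · intro v hv
          have := hP.closed v hv
          rw [nb_union hdP, Finset.sum_eq_zero_iff.1 hc0 v hv] at this
          simpa using this
      have h6 : (Z ∩ (S ∪ P)).card = (Z ∩ S).card + (Z ∩ P).card := by
        rw [Finset.inter_union_distrib_left, Finset.card_union_of_disjoint]
        exact hPS.mono Finset.inter_subset_right Finset.inter_subset_right
      have := Finset.card_pos.2 h5
      omega
    · refine ⟨e + 1, f, by omega, by omega, fun Z hZ => ?_⟩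
      refine (h3 Z (hmono Z hZ)).trans (Finset.card_le_card ?_)
      exact Finset.inter_subset_inter subset_rfl Finset.subset_union_left

/-- When no further step is possible, the neighbourhood of `X` meets all cycles. -/
theorem Frame.acyclic_outside {S X W U : Finset V} (h : Frame G S X)
    (hW : ∀ w, w ∈ W ↔ w ∉ S ∧ nb G X w = 0) (hno : ¬ Cyc G (S \ X) W)
    (hU : ∀ u ∈ U, u ∉ X ∧ nb G X u = 0) : ¬ Cyc G ∅ U := by
  rintro ⟨U', hU', hne, hc⟩
  by_cases hUW : (U' ∩ W).Nonempty
  -- All of `U'` lies in `(S \ X) ∪ W`, so its part in `W` is closed relative to `S \ X`.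
  · refine hno ⟨U' ∩ W, Finset.inter_subset_right, hUW, ?_⟩
    intro v hv
    refine (hc v (Finset.mem_inter.1 hv).1).trans (nb_mono ?_ v)
    intro u hu
    rw [Finset.union_empty] at hu
    have h1 := hU u (hU' hu)
    by_cases huS : u ∈ S
    · exact Finset.mem_union_right _ (Finset.mem_sdiff.2 ⟨huS, h1.1⟩)
    · exact Finset.mem_union_left _ (Finset.mem_inter.2 ⟨hu, (hW u).2 ⟨huS, h1.2⟩⟩)
  · rw [Finset.not_nonempty_iff_eq_empty] at hUW
    refine h.acyc ⟨U', ?_, hne, hc⟩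
    intro u hu
    have h1 := hU u (hU' hu)
    by_contra hn
    have huS : u ∉ S := fun hh => hn (Finset.mem_sdiff.2 ⟨hh, h1.1⟩)
    have : u ∈ U' ∩ W := Finset.mem_inter.2 ⟨hu, (hW u).2 ⟨huS, h1.2⟩⟩
    rw [hUW] at this
    simp at this

/-! ### Vertices of degree at least three -/

variable (G) in
/-- The vertices of degree at least three in the subgraph induced on `A`. -/
def branch (A : Finset V) : Finset V := A.filter fun v => 3 ≤ nb G A v

variable (G) in
/-- The weight of a vertex: one for the vertices of degree at least three, zero for the others. -/
def wt (A : Finset V) (v : V) : ℕ := if 3 ≤ nb G A v then 1 else 0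

theorem wt_le_one (A : Finset V) (v : V) : wt G A v ≤ 1 := by
  unfold wt; split_ifs <;> omega

theorem card_branch_inter (A B : Finset V) :
    (B ∩ branch G A).card ≤ ∑ v ∈ B, wt G A v := by
  have : B ∩ branch G A ⊆ B.filter fun v => 3 ≤ nb G A v := by
    intro v
    simp only [branch, Finset.mem_inter, Finset.mem_filter]
    tauto
  refine (Finset.card_le_card this).trans ?_
  rw [Finset.card_filter]
  rfl

/-- A closed subset of `A \ Z` is a closed subset of `A`, hence lies in the core: passing to the
core loses no cycle. -/
theorem Cyc.of_core {A Z : Finset V} (h : Cyc G ∅ (A \ Z)) : Cyc G ∅ (core G ∅ A \ Z) := by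
  obtain ⟨U, hU, hne, hc⟩ := h
  refine ⟨U, ?_, hne, hc⟩
  have h1 : U ⊆ core G ∅ A := subset_core (hU.trans Finset.sdiff_subset) hc
  intro u hu
  exact Finset.mem_sdiff.2 ⟨h1 hu, (Finset.mem_sdiff.1 (hU hu)).2⟩

/-- In a closed set every branch vertex adds one to a degree sum of at least `2|A|`, while a hitting
set `Z` limits this sum to `2|A| + 40|Z|`. -/
theorem card_branch_le {A Z : Finset V} (hA : Closed G ∅ A) (hD : ∀ v ∈ A, nb G A v ≤ 20)
    (hZ : ¬ Cyc G ∅ (A \ Z)) : (branch G A).card ≤ 40 * Z.card := by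
  have h1 := en_le_of_hits hD hZ
  rw [en_empty] at h1
  have h2 : ∑ v ∈ A, (2 + if 3 ≤ nb G A v then 1 else 0) ≤ ∑ v ∈ A, nb G A v := by
    refine Finset.sum_le_sum fun v hv => ?_
    have := hA v hv
    rw [Finset.union_empty] at this
    split_ifs <;> omega
  rw [Finset.sum_add_distrib, ← Finset.card_filter, Finset.sum_const, smul_eq_mul] at h2
  unfold branch
  omega

/-! ### Search trees measured by branch vertices -/

/-- A search tree on `B` inside `A` with root `r`; `dep v` is the number of vertices of degree at
least three on the path from the root to `v`, the root excluded. All vertices that are adjacent to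
`B` have depth at least `d`, and those of `B` at most `d`. -/
structure GrownBy (G : SimpleGraph V) [DecidableRel G.Adj] (A B : Finset V) (r : V) (dep : V → ℕ)
    (d : ℕ) (par : V → V) (anc : V → Finset V) : Prop where
  sub : B ⊆ A
  root : r ∈ B
  par_mem : ∀ v ∈ B, v ≠ r → par v ∈ B
  dep_par : ∀ v ∈ B, v ≠ r → dep v = dep (par v) + wt G A v
  edge : ∀ u ∈ B, ∀ v ∈ B, G.Adj u v → (u ≠ r ∧ par u = v) ∨ (v ≠ r ∧ par v = u)
  anc_self : ∀ v ∈ B, v ∈ anc v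
  anc_sub : ∀ v ∈ B, anc v ⊆ B
  anc_par : ∀ v ∈ B, ∀ x ∈ anc v, x ≠ r → par x ∈ anc v
  anc_wt : ∀ v ∈ B, ∑ x ∈ anc v, wt G A x ≤ dep v + 1
  anc_lt : ∀ v ∈ B, v ≠ r → (anc (par v)).card < (anc v).card
  dep_le : ∀ v ∈ B, dep v ≤ d
  le_key : ∀ u ∈ B, ∀ w ∈ A, w ∉ B → G.Adj u w → d ≤ dep u + wt G A w
  dep_lt : ∀ v ∈ B, dep v < B.card
  en_eq : en G ∅ B + 2 = 2 * B.card

/-- There is a search tree as in `GrownBy`. -/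
def Grown (G : SimpleGraph V) [DecidableRel G.Adj] (A B : Finset V) (r : V) (dep : V → ℕ)
    (d : ℕ) : Prop := ∃ par anc, GrownBy G A B r dep d par anc

theorem Grown.init {A : Finset V} {r : V} (hr : r ∈ A) (dep : V → ℕ) (h0 : dep r = 0) :
    Grown G A {r} r dep 0 := by
  refine ⟨id, fun _ => {r}, ?_⟩
  constructor <;> simp_all [wt_le_one, en, nb]

/-- The depth array in memory may contain anything outside the tree. -/
theorem Grown.congr {A B : Finset V} {r : V} {dep dep' : V → ℕ} {d : ℕ}
    (h : Grown G A B r dep d) (he : ∀ v ∈ B, dep v = dep' v) : Grown G A B r dep' d := by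
  obtain ⟨par, anc, h⟩ := h
  refine ⟨par, anc, ?_⟩
  constructor
  case dep_par => intro v hv hr; rw [← he v hv, ← he _ (h.par_mem v hv hr)]; exact h.dep_par v hv hr
  case anc_wt => intro v hv; rw [← he v hv]; exact h.anc_wt v hv
  case dep_le => intro v hv; rw [← he v hv]; exact h.dep_le v hv
  case le_key => intro v hv; rw [← he v hv]; exact h.le_key v hv
  case dep_lt => intro v hv; rw [← he v hv]; exact h.dep_lt v hv
  all_goals first
    | exact h.sub | exact h.root | exact h.par_mem | exact h.edge | exact h.anc_self
    | exact h.anc_sub | exact h.anc_par | exact h.anc_lt | exact h.en_eq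

theorem Grown.level {A B : Finset V} {r : V} {dep : V → ℕ} {d : ℕ} (h : Grown G A B r dep d)
    (hn : ∀ u ∈ B, ∀ w ∈ A, w ∉ B → G.Adj u w → d < dep u + wt G A w) :
    Grown G A B r dep (d + 1) := by
  obtain ⟨par, anc, h⟩ := h
  exact ⟨par, anc,
    { h with dep_le := fun v hv => (h.dep_le v hv).trans (Nat.le_succ d), le_key := hn }⟩

theorem update_eq {B : Finset V} {w : V} (hw : w ∉ B) {β : Type*} (f : V → β) (b : β) :
    ∀ v ∈ B, Function.update f w b v = f v :=
  fun v hv => Function.update_of_ne (fun e : v = w => hw (e ▸ hv)) _ _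

theorem sum_biUnion_le' (s : Finset V) (t : V → Finset V) (f : V → ℕ) :
    ∑ v ∈ s.biUnion t, f v ≤ ∑ x ∈ s, ∑ v ∈ t x, f v := by
  induction s using Finset.induction_on with
  | empty => simp
  | insert a s ha ih =>
    rw [Finset.biUnion_insert, Finset.sum_insert ha]
    have := Finset.sum_union_inter (s₁ := t a) (s₂ := s.biUnion t) (f := f)
    omega

/-- A vertex with a single neighbour in `B` keeps `B` an induced tree. Being due at level `d`,
together with `le_key`, forces its depth to be exactly `d`. -/
theorem Grown.add {A B : Finset V} {r u w : V} {dep : V → ℕ} {d : ℕ} (h : Grown G A B r dep d)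
    (hu : u ∈ B) (hwA : w ∈ A) (hwB : w ∉ B) (hadj : G.Adj u w) (hkey : dep u + wt G A w ≤ d)
    (hnb : nb G B w ≤ 1) : Grown G A (insert w B) r (Function.update dep w d) d := by
  obtain ⟨par, anc, h⟩ := h
  have hkey' := h.le_key u hu w hwA hwB hadj
  have hnew : ∀ v ∈ B, v ≠ w := fun v hv e => hwB (e ▸ hv)
  have hrw : r ≠ w := hnew r h.root
  have hadj' : ∀ v ∈ B, G.Adj w v → v = u := by
    intro v hv hwv
    by_contra hvu
    have : ({v, u} : Finset V) ⊆ B.filter (G.Adj w) := by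
      intro x hx
      rcases Finset.mem_insert.1 hx with rfl | hx
      · exact Finset.mem_filter.2 ⟨hv, hwv⟩
      · rw [Finset.mem_singleton.1 hx]; exact Finset.mem_filter.2 ⟨hu, hadj.symm⟩
    have := Finset.card_le_card this
    rw [Finset.card_pair hvu] at this
    unfold nb at hnb
    omega
  have hone : nb G B w = 1 := by
    have : 0 < nb G B w := nb_pos.2 ⟨u, hu, hadj.symm⟩
    omega
  have hcard := Finset.card_insert_of_notMem hwB
  refine ⟨Function.update par w u, Function.update anc w (insert w (anc u)), ?_⟩
  have hwanc : w ∉ anc u := fun hh => hwB (h.anc_sub u hu hh)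
  constructor
  · exact Finset.insert_subset hwA h.sub
  · exact Finset.mem_insert_of_mem h.root
  · intro v hv hvr
    rcases Finset.mem_insert.1 hv with rfl | hv
    · rw [Function.update_self]; exact Finset.mem_insert_of_mem hu
    · rw [update_eq hwB _ _ v hv]; exact Finset.mem_insert_of_mem (h.par_mem v hv hvr)
  · intro v hv hvr
    rcases Finset.mem_insert.1 hv with rfl | hv
    · rw [Function.update_self, Function.update_self, update_eq hwB _ _ u hu]; omega
    · rw [update_eq hwB _ _ v hv, update_eq hwB _ _ v hv,
          update_eq hwB _ _ _ (h.par_mem v hv hvr)]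
      exact h.dep_par v hv hvr
  · intro a ha b hb hab
    rcases Finset.mem_insert.1 ha with rfl | ha₁ <;> rcases Finset.mem_insert.1 hb with rfl | hb₁
    · exact absurd hab (G.irrefl)
    · left; rw [Function.update_self]; exact ⟨hrw.symm, (hadj' b hb₁ hab).symm⟩
    · right; rw [Function.update_self]; exact ⟨hrw.symm, (hadj' a ha₁ hab.symm).symm⟩
    · rw [update_eq hwB _ _ a ha₁, update_eq hwB _ _ b hb₁]; exact h.edge a ha₁ b hb₁ hab
  · intro v hv
    rcases Finset.mem_insert.1 hv with rfl | hv
    · rw [Function.update_self]; exact Finset.mem_insert_self _ _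
    · rw [update_eq hwB _ _ v hv]; exact h.anc_self v hv
  · intro v hv
    rcases Finset.mem_insert.1 hv with rfl | hv
    · rw [Function.update_self]; exact Finset.insert_subset_insert _ (h.anc_sub u hu)
    · rw [update_eq hwB _ _ v hv]; exact (h.anc_sub v hv).trans (Finset.subset_insert _ _)
  · intro v hv x hx hxr
    rcases Finset.mem_insert.1 hv with rfl | hv
    · rw [Function.update_self] at hx ⊢
      rcases Finset.mem_insert.1 hx with rfl | hx
      · rw [Function.update_self]; exact Finset.mem_insert_of_mem (h.anc_self u hu)
      · rw [update_eq hwB _ _ x (h.anc_sub u hu hx)]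
        exact Finset.mem_insert_of_mem (h.anc_par u hu x hx hxr)
    · rw [update_eq hwB _ _ v hv] at hx ⊢
      rw [update_eq hwB _ _ x (h.anc_sub v hv hx)]
      exact h.anc_par v hv x hx hxr
  · intro v hv
    rcases Finset.mem_insert.1 hv with rfl | hv
    · rw [Function.update_self, Function.update_self, Finset.sum_insert hwanc]
      have := h.anc_wt u hu
      omega
    · rw [update_eq hwB _ _ v hv, update_eq hwB _ _ v hv]; exact h.anc_wt v hv
  · intro v hv hvr
    rcases Finset.mem_insert.1 hv with rfl | hv
    · rw [Function.update_self, Function.update_self, update_eq hwB _ _ u hu,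
          Finset.card_insert_of_notMem hwanc]
      omega
    · rw [update_eq hwB _ _ v hv, update_eq hwB _ _ v hv,
          update_eq hwB _ _ _ (h.par_mem v hv hvr)]
      exact h.anc_lt v hv hvr
  · intro v hv
    rcases Finset.mem_insert.1 hv with rfl | hv
    · rw [Function.update_self]
    · rw [update_eq hwB _ _ v hv]; exact h.dep_le v hv
  · intro a ha b hb hbB hab
    have hbB' : b ∉ B := fun hh => hbB (Finset.mem_insert_of_mem hh)
    rcases Finset.mem_insert.1 ha with rfl | ha
    · rw [Function.update_self]; omega
    · rw [update_eq hwB _ _ a ha]; exact h.le_key a ha b hb hbB' hab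
  · intro v hv
    rw [hcard]
    rcases Finset.mem_insert.1 hv with rfl | hv
    · rw [Function.update_self]
      have := h.dep_lt u hu
      have := wt_le_one (G := G) A v
      omega
    · rw [update_eq hwB _ _ v hv]
      have := h.dep_lt v hv
      omega
  · rw [en_insert hwB (by simp), Finset.union_empty, hone, hcard]
    have := h.en_eq
    omega

/-- The search tree can always be extended. -/
theorem Grown.exists_edge {A B : Finset V} {r : V} {dep : V → ℕ} {d : ℕ} (h : Grown G A B r dep d)
    (hA : Closed G ∅ A) : ∃ u ∈ B, ∃ w ∈ A, w ∉ B ∧ G.Adj u w := by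
  obtain ⟨par, anc, h⟩ := h
  by_contra hno
  push Not at hno
  have h1 : ∀ v ∈ B, 2 ≤ nb G B v := by
    intro v hv
    have h2 := hA v (h.sub hv)
    refine h2.trans (Finset.card_le_card ?_)
    intro x hx
    have hx' := Finset.mem_filter.1 hx
    rw [Finset.union_empty] at hx'
    refine Finset.mem_filter.2 ⟨?_, hx'.2⟩
    by_contra hxB
    exact hno v hv x hx'.1 hxB hx'.2
  have h2 := Finset.card_nsmul_le_sum B _ 2 h1
  rw [← en_empty, smul_eq_mul] at h2
  have := h.en_eq
  omega

/-- Some edge always leaves the tree, and its key is at most the depth of its tree end plus one;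
this bounds the level in the termination measure. -/
theorem Grown.level_le {A B : Finset V} {r : V} {dep : V → ℕ} {d : ℕ} (h : Grown G A B r dep d)
    (hA : Closed G ∅ A) : d ≤ B.card := by
  obtain ⟨u, hu, w, hw, hwB, hadj⟩ := h.exists_edge hA
  obtain ⟨par, anc, h⟩ := h
  have := h.le_key u hu w hw hwB hadj
  have := h.dep_lt u hu
  have := wt_le_one (G := G) A w
  omega

/-- Up to depth `d - 2` all neighbours of a tree vertex are in the tree. A degree-two vertex passes
on one branch and a branch vertex at least two, so the number of branch vertices at least doubles
with each unit of depth. -/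
theorem Grown.two_pow_le {A B : Finset V} {r : V} {dep : V → ℕ} {d : ℕ} (h : Grown G A B r dep d)
    (hA : Closed G ∅ A) (hr0 : dep r = 0) (hd : 2 ≤ d) : 2 ^ (d - 1) ≤ (branch G A).card := by
  obtain ⟨par, anc, h⟩ := h
  let N : ℕ → Finset V := fun j => B.filter fun v => dep v ≤ j ∧ 3 ≤ nb G A v
  -- Let `L` be the tree vertices of depth at most `j`. Their degree sum is at least `2|L| + |N j|`
  -- and at most `|L| - 1` plus their number of children. A child is a non-root vertex of `L` or a
  -- branch vertex of depth `j + 1`.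
  have key : ∀ j, j + 2 ≤ d → 2 * (N j).card + 2 ≤ (N (j + 1)).card := by
    intro j hj
    let L : Finset V := B.filter fun v => dep v ≤ j
    let K : V → Finset V := fun u => B.filter fun v => v ≠ r ∧ par v = u
    have hrL : r ∈ L := Finset.mem_filter.2 ⟨h.root, by omega⟩
    have hcompl : ∀ u ∈ L, nb G A u ≤ (K u).card + if u = r then 0 else 1 := by
      intro u hu
      have hu' := Finset.mem_filter.1 hu
      have hsub : A.filter (G.Adj u) ⊆ K u ∪ if u = r then ∅ else {par u} := by
        intro x hx
        have hx' := Finset.mem_filter.1 hx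
        have hxB : x ∈ B := by
          by_contra hxB
          have := h.le_key u hu'.1 x hx'.1 hxB hx'.2
          have := wt_le_one (G := G) A x
          omega
        rcases h.edge u hu'.1 x hxB hx'.2 with ⟨h1, h2⟩ | ⟨h1, h2⟩
        · rw [if_neg h1, h2]; simp
        · exact Finset.mem_union_left _ (Finset.mem_filter.2 ⟨hxB, h1, h2⟩)
      refine (Finset.card_le_card hsub).trans ((Finset.card_union_le _ _).trans ?_)
      split_ifs <;> simp
    have h1 : ∑ u ∈ L, nb G A u + 1 ≤ ∑ u ∈ L, (K u).card + L.card := by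
      have h2 := Finset.sum_le_sum hcompl
      rw [Finset.sum_add_distrib] at h2
      have h3 : ∑ u ∈ L, (if u = r then 0 else 1) + 1 = L.card := by
        rw [← Finset.add_sum_erase L _ hrL, if_pos rfl, Finset.sum_congr rfl
          (fun u hu => if_neg (Finset.ne_of_mem_erase hu)), Finset.sum_const, smul_eq_mul, mul_one,
          zero_add, Finset.card_erase_add_one hrL]
      omega
    have h2 : 2 * L.card + (N j).card ≤ ∑ u ∈ L, nb G A u := by
      have h3 : ∑ v ∈ L, (2 + if 3 ≤ nb G A v then 1 else 0) ≤ ∑ v ∈ L, nb G A v := by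
        refine Finset.sum_le_sum fun v hv => ?_
        have := hA v (h.sub (Finset.mem_filter.1 hv).1)
        rw [Finset.union_empty] at this
        split_ifs <;> omega
      rw [Finset.sum_add_distrib, ← Finset.card_filter, Finset.sum_const, smul_eq_mul,
        Finset.filter_filter] at h3
      show 2 * L.card + (B.filter fun v => dep v ≤ j ∧ 3 ≤ nb G A v).card ≤ _
      omega
    have h3 : ∑ u ∈ L, (K u).card + 1 ≤ L.card + (N (j + 1) \ N j).card := by
      have hdisj : ∀ u ∈ L, ∀ v ∈ L, u ≠ v → Disjoint (K u) (K v) := by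
        intro u _ v _ huv
        rw [Finset.disjoint_left]
        intro x hx hx'
        exact huv (((Finset.mem_filter.1 hx).2.2).symm.trans (Finset.mem_filter.1 hx').2.2)
      rw [← Finset.card_biUnion hdisj]
      have hsub : L.biUnion K ⊆ L.erase r ∪ (N (j + 1) \ N j) := by
        intro v hv
        obtain ⟨u, hu, hv⟩ := Finset.mem_biUnion.1 hv
        obtain ⟨hvB, hvr, rfl⟩ := Finset.mem_filter.1 hv
        have hu' := (Finset.mem_filter.1 hu).2
        have hdv := h.dep_par v hvB hvr
        by_cases hvj : dep v ≤ j
        · exact Finset.mem_union_left _ (Finset.mem_erase.2 ⟨hvr, Finset.mem_filter.2 ⟨hvB, hvj⟩⟩)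
        · refine Finset.mem_union_right _
            (Finset.mem_sdiff.2 ⟨Finset.mem_filter.2 ⟨hvB, ?_, ?_⟩, ?_⟩)
          · have := wt_le_one (G := G) A v
            omega
          · by_contra h3
            rw [wt, if_neg h3] at hdv
            omega
          · intro hh
            exact hvj (Finset.mem_filter.1 hh).2.1
      have := (Finset.card_le_card hsub).trans (Finset.card_union_le _ _)
      have := Finset.card_erase_add_one hrL
      omega
    have h4 : N j ⊆ N (j + 1) := by
      intro v hv
      have hv' := Finset.mem_filter.1 hv
      exact Finset.mem_filter.2 ⟨hv'.1, by omega, hv'.2.2⟩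
    have h5 := Finset.card_sdiff_add_card_eq_card h4
    omega
  have main : ∀ j, j + 2 ≤ d → 2 ^ (j + 1) ≤ (N (j + 1)).card := by
    intro j
    induction j with
    | zero => intro hj; have := key 0 hj; omega
    | succ j ih =>
      intro hj
      have := ih (by omega)
      have := key (j + 1) hj
      rw [pow_succ]
      omega
  have h1 := main (d - 2) (by omega)
  rw [show d - 2 + 1 = d - 1 by omega] at h1
  refine h1.trans (Finset.card_le_card ?_)
  intro v hv
  have hv' := Finset.mem_filter.1 hv
  exact Finset.mem_filter.2 ⟨h.sub hv'.1, hv'.2.2⟩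

/-- A vertex with two neighbours in the tree closes a cycle that has few vertices of degree at
least three. -/
theorem Grown.close {A B : Finset V} {r w : V} {dep : V → ℕ} {d : ℕ} (h : Grown G A B r dep d)
    (hD : ∀ v ∈ A, nb G A v ≤ 20) (hwA : w ∈ A) (hwB : w ∉ B) (hnb : 2 ≤ nb G B w) :
    Cyc G ∅ (insert w B) ∧ (core G ∅ (insert w B) ∩ branch G A).card ≤ 20 * d + 21 := by
  obtain ⟨par, anc, h⟩ := h
  constructor
  · by_contra hno
    have h1 := en_add_two_le_of_not_cyc (Finset.insert_nonempty w B) hno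
    rw [en_insert hwB (by simp), Finset.union_empty, Finset.card_insert_of_notMem hwB] at h1
    have := h.en_eq
    omega
  -- The core lies within `w` and the root paths of its neighbours in `B`. There are at most 20 such
  -- paths, each with at most `d + 1` branch vertices, and `w` accounts for one more.
  · let T : Finset V := insert w ((B.filter (G.Adj w)).biUnion anc)
    have hT : core G ∅ (insert w B) ⊆ T := by
      by_contra hno
      have hne : (core G ∅ (insert w B) \ T).Nonempty := Finset.sdiff_nonempty.2 hno
      obtain ⟨v, hv, hmax⟩ := Finset.exists_max_image _ (fun v => (anc v).card) hne
      obtain ⟨hvc, hvT⟩ := Finset.mem_sdiff.1 hv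
      have hvw : v ≠ w := fun e => hvT (e ▸ Finset.mem_insert_self _ _)
      have hvB : v ∈ B := (Finset.mem_insert.1 (core_subset _ _ hvc)).resolve_left hvw
      have hnadj : ¬ G.Adj w v := fun ha => hvT (Finset.mem_insert_of_mem
        (Finset.mem_biUnion.2 ⟨v, Finset.mem_filter.2 ⟨hvB, ha⟩, h.anc_self v hvB⟩))
      have h2 := core_closed (G := G) ∅ (insert w B) v hvc
      rw [Finset.union_empty] at h2
      obtain ⟨a, ha, b, hb, hab⟩ := Finset.one_lt_card.1 h2
      -- A core vertex `v` outside `T` with `anc v` largest has no child in the core: the child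
      -- would also be outside `T`, as `T` contains the parents of its tree vertices. So the only
      -- possible neighbour of `v` in the core is its parent.
      have hchild : ∀ x ∈ (core G ∅ (insert w B)).filter (G.Adj v), v ≠ r ∧ par v = x := by
        intro x hx
        obtain ⟨hxc, hvx⟩ := Finset.mem_filter.1 hx
        have hxw : x ≠ w := fun e => hnadj (e ▸ hvx).symm
        have hxB : x ∈ B := (Finset.mem_insert.1 (core_subset _ _ hxc)).resolve_left hxw
        rcases h.edge v hvB x hxB hvx with h3 | ⟨h3, h4⟩
        · exact h3
        · exfalso
          have hxT : x ∉ T := by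
            intro hxT
            rcases Finset.mem_insert.1 hxT with h5 | h5
            · exact hxw h5
            · obtain ⟨y, hy, hxy⟩ := Finset.mem_biUnion.1 h5
              refine hvT (Finset.mem_insert_of_mem (Finset.mem_biUnion.2 ⟨y, hy, ?_⟩))
              rw [← h4]
              exact h.anc_par y (Finset.mem_filter.1 hy).1 x hxy h3
          have h6 := hmax x (Finset.mem_sdiff.2 ⟨hxc, hxT⟩)
          have h7 := h.anc_lt x hxB h3
          rw [h4] at h7
          omega
      exact hab ((hchild a ha).2.symm.trans (hchild b hb).2)
    have h1 : (core G ∅ (insert w B) ∩ branch G A).card ≤ ∑ v ∈ T, wt G A v :=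
      (card_branch_inter A _).trans (Finset.sum_le_sum_of_subset hT)
    have h2 : ∑ v ∈ T, wt G A v ≤ wt G A w + ∑ v ∈ (B.filter (G.Adj w)).biUnion anc, wt G A v := by
      by_cases hw : w ∈ (B.filter (G.Adj w)).biUnion anc
      · show ∑ v ∈ insert w _, wt G A v ≤ _
        rw [Finset.insert_eq_of_mem hw]; omega
      · exact (Finset.sum_insert hw).le
    have h3 : ∑ v ∈ (B.filter (G.Adj w)).biUnion anc, wt G A v ≤
        ∑ x ∈ B.filter (G.Adj w), ∑ v ∈ anc x, wt G A v := sum_biUnion_le' _ _ _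
    have h4 : ∑ x ∈ B.filter (G.Adj w), ∑ v ∈ anc x, wt G A v ≤ 20 * (d + 1) := by
      refine (Finset.sum_le_card_nsmul _ _ (d + 1) fun x hx => ?_).trans ?_
      · have hxB := (Finset.mem_filter.1 hx).1
        exact (h.anc_wt x hxB).trans (Nat.succ_le_succ (h.dep_le x hxB))
      · rw [smul_eq_mul]
        refine Nat.mul_le_mul_right _ ?_
        exact (nb_mono h.sub w).trans (hD w hwA)
    have := wt_le_one (G := G) A w
    omega

/-! ### Cycles as vertex sequences, and the cost of deleting one -/

/-- The sequence `y 0, …, y l` runs once around a cycle. -/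
structure IsCycSeq (G : SimpleGraph V) (l : ℕ) (y : ℕ → V) : Prop where
  three_le : 3 ≤ l
  inj : ∀ i < l, ∀ j < l, y i = y j → i = j
  adj : ∀ i < l, G.Adj (y i) (y (i + 1))
  last : y l = y 0

/-- The vertices of the cycle. -/
def cycSet (l : ℕ) (y : ℕ → V) : Finset V := (Finset.range l).image y

theorem mem_cycSet {l : ℕ} {y : ℕ → V} {v : V} : v ∈ cycSet l y ↔ ∃ i < l, y i = v := by
  simp [cycSet]

/-- Provides the predecessor on the cycle, a second cycle neighbour besides `y (i + 1)`. -/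
theorem IsCycSeq.nbrs {l : ℕ} {y : ℕ → V} (h : IsCycSeq G l y) {i : ℕ} (hi : i < l) :
    ∃ a ∈ cycSet l y, a ≠ y (i + 1) ∧ G.Adj (y i) a := by
  have h3 := h.three_le
  rcases Nat.eq_zero_or_pos i with rfl | hpos
  · refine ⟨y (l - 1), mem_cycSet.2 ⟨l - 1, by omega, rfl⟩, fun e => ?_, ?_⟩
    · have := h.inj _ (by omega) _ (by omega) e
      omega
    · have := h.adj (l - 1) (by omega)
      rw [show l - 1 + 1 = l by omega, h.last] at this
      exact this.symm
  · refine ⟨y (i - 1), mem_cycSet.2 ⟨i - 1, by omega, rfl⟩, fun e => ?_, ?_⟩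
    · rcases Nat.lt_or_ge (i + 1) l with hl | hl
      · have := h.inj _ (by omega) _ hl e
        omega
      · rw [show i + 1 = l by omega, h.last] at e
        have := h.inj _ (by omega) _ (by omega) e
        omega
    · have := h.adj (i - 1) (by omega)
      rw [show i - 1 + 1 = i by omega] at this
      exact this.symm

theorem IsCycSeq.succ_mem {l : ℕ} {y : ℕ → V} (h : IsCycSeq G l y) {i : ℕ} (hi : i < l) :
    y (i + 1) ∈ cycSet l y := by
  rcases Nat.lt_or_ge (i + 1) l with hl | hl
  · exact mem_cycSet.2 ⟨_, hl, rfl⟩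
  · rw [show i + 1 = l by omega, h.last]
    exact mem_cycSet.2 ⟨0, by omega, rfl⟩

/-- Removing a cycle together with its neighbourhood costs few vertices of a hitting set. -/
theorem IsCycSeq.exists_hits {l b : ℕ} {y : ℕ → V} (h : IsCycSeq G l y) {A A' : Finset V}
    (hD : ∀ v ∈ A, nb G A v ≤ 20) (hC : cycSet l y ⊆ A) (hb : (cycSet l y ∩ branch G A).card ≤ b)
    (hA' : ∀ v, v ∈ A' ↔ v ∈ A ∧ v ∉ cycSet l y ∧ nb G (cycSet l y) v = 0) :
    ∃ Z' : Finset V, Z'.card ≤ 21 * b + 1 ∧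
      ∀ Z, ¬ Cyc G ∅ (A' \ Z) → ¬ Cyc G ∅ (A \ (Z ∪ Z')) := by
  have h3 := h.three_le
  let K := cycSet l y ∩ branch G A
  -- The witness contains the branch vertices of the cycle with all their neighbours in `A`, at most
  -- 21 vertices each, and `y 0`, which breaks the cycle when it has no branch vertex.
  refine ⟨insert (y 0) (K.biUnion fun c => insert c (A.filter (G.Adj c))), ?_, ?_⟩
  · refine (Finset.card_insert_le _ _).trans (Nat.succ_le_succ ?_)
    refine (Finset.card_biUnion_le_card_mul K _ 21 ?_).trans ?_
    · intro c hc
      refine (Finset.card_insert_le _ _).trans (Nat.succ_le_succ ?_)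
      exact hD c (hC (Finset.mem_inter.1 hc).1)
    · rw [mul_comm]; exact Nat.mul_le_mul_left _ hb
  · rintro Z hZ ⟨U, hU, hne, hc⟩
    have hUA : ∀ v ∈ U, v ∈ A := fun v hv => (Finset.mem_sdiff.1 (hU hv)).1
    have hU0 : y 0 ∉ U := fun hv => (Finset.mem_sdiff.1 (hU hv)).2
      (Finset.mem_union_right _ (Finset.mem_insert_self _ _))
    have hUK : ∀ c ∈ K, ∀ v ∈ U, v ≠ c ∧ ¬ G.Adj c v := by
      intro c hcK v hv
      have : v ∉ insert c (A.filter (G.Adj c)) := fun hh => (Finset.mem_sdiff.1 (hU hv)).2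
        (Finset.mem_union_right _ (Finset.mem_insert_of_mem (Finset.mem_biUnion.2 ⟨c, hcK, hh⟩)))
      rw [Finset.mem_insert, Finset.mem_filter] at this
      push Not at this
      exact ⟨this.1, this.2 (hUA v hv)⟩
    have hUC : ∀ v ∈ U, v ∉ cycSet l y := by
      intro v hv hvC
      -- The last cycle vertex in `U` is not a branch vertex, so it has degree at most two in `A`;
      -- its successor is outside `U`, so it cannot have two neighbours in `U`.
      obtain ⟨i, hi, hmax⟩ := Finset.exists_max_image
        ((Finset.range l).filter fun i => y i ∈ U) id (by
          obtain ⟨i, hi, rfl⟩ := mem_cycSet.1 hvC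
          exact ⟨i, Finset.mem_filter.2 ⟨Finset.mem_range.2 hi, hv⟩⟩)
      obtain ⟨hil, hiU⟩ := Finset.mem_filter.1 hi
      rw [Finset.mem_range] at hil
      have hiC : y i ∈ cycSet l y := mem_cycSet.2 ⟨i, hil, rfl⟩
      have hnbr : nb G A (y i) ≤ 2 := by
        by_contra hlt
        exact (hUK (y i) (Finset.mem_inter.2 ⟨hiC, Finset.mem_filter.2 ⟨hC hiC, by omega⟩⟩)
          _ hiU).1 rfl
      have hnext : y (i + 1) ∉ U := by
        intro hn
        rcases Nat.lt_or_ge (i + 1) l with hl | hl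
        · have := hmax (i + 1) (Finset.mem_filter.2 ⟨Finset.mem_range.2 hl, hn⟩)
          simp at this
        · rw [show i + 1 = l by omega, h.last] at hn
          exact hU0 hn
      have h2 := hc _ hiU
      rw [Finset.union_empty] at h2
      have : insert (y (i + 1)) (U.filter (G.Adj (y i))) ⊆ A.filter (G.Adj (y i)) := by
        refine Finset.insert_subset ?_ ?_
        · exact Finset.mem_filter.2 ⟨hC (h.succ_mem hil), h.adj i hil⟩
        · exact Finset.filter_subset_filter _ hUA
      have := Finset.card_le_card this
      rw [Finset.card_insert_of_notMem (fun hh => hnext (Finset.mem_filter.1 hh).1)] at this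
      unfold nb at h2 hnbr
      omega
    refine hZ ⟨U, ?_, hne, hc⟩
    intro v hv
    have hvZ : v ∉ Z := fun hh => (Finset.mem_sdiff.1 (hU hv)).2 (Finset.mem_union_left _ hh)
    refine Finset.mem_sdiff.2 ⟨(hA' v).2 ⟨hUA v hv, hUC v hv, ?_⟩, hvZ⟩
    rw [nb_eq_zero]
    intro c hcC hvc
    obtain ⟨i, hi, rfl⟩ := mem_cycSet.1 hcC
    obtain ⟨a, haC, hane, ha⟩ := h.nbrs hi
    -- A cycle vertex with a neighbour off the cycle has degree at least three, and its neighbours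
    -- in `A` were put into the witness.
    have : ({v, a, y (i + 1)} : Finset V) ⊆ A.filter (G.Adj (y i)) := by
      intro x hx
      simp only [Finset.mem_insert, Finset.mem_singleton] at hx
      rcases hx with rfl | rfl | rfl
      · exact Finset.mem_filter.2 ⟨hUA _ hv, hvc.symm⟩
      · exact Finset.mem_filter.2 ⟨hC haC, ha⟩
      · exact Finset.mem_filter.2 ⟨hC (h.succ_mem hi), h.adj i hi⟩
    have h4 := Finset.card_le_card this
    rw [Finset.card_eq_three.2 ⟨v, a, y (i + 1), fun e => hUC v hv (e ▸ haC),
      fun e => hUC v hv (e ▸ h.succ_mem hi), hane, rfl⟩] at h4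
    exact (hUK (y i) (Finset.mem_inter.2 ⟨hcC, Finset.mem_filter.2 ⟨hC hcC, h4⟩⟩) v hv).2 hvc.symm

/-- A path in a closed set that cannot be extended has an edge back to one of its vertices. -/
theorem exists_back_edge {M : Finset V} (hM : Closed G ∅ M) {m : ℕ} {x : ℕ → V}
    (hmem : x m ∈ M) (hstuck : ∀ v ∈ M, G.Adj (x m) v → ∃ i ≤ m, x i = v) :
    ∃ j, j + 2 ≤ m ∧ G.Adj (x m) (x j) := by
  have h := hM _ hmem
  rw [Finset.union_empty] at h
  obtain ⟨a, ha, b, hb, hab⟩ := Finset.one_lt_card.1 h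
  obtain ⟨ha, ha'⟩ := Finset.mem_filter.1 ha
  obtain ⟨hb, hb'⟩ := Finset.mem_filter.1 hb
  obtain ⟨i, hi, rfl⟩ := hstuck a ha ha'
  obtain ⟨j, hj, rfl⟩ := hstuck b hb hb'
  have hi' : i ≠ m := fun e => ha'.ne (by rw [e])
  have hj' : j ≠ m := fun e => hb'.ne (by rw [e])
  have hij : i ≠ j := fun e => hab (by rw [e])
  rcases Nat.lt_or_gt_of_ne hij with hlt | hlt
  · exact ⟨i, by omega, ha'⟩
  · exact ⟨j, by omega, hb'⟩

theorem isCycSeq_of_back_edge {m j : ℕ} {x : ℕ → V} (hinj : ∀ a ≤ m, ∀ b ≤ m, x a = x b → a = b)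
    (hadj : ∀ i < m, G.Adj (x i) (x (i + 1))) (hj : j + 2 ≤ m) (hback : G.Adj (x m) (x j)) :
    IsCycSeq G (m + 1 - j) (fun i => if i < m + 1 - j then x (i + j) else x j) := by
  refine ⟨by omega, ?_, ?_, ?_⟩
  · intro a ha b hb hab
    simp only [ha, hb, if_true] at hab
    have := hinj _ (by omega) _ (by omega) hab
    omega
  · intro i hi
    simp only [hi, if_true]
    split_ifs with h2
    · have := hadj (i + j) (by omega)
      rwa [show i + j + 1 = i + 1 + j by omega] at this
    · rwa [show i + j = m by omega]
  · rw [if_neg (lt_irrefl _), if_pos (by omega), zero_add]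

end CycleCore

/-! ### From sequences to walks, forests, and the size of the hitting set -/

namespace CycleCore

set_option linter.unusedSectionVars false

section walks

variable {V : Type*} {G : SimpleGraph V}

/-- The walk along a sequence of vertices. -/
def seqWalk (y : ℕ → V) : (l : ℕ) → (∀ i < l, G.Adj (y i) (y (i + 1))) → G.Walk (y 0) (y l)
  | 0, _ => .nil
  | l + 1, h => .cons (h 0 (Nat.succ_pos l))
      (seqWalk (fun i => y (i + 1)) l fun i hi => h (i + 1) (Nat.succ_lt_succ hi))

theorem length_seqWalk (y : ℕ → V) (l : ℕ) (h : ∀ i < l, G.Adj (y i) (y (i + 1))) :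
    (seqWalk y l h).length = l := by
  induction l generalizing y with
  | zero => rfl
  | succ l ih => simp [seqWalk, ih]

theorem getVert_seqWalk (y : ℕ → V) (l : ℕ) (h : ∀ i < l, G.Adj (y i) (y (i + 1))) {j : ℕ}
    (hj : j ≤ l) : (seqWalk y l h).getVert j = y j := by
  induction l generalizing y j with
  | zero => obtain rfl : j = 0 := by omega
            rfl
  | succ l ih =>
    cases j with
    | zero => simp
    | succ j =>
      simp only [seqWalk, SimpleGraph.Walk.getVert_cons_succ]
      exact ih _ _ (by omega)

theorem mem_support_seqWalk (y : ℕ → V) (l : ℕ) (h : ∀ i < l, G.Adj (y i) (y (i + 1))) {v : V} :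
    v ∈ (seqWalk y l h).support ↔ ∃ j ≤ l, y j = v := by
  rw [SimpleGraph.Walk.mem_support_iff_exists_getVert, length_seqWalk]
  constructor
  · rintro ⟨j, hj, hl⟩
    exact ⟨j, hl, by rw [← hj, getVert_seqWalk y l h hl]⟩
  · rintro ⟨j, hl, rfl⟩
    exact ⟨j, getVert_seqWalk y l h hl, hl⟩

theorem isPath_seqWalk (y : ℕ → V) (l : ℕ) (h : ∀ i < l, G.Adj (y i) (y (i + 1)))
    (hinj : ∀ i ≤ l, ∀ j ≤ l, y i = y j → i = j) : (seqWalk y l h).IsPath := by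
  induction l generalizing y with
  | zero => simp [seqWalk]
  | succ l ih =>
    rw [seqWalk, SimpleGraph.Walk.cons_isPath_iff]
    refine ⟨ih _ _ fun i hi j hj e => by have := hinj _ (by omega) _ (by omega) e; omega, ?_⟩
    intro hm
    obtain ⟨j, hj, e⟩ := (mem_support_seqWalk _ _ _).1 hm
    have := hinj _ (by omega) _ (by omega) e
    omega

end walks

variable {V : Type*} [DecidableEq V] {G : SimpleGraph V} [DecidableRel G.Adj]

theorem IsCycSeq.isCycle_seqWalk {l : ℕ} {y : ℕ → V} (h : IsCycSeq G l y) :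
    ((seqWalk y l h.adj).copy rfl h.last).IsCycle := by
  obtain ⟨l, rfl⟩ : ∃ l', l = l' + 1 := ⟨l - 1, by have := h.three_le; omega⟩
  have h3 := h.three_le
  have hadj : ∀ i < l, G.Adj (y (i + 1)) (y (i + 1 + 1)) := fun i hi => h.adj (i + 1) (by omega)
  have heq : (seqWalk y (l + 1) h.adj).copy rfl h.last = .cons (h.adj 0 (Nat.succ_pos l))
      ((seqWalk (fun i => y (i + 1)) l hadj).copy rfl h.last) := by
    simp [seqWalk]
  have hpath : (seqWalk (fun i => y (i + 1)) l hadj).IsPath := by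
    refine isPath_seqWalk _ _ _ ?_
    intro i hi j hj e
    rcases Nat.lt_or_ge i l with h1 | h1 <;> rcases Nat.lt_or_ge j l with h2 | h2
    · have := h.inj _ (by omega) _ (by omega) e; omega
    · obtain rfl : j = l := by omega
      have e' : y (i + 1) = y 0 := by rw [← h.last]; exact e
      have := h.inj _ (by omega) _ (by omega) e'; omega
    · obtain rfl : i = l := by omega
      have e' : y 0 = y (j + 1) := by rw [← h.last]; exact e
      have := h.inj _ (by omega) _ (by omega) e'; omega
    · omega
  rw [heq, SimpleGraph.Walk.cons_isCycle_iff]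
  refine ⟨by rw [SimpleGraph.Walk.isPath_copy]; exact hpath, ?_⟩
  intro hm
  rw [SimpleGraph.Walk.edges_copy] at hm
  have hle : (seqWalk (fun i => y (i + 1)) l hadj).length = l := length_seqWalk _ _ _
  have h0 : y 0 = y (l + 1) := h.last.symm
  rw [h0, Sym2.eq_swap] at hm
  -- If the first edge occurred on the remaining path, it would join the ends of that path, whose
  -- length would be 1; but its length is `l ≥ 2`.
  have := hpath.length_eq_one_of_mem_edges hm
  omega

/-- A nonempty set without closed subsets induces a forest. -/
theorem isAcyclic_of_not_cyc {s : Set V} {U : Finset V} (hs : ∀ v, v ∈ s → v ∈ U)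
    (h : ¬ Cyc G ∅ U) : (G.induce s).IsAcyclic := by
  intro v c hc
  classical
  refine h ⟨c.support.toFinset.image (fun x : s => (x : V)), ?_, ?_, ?_⟩
  · intro x hx
    obtain ⟨y, -, rfl⟩ := Finset.mem_image.1 hx
    exact hs _ y.2
  · exact ⟨v, Finset.mem_image.2 ⟨v, by simp, rfl⟩⟩
  · intro x hx
    obtain ⟨y, hy, rfl⟩ := Finset.mem_image.1 hx
    rw [List.mem_toFinset] at hy
    have h2 := hc.ncard_neighborSet_toSubgraph_eq_two hy
    obtain ⟨a, b, hab, he⟩ := Set.ncard_eq_two.1 h2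
    have hmem : ∀ z ∈ c.toSubgraph.neighborSet y, (z : V) ∈
        (c.support.toFinset.image (fun x : s => (x : V)) ∪ ∅).filter (G.Adj y) := by
      intro z hz
      have hz' : c.toSubgraph.Adj y z := hz
      refine Finset.mem_filter.2 ⟨Finset.mem_union_left _ (Finset.mem_image.2 ⟨z, ?_, rfl⟩), ?_⟩
      · rw [List.mem_toFinset]
        exact (c.mem_verts_toSubgraph).1 hz'.snd_mem
      · exact hz'.adj_sub
    have hsub : ({(a : V), (b : V)} : Finset V) ⊆
        (c.support.toFinset.image (fun x : s => (x : V)) ∪ ∅).filter (G.Adj y) := by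
      intro z hz
      rcases Finset.mem_insert.1 hz with rfl | hz
      · exact hmem a (by rw [he]; simp)
      · rw [Finset.mem_singleton.1 hz]; exact hmem b (by rw [he]; simp)
    have := Finset.card_le_card hsub
    rwa [Finset.card_pair (fun e => hab (Subtype.ext e))] at this

/-- The arithmetic behind the bound on the hitting set. -/
theorem hits_bound {k z D c : ℕ} (hc : c + 1 ≤ k) (hz : z ≤ c * (420 * D + 442))
    (hD : D ≤ 1 ∨ 2 ^ (D - 1) ≤ 40 * z) : (z : ℝ) ≤ 30000 * (k * Real.log k) := by
  rcases Nat.lt_or_ge k 2 with hk | hk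
  -- For `k = 1` the right side is 0, and `c = 0` gives `z = 0`.
  · obtain rfl : c = 0 := by omega
    obtain rfl : z = 0 := by simpa using hz
    have : k = 1 := by omega
    simp [this]
  have hl2 := Real.log_two_gt_d9
  have hlk : Real.log 2 ≤ Real.log k := Real.log_le_log (by norm_num) (by exact_mod_cast hk)
  have hkr : (2 : ℝ) ≤ k := by exact_mod_cast hk
  have hzr : (z : ℝ) ≤ k * (420 * D + 442) := by
    have : z ≤ k * (420 * D + 442) := hz.trans (Nat.mul_le_mul_right _ (by omega))
    exact_mod_cast this
  have hDr : (D : ℝ) ≤ 2 * Real.log k + 36 := by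
    rcases hD with hD | hD
    · have : (D : ℝ) ≤ 1 := by exact_mod_cast hD
      linarith
    · rcases Nat.eq_zero_or_pos D with rfl | hpos
      · simp; linarith
      have hD1 : (1 : ℝ) ≤ D := by exact_mod_cast hpos
      have h1 : (2 : ℝ) ^ (D - 1) ≤ 40 * z := by exact_mod_cast hD
      have h2 : (2 : ℝ) ^ D = 2 * 2 ^ (D - 1) := by
        rw [← pow_succ']; congr 1; omega
      -- The constant comes from `80 * 862 ≤ 2 ^ 17`.
      have h3 : (2 : ℝ) ^ D ≤ k * D * 2 ^ 17 := by
        rw [h2]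
        have : (420 * (D : ℝ) + 442) ≤ 862 * D := by linarith
        have : (k : ℝ) * (420 * D + 442) ≤ k * (862 * D) := by gcongr
        have : 0 ≤ (k : ℝ) * D := by positivity
        nlinarith
      have h4 := Real.log_le_log (by positivity) h3
      rw [Real.log_pow, Real.log_mul (by positivity) (by positivity),
        Real.log_mul (by positivity) (by positivity), Real.log_pow] at h4
      -- Any slope below `log 2` lets the term `D log 2` absorb `log D`.
      have h5 : Real.log D ≤ D / 8 + 2.1 := by
        have h6 := Real.log_le_sub_one_of_pos (show (0 : ℝ) < D / 8 by positivity)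
        have h7 : Real.log (8 : ℝ) = 3 * Real.log 2 := by
          rw [show (8 : ℝ) = 2 ^ 3 by norm_num, Real.log_pow]; norm_num
        rw [Real.log_div (by positivity) (by norm_num), h7] at h6
        have := Real.log_two_lt_d9
        linarith
      have := Real.log_two_lt_d9
      push_cast at h4
      nlinarith
  have h1 : (420 * (D : ℝ) + 442) ≤ 30000 * Real.log k := by linarith
  calc (z : ℝ) ≤ k * (420 * D + 442) := hzr
    _ ≤ k * (30000 * Real.log k) := by gcongr
    _ = _ := by ring

end CycleCore

/-! ### Correctness with running time: a program logic -/

namespace RAM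

open Polynomial in
/-- A bound on the number of steps of a program whose loops are repeated at most `2n + 3` times each
time they are entered. -/
noncomputable def Prog.bound : Prog → Polynomial ℕ
  | .skip => 1
  | .set _ i j e => C (i.cost + j.cost + e.cost + 1)
  | .seq p q => p.bound + q.bound
  | .ite e p q => C (e.cost + 1) + p.bound + q.bound
  | .loop e p => (2 * X + 3) * (C (e.cost + 1) + p.bound) + C (e.cost + 1)

/-- The arrays that a program may write to. -/
def Prog.writes : Prog → List ℕ
  | .skip => []
  | .set a _ _ _ => [a]
  | .seq p q => p.writes ++ q.writes
  | .ite _ p q => p.writes ++ q.writes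
  | .loop _ p => p.writes

/-- Started in the memory state `m`, the program `p` halts within its time bound for the parameter
`n` in a state that satisfies `Q`. -/
def WP (n : ℕ) (p : Prog) (m : Mem) (Q : Mem → Prop) : Prop :=
  ∃ m', HaltsWithin p m (p.bound.eval n) m' ∧ Q m'

/-- Array numbers are literals, so the arrays left untouched can be read off the text; such side
conditions are then settled by `decide`. -/
theorem Exec.frame {p : Prog} {m m' : Mem} {s : ℕ} (h : Exec p m s m') :
    ∀ a, a ∉ p.writes → m' a = m a := by
  induction h with
  | skip m => intro a _; rfl
  | set m a i j e =>
    intro b hb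
    have : b ≠ a := by simpa [Prog.writes] using hb
    funext x y
    simp [Mem.write, this]
  | seq h₁ h₂ ih₁ ih₂ =>
    intro a ha
    simp only [Prog.writes, List.mem_append, not_or] at ha
    rw [ih₂ a ha.2, ih₁ a ha.1]
  | ite_pos he h ih =>
    intro a ha
    simp only [Prog.writes, List.mem_append, not_or] at ha
    exact ih a ha.1
  | ite_neg he h ih =>
    intro a ha
    simp only [Prog.writes, List.mem_append, not_or] at ha
    exact ih a ha.2
  | loop_done he => intro a _; rfl
  | loop_step he h₁ h₂ ih₁ ih₂ =>
    intro a ha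
    rw [ih₂ a ha, ih₁ a ha]

variable {n : ℕ} {p q : Prog} {m : Mem} {Q R : Mem → Prop}

theorem WP.mono (h : WP n p m R) (hQ : ∀ m', R m' → (∀ a, a ∉ p.writes → m' a = m a) → Q m') :
    WP n p m Q := by
  obtain ⟨m', ⟨s, hs, he⟩, hR⟩ := h
  exact ⟨m', ⟨s, hs, he⟩, hQ m' hR he.frame⟩

theorem wp_skip (h : Q m) : WP n .skip m Q :=
  ⟨m, ⟨1, by simp [Prog.bound], .skip m⟩, h⟩

theorem wp_set {a : ℕ} {i j e : Expr} (h : Q (m.write a (i.eval m) (j.eval m) (e.eval m))) :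
    WP n (.set a i j e) m Q :=
  ⟨_, ⟨_, by simp [Prog.bound], .set m a i j e⟩, h⟩

theorem wp_seq (h : WP n p m R)
    (hq : ∀ m', R m' → (∀ a, a ∉ p.writes → m' a = m a) → WP n q m' Q) : WP n (.seq p q) m Q := by
  obtain ⟨m', ⟨s, hs, he⟩, hR⟩ := h
  obtain ⟨m'', ⟨s', hs', he'⟩, hQ⟩ := hq m' hR he.frame
  exact ⟨m'', ⟨s + s', by simp only [Prog.bound, Polynomial.eval_add]; omega, .seq he he'⟩, hQ⟩

theorem wp_ite {e : Expr} (h₁ : e.eval m ≠ 0 → WP n p m Q) (h₂ : e.eval m = 0 → WP n q m Q) :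
    WP n (.ite e p q) m Q := by
  by_cases he : e.eval m = 0
  · obtain ⟨m', ⟨s, hs, hx⟩, hQ⟩ := h₂ he
    refine ⟨m', ⟨_, ?_, .ite_neg he hx⟩, hQ⟩
    simp only [Prog.bound, Polynomial.eval_add, Polynomial.eval_C]
    omega
  · obtain ⟨m', ⟨s, hs, hx⟩, hQ⟩ := h₁ he
    refine ⟨m', ⟨_, ?_, .ite_pos he hx⟩, hQ⟩
    simp only [Prog.bound, Polynomial.eval_add, Polynomial.eval_C]
    omega

/-- The rule for loops. The natural number `j` in the invariant `I j` bounds the number of remaining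
iterations. -/
theorem wp_loop {e : Expr} (I : ℕ → Mem → Prop) (j : ℕ) (hj : j ≤ 2 * n + 3) (hI : I j m)
    (hstep : ∀ j m', I j m' → (∀ a, a ∉ p.writes → m' a = m a) → e.eval m' ≠ 0 →
      WP n p m' (fun m'' => ∃ j' < j, I j' m''))
    (hpost : ∀ j m', I j m' → (∀ a, a ∉ p.writes → m' a = m a) → e.eval m' = 0 → Q m') :
    WP n (.loop e p) m Q := by
  have key : ∀ j m', I j m' → (∀ a, a ∉ p.writes → m' a = m a) →
      ∃ m'', HaltsWithin (.loop e p) m' (j * (e.cost + 1 + p.bound.eval n) + (e.cost + 1)) m'' ∧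
        Q m'' := by
    intro j
    induction j using Nat.strong_induction_on with
    | _ j ih =>
      intro m' hI hfr
      by_cases he : e.eval m' = 0
      · exact ⟨m', ⟨_, Nat.le_add_left _ _, .loop_done he⟩, hpost j m' hI hfr he⟩
      · obtain ⟨m₁, ⟨s₁, hs₁, hx₁⟩, j', hj', hI'⟩ := hstep j m' hI hfr he
        obtain ⟨m₂, ⟨s₂, hs₂, hx₂⟩, hQ⟩ := ih j' hj' m₁ hI'
          (fun a ha => (hx₁.frame a ha).trans (hfr a ha))
        refine ⟨m₂, ⟨_, ?_, .loop_step he hx₁ hx₂⟩, hQ⟩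
        have h1 : (j' + 1) * (e.cost + 1 + p.bound.eval n) ≤ j * (e.cost + 1 + p.bound.eval n) :=
          Nat.mul_le_mul_right _ hj'
        rw [Nat.succ_mul] at h1
        omega
  obtain ⟨m'', ⟨s, hs, hx⟩, hQ⟩ := key j m hI (fun _ _ => rfl)
  refine ⟨m'', ⟨s, hs.trans ?_, hx⟩, hQ⟩
  simp only [Prog.bound, Polynomial.eval_add, Polynomial.eval_mul, Polynomial.eval_C,
    Polynomial.eval_X, Polynomial.eval_ofNat]
  exact Nat.add_le_add_right (Nat.mul_le_mul_right _ hj) _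

/-! ### Variables, bounded iteration and search -/

/-- The cell `[0][0]` of an array, used as a variable. -/
def var (a : ℕ) : Expr := .get a (.lit 0) (.lit 0)

/-- The cell `[0][i]` of an array, where `i` is the value of a variable. -/
def row (a i : ℕ) : Expr := .get a (.lit 0) (var i)

/-- Assign to a variable. -/
def setv (a : ℕ) (e : Expr) : Prog := .set a (.lit 0) (.lit 0) e

/-- Run a program for all values of the variable `i` below `n`. -/
def forN (i : ℕ) (body : Prog) : Prog :=
  .seq (setv i (.lit 0)) (.loop (.sub (var 0) (var i)) (.seq body (setv i (.add (var i) (.lit 1)))))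

@[simp] theorem eval_var (a : ℕ) : (var a).eval m = m a 0 0 := rfl
@[simp] theorem eval_row (a i : ℕ) : (row a i).eval m = m a 0 (m i 0 0) := rfl
@[simp] theorem eval_lit (c : ℕ) : (Expr.lit c).eval m = c := rfl
@[simp] theorem eval_add (e e' : Expr) : (Expr.add e e').eval m = e.eval m + e'.eval m := rfl
@[simp] theorem eval_sub (e e' : Expr) : (Expr.sub e e').eval m = e.eval m - e'.eval m := rfl
@[simp] theorem eval_get (a : ℕ) (i j : Expr) :
    (Expr.get a i j).eval m = m a (i.eval m) (j.eval m) := rfl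

theorem write_same (a i j x : ℕ) : (m.write a i j x) a i j = x := by simp [Mem.write]
theorem write_ne {a b : ℕ} (i j x : ℕ) (h : b ≠ a) : (m.write a i j x) b = m b := by
  funext u v; simp [Mem.write, h]

theorem wp_setv {a : ℕ} {e : Expr} (h : Q (m.write a 0 0 (e.eval m))) : WP n (setv a e) m Q :=
  wp_set h

/-- The counter is initialised and incremented outside the body, so the invariant must not depend on
it. -/
theorem wp_for {i : ℕ} {body : Prog} (I : ℕ → Mem → Prop) (hn : m 0 0 0 = n)
    (h0 : 0 ∉ i :: body.writes) (hi : i ∉ body.writes)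
    (hI : ∀ j m x, I j m → I j (m.write i 0 0 x)) (init : I 0 m)
    (step : ∀ j : Fin n, ∀ m', I j m' → m' i 0 0 = j → (∀ a, a ∉ i :: body.writes → m' a = m a) →
      WP n body m' (I (j + 1)))
    (post : ∀ m', I n m' → (∀ a, a ∉ i :: body.writes → m' a = m a) → Q m') :
    WP n (forN i body) m Q := by
  have h0i : (0 : ℕ) ≠ i := fun e => h0 (by simp [e])
  refine wp_seq (R := fun m' => I 0 m' ∧ m' i 0 0 = 0)
    (wp_setv ⟨hI _ _ _ init, write_same _ _ _ _⟩) ?_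
  intro m₁ ⟨h₁, hz⟩ hfr
  have hfr' : ∀ a, a ∉ i :: body.writes → m₁ a = m a := fun a ha => hfr a (by
    simp only [List.mem_cons, not_or] at ha
    simpa [setv, Prog.writes] using ha.1)
  have hw : ∀ a, a ∉ i :: body.writes →
      a ∉ (Prog.seq body (setv i (.add (var i) (.lit 1)))).writes := by
    intro a ha
    simp only [List.mem_cons, not_or] at ha
    simp [setv, Prog.writes, ha.1, ha.2]
  refine wp_loop (fun j m' => ∃ j₀, j₀ + j = n ∧ I j₀ m' ∧ m' i 0 0 = j₀) n (by omega)
    ⟨0, by omega, h₁, hz⟩ ?_ ?_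
  · rintro j m' ⟨j₀, hj, hI₀, hv⟩ hfr₂ he
    have hfr₃ : ∀ a, a ∉ i :: body.writes → m' a = m a := fun a ha =>
      (hfr₂ a (hw a ha)).trans (hfr' a ha)
    have hlt : j₀ < n := by
      simp only [eval_sub, eval_var, hv, hfr₃ 0 h0, hn] at he
      omega
    refine wp_seq (step ⟨j₀, hlt⟩ m' hI₀ hv hfr₃) ?_
    intro m₂ hI₂ hfr₄
    refine wp_setv ⟨j - 1, by omega, j₀ + 1, by omega, hI _ _ _ hI₂, ?_⟩
    rw [write_same]
    simp only [eval_add, eval_var, eval_lit]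
    rw [hfr₄ i hi, hv]
  · rintro j m' ⟨j₀, hj, hI₀, hv⟩ hfr₂ he
    have hfr₃ : ∀ a, a ∉ i :: body.writes → m' a = m a := fun a ha =>
      (hfr₂ a (hw a ha)).trans (hfr' a ha)
    simp only [eval_sub, eval_var, hv, hfr₃ 0 h0, hn] at he
    obtain rfl : j₀ = n := by omega
    exact post m' hI₀ hfr₃

/-- Set the cells `[0][u]` of the array `a` to the value of `e` with `i = u`, for all `u < n`. -/
def mapP (a i : ℕ) (e : Expr) : Prog := forN i (.set a (.lit 0) (var i) e)

theorem wp_map {a i : ℕ} {e : Expr} (f : Fin n → ℕ) (hn : m 0 0 0 = n) (ha : 0 ≠ a) (hi : 0 ≠ i)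
    (hia : i ≠ a)
    (hf : ∀ m' : Mem, ∀ u : Fin n, (∀ b, b ≠ a → b ≠ i → m' b = m b) → m' a 0 u = m a 0 u →
      m' i 0 0 = u → e.eval m' = f u) :
    WP n (mapP a i e) m (fun m' => ∀ u : Fin n, m' a 0 u = f u) := by
  refine wp_for (fun j m' => (∀ u : Fin n, (u : ℕ) < j → m' a 0 u = f u) ∧
    ∀ u, j ≤ u → m' a 0 u = m a 0 u) hn (by simp [Prog.writes, ha, hi]) (by simp [Prog.writes, hia])
    ?_ ?_ ?_ ?_
  · intro j m x h
    simpa [write_ne _ _ _ hia.symm] using h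
  · simp
  · intro j m' hI hv hfr
    refine wp_set ?_
    have he := hf m' j (fun b hb hb' => hfr b (by simp [Prog.writes, hb, hb']))
      (hI.2 j le_rfl) hv
    simp only [eval_lit, eval_var, hv, he]
    constructor
    · intro u hu
      by_cases huj : u = j
      · subst huj; exact write_same _ _ _ _
      · have : (u : ℕ) ≠ j := fun h => huj (Fin.ext h)
        simp only [Mem.write, this, and_false, if_false]
        exact hI.1 u (by omega)
    · intro u hu
      have : u ≠ (j : ℕ) := by omega
      simp only [Mem.write, this, and_false, if_false]
      exact hI.2 u (by omega)
  · intro m' hI _ u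
    exact hI.1 u u.2

/-- Sum the values of `e` for all `i < n`, into the variable `c`. -/
def sumP (c i : ℕ) (e : Expr) : Prog :=
  .seq (setv c (.lit 0)) (forN i (setv c (.add (var c) e)))

theorem wp_sum {c i : ℕ} {e : Expr} (f : Fin n → ℕ) (hn : m 0 0 0 = n) (hc : 0 ≠ c) (hi : 0 ≠ i)
    (hic : i ≠ c)
    (hf : ∀ m' : Mem, ∀ u : Fin n, (∀ b, b ≠ c → b ≠ i → m' b = m b) → m' i 0 0 = u →
      e.eval m' = f u) :
    WP n (sumP c i e) m (fun m' => m' c 0 0 = ∑ u, f u) := by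
  refine wp_seq (R := fun m' => m' c 0 0 = 0) (wp_setv (write_same _ _ _ _)) ?_
  intro m₁ h₁ hfr₁
  have hfr₁' : ∀ b, b ≠ c → m₁ b = m b := fun b hb => hfr₁ b (by simpa [setv, Prog.writes] using hb)
  refine wp_for (fun j m' => m' c 0 0 = ∑ u : Fin n, if (u : ℕ) < j then f u else 0)
    (by rw [hfr₁' 0 hc, hn]) (by simp [setv, Prog.writes, hc, hi])
    (by simp [setv, Prog.writes, hic])
    ?_ ?_ ?_ ?_
  · intro j m x h
    simpa [write_ne _ _ _ hic.symm] using h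
  · simpa using h₁
  · intro j m' hI hv hfr
    refine wp_setv ?_
    have he := hf m' j (fun b hb hb' => (hfr b (by simp [setv, Prog.writes, hb, hb'])).trans
      (hfr₁' b hb)) hv
    rw [write_same]
    simp only [eval_add, eval_var, hI, he]
    have : f j = ∑ u : Fin n, if u = j then f u else 0 := by simp
    rw [this, ← Finset.sum_add_distrib]
    refine Finset.sum_congr rfl fun u _ => ?_
    by_cases h1 : u = j
    · subst h1; simp
    · have : (u : ℕ) ≠ j := fun h => h1 (Fin.ext h)
      simp only [h1, if_false, add_zero]
      congr 1
      exact propext ⟨fun h => by omega, fun h => by omega⟩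
  · intro m' hI _
    rw [hI]
    exact Finset.sum_congr rfl fun u _ => by simp

/-- Find a value of `i` with `e ≠ 0`: the variable `r` is set to `i + 1`, or to `0` if there is
none. -/
def findP (r i : ℕ) (e : Expr) : Prog :=
  .seq (setv r (.lit 0)) (forN i (.ite e (setv r (.add (var i) (.lit 1))) .skip))

theorem wp_find {r i : ℕ} {e : Expr} (φ : Fin n → Prop) (hn : m 0 0 0 = n) (hr : 0 ≠ r) (hi : 0 ≠ i)
    (hir : i ≠ r)
    (hf : ∀ m' : Mem, ∀ u : Fin n, (∀ b, b ≠ r → b ≠ i → m' b = m b) → m' i 0 0 = u →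
      (e.eval m' ≠ 0 ↔ φ u)) :
    WP n (findP r i e) m (fun m' => (m' r 0 0 = 0 ∧ ∀ u, ¬ φ u) ∨
      ∃ u : Fin n, m' r 0 0 = u + 1 ∧ φ u) := by
  refine wp_seq (R := fun m' => m' r 0 0 = 0) (wp_setv (write_same _ _ _ _)) ?_
  intro m₁ h₁ hfr₁
  have hfr₁' : ∀ b, b ≠ r → m₁ b = m b := fun b hb => hfr₁ b (by simpa [setv, Prog.writes] using hb)
  refine wp_for (fun j m' => (m' r 0 0 = 0 ∧ ∀ u : Fin n, (u : ℕ) < j → ¬ φ u) ∨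
      ∃ u : Fin n, m' r 0 0 = u + 1 ∧ φ u)
    (by rw [hfr₁' 0 hr, hn]) (by simp [setv, Prog.writes, hr, hi])
    (by simp [setv, Prog.writes, hir])
    ?_ ?_ ?_ ?_
  · intro j m x h
    simpa [write_ne _ _ _ hir.symm] using h
  · simpa using Or.inl h₁
  · intro j m' hI hv hfr
    have he := hf m' j (fun b hb hb' => (hfr b (by simp [setv, Prog.writes, hb, hb'])).trans
      (hfr₁' b hb)) hv
    refine wp_ite (fun hne => wp_setv (Or.inr ⟨j, ?_, he.1 hne⟩)) (fun h0 => wp_skip ?_)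
    · rw [write_same]
      simp [hv]
    · rcases hI with ⟨h2, h3⟩ | h2
      · left
        refine ⟨h2, fun u hu => ?_⟩
        by_cases h1 : u = j
        · rw [h1, ← he, h0]; exact fun h => h rfl
        · have : (u : ℕ) ≠ j := fun h => h1 (Fin.ext h)
          exact h3 u (by omega)
      · exact Or.inr h2
  · intro m' hI _
    rcases hI with ⟨h2, h3⟩ | h2
    · exact Or.inl ⟨h2, fun u => h3 u u.2⟩
    · exact Or.inr h2

/-- Run the body for all values of `i < n` until it sets the variable `s`. -/
def searchP (s i : ℕ) (body : Prog) : Prog := forN i (.ite (var s) .skip body)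

/-- After success the remaining iterations only move the counter, so `R` as well as `I` must be
stable under that. The negative outcome records that `φ` fails everywhere. -/
theorem wp_search {s i : ℕ} {body : Prog} (φ : Fin n → Prop) (I R : Mem → Prop) (hn : m 0 0 0 = n)
    (h0 : 0 ∉ i :: body.writes) (hi : i ∉ body.writes) (his : i ≠ s)
    (hI : ∀ m x, I m → I (m.write i 0 0 x)) (hR : ∀ m x, R m → R (m.write i 0 0 x))
    (hs : m s 0 0 = 0) (init : I m)
    (step : ∀ j : Fin n, ∀ m', I m' → m' s 0 0 = 0 → m' i 0 0 = j →
      (∀ a, a ∉ i :: body.writes → m' a = m a) →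
      WP n body m' (fun m'' => (m'' s 0 0 = 0 ∧ I m'' ∧ ¬ φ j) ∨ (m'' s 0 0 ≠ 0 ∧ R m''))) :
    WP n (searchP s i body) m (fun m' => (m' s 0 0 = 0 ∧ I m' ∧ ∀ j, ¬ φ j) ∨
      (m' s 0 0 ≠ 0 ∧ R m')) := by
  refine wp_for (fun j m' => (m' s 0 0 = 0 ∧ I m' ∧ ∀ u : Fin n, (u : ℕ) < j → ¬ φ u) ∨
      (m' s 0 0 ≠ 0 ∧ R m')) hn (by simpa [Prog.writes] using h0) (by simpa [Prog.writes] using hi)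
    ?_ ?_ ?_ ?_
  · intro j m x h
    rw [write_ne _ _ _ his.symm]
    rcases h with ⟨h1, h2, h3⟩ | ⟨h1, h2⟩
    · exact Or.inl ⟨h1, hI _ _ h2, h3⟩
    · exact Or.inr ⟨h1, hR _ _ h2⟩
  · exact Or.inl ⟨hs, init, fun u hu => absurd hu (Nat.not_lt_zero _)⟩
  · intro j m' h hv hfr
    refine wp_ite (fun hne => wp_skip ?_) (fun h0 => ?_)
    · rcases h with ⟨h1, -, -⟩ | h
      · exact absurd h1 hne
      · exact Or.inr h
    · rcases h with ⟨h1, h2, h3⟩ | ⟨h1, h2⟩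
      · refine (step j m' h2 h1 hv (fun a ha => hfr a (by simpa [Prog.writes] using ha))).mono ?_
        intro m'' h4 _
        rcases h4 with ⟨h5, h6, h7⟩ | h4
        · refine Or.inl ⟨h5, h6, fun u hu => ?_⟩
          by_cases h8 : u = j
          · rwa [h8]
          · have : (u : ℕ) ≠ j := fun h => h8 (Fin.ext h)
            exact h3 u (by omega)
        · exact Or.inr h4
      · exact absurd h0 h1
  · intro m' h _
    rcases h with ⟨h1, h2, h3⟩ | h
    · exact Or.inl ⟨h1, h2, fun u => h3 u u.2⟩
    · exact Or.inr h

end RAM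

/-! ### Vertex sets in memory, neighbour counts and cores -/

namespace RAM

open CycleCore

set_option linter.unusedSectionVars false

/-- A row of the memory holds the characteristic vector of `A`. -/
def Has {n : ℕ} (r : ℕ → ℕ) (A : Finset (Fin n)) : Prop := ∀ v : Fin n, r v = if v ∈ A then 1 else 0

/-- The memory holds the graph `G`. -/
def HasGraph {n : ℕ} (G : SimpleGraph (Fin n)) [DecidableRel G.Adj] (m : Mem) : Prop :=
  m 0 0 0 = n ∧ (∀ u v : Fin n, m 2 u v = if G.Adj u v then 1 else 0) ∧ ∀ i j, m 2 i j ≤ 1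

variable {n : ℕ} {G : SimpleGraph (Fin n)} [DecidableRel G.Adj] {m : Mem}

theorem HasGraph.of_eq {m' : Mem} (h : HasGraph G m) (h0 : m' 0 = m 0) (h2 : m' 2 = m 2) :
    HasGraph G m' := by
  unfold HasGraph; rw [h0, h2]; exact h

theorem Has.of_eq {m' : Mem} {a : ℕ} {A : Finset (Fin n)} (h : Has (m a 0) A) (he : m' a = m a) :
    Has (m' a 0) A := by rw [he]; exact h

theorem sum_mask (A : Finset (Fin n)) : ∑ u : Fin n, (if u ∈ A then 1 else 0) = A.card := by simp

theorem Has.insert {A : Finset (Fin n)} {a i : ℕ} (h : Has (m a i) A) (v : Fin n) :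
    Has ((m.write a i v 1) a i) (insert v A) := by
  intro u
  by_cases hu : u = v
  · subst hu; simp [Mem.write]
  · have : (u : ℕ) ≠ v := fun e => hu (Fin.ext e)
    simp [Mem.write, this, hu, h u]

theorem Has.erase {A : Finset (Fin n)} {a i : ℕ} (h : Has (m a i) A) (v : Fin n) :
    Has ((m.write a i v 0) a i) (A.erase v) := by
  intro u
  by_cases hu : u = v
  · subst hu; simp [Mem.write]
  · have : (u : ℕ) ≠ v := fun e => hu (Fin.ext e)
    simp [Mem.write, this, hu, h u]

/-- For every vertex `v`, store in `dst[0][v]` the number of neighbours `u` of `v` with `e = 1`. -/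
def nbrP (dst : ℕ) (e : Expr) : Prog :=
  -- For values 0 and 1, `x + y - 1` is conjunction under truncated subtraction.
  forN 10 (.seq (sumP 12 11 (.sub (.add (.get 2 (var 10) (var 11)) e) (.lit 1)))
    (.set dst (.lit 0) (var 10) (var 12)))

theorem wp_nbr {dst : ℕ} {e : Expr} (A : Finset (Fin n)) (hG : HasGraph G m) (hd : 12 < dst)
    (he : ∀ m' : Mem, ∀ u : Fin n, (∀ b, b ≠ 10 → b ≠ 11 → b ≠ 12 → b ≠ dst → m' b = m b) →
      m' 11 0 0 = u → e.eval m' = if u ∈ A then 1 else 0) :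
    WP n (nbrP dst e) m (fun m' => ∀ v : Fin n, m' dst 0 v = nb G A v) := by
  have hw : (Prog.seq (sumP 12 11 (.sub (.add (.get 2 (var 10) (var 11)) e) (.lit 1)))
    (.set dst (.lit 0) (var 10) (var 12))).writes = [12, 11, 12, 11, dst] := rfl
  have hd2 : dst ≠ 12 ∧ dst ≠ 11 ∧ dst ≠ 10 ∧ dst ≠ 2 ∧ dst ≠ 0 := by omega
  refine wp_for (fun j m' => ∀ v : Fin n, (v : ℕ) < j → m' dst 0 v = nb G A v) hG.1
    (by rw [hw]; simp; omega) (by rw [hw]; simp; omega) ?_ (by simp) ?_ ?_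
  · intro j m x h
    simpa [write_ne _ _ _ hd2.2.2.1] using h
  · intro j m' hI hv hfr
    rw [hw] at hfr
    have hfr' : ∀ b, b ≠ 10 → b ≠ 11 → b ≠ 12 → b ≠ dst → m' b = m b := fun b h1 h2 h3 h4 =>
      hfr b (by simp [h1, h2, h3, h4])
    refine wp_seq (wp_sum (fun u => if u ∈ A ∧ G.Adj j u then 1 else 0) ?_ (by decide) (by decide)
      (by decide) ?_) ?_
    · rw [hfr' 0 (by decide) (by decide) (by decide) hd2.2.2.2.2.symm]; exact hG.1
    · intro m'' u hb hu
      have e1 := he m'' u (fun b h1 h2 h3 h4 => (hb b h3 h2).trans (hfr' b h1 h2 h3 h4)) hu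
      have e2 : m'' 2 = m 2 := (hb 2 (by decide) (by decide)).trans
        (hfr' 2 (by decide) (by decide) (by decide) hd2.2.2.2.1.symm)
      have e3 : m'' 10 0 0 = j := by rw [hb 10 (by decide) (by decide), hv]
      simp only [eval_sub, eval_add, eval_get, eval_var, eval_lit, e1, e2, e3, hu, hG.2.1]
      by_cases h1 : G.Adj j u <;> by_cases h2 : u ∈ A <;> simp [h1, h2]
    · intro m'' hs hfr2
      refine wp_set ?_
      have hfr2' : ∀ b, b ≠ 12 → b ≠ 11 → m'' b = m' b := fun b h1 h2 =>
        hfr2 b (by simp [sumP, setv, forN, Prog.writes, h1, h2])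
      have e3 : m'' 10 0 0 = j := by rw [hfr2' 10 (by decide) (by decide), hv]
      have e4 : m'' 12 0 0 = nb G A j := by
        rw [hs, nb, Finset.card_filter, ← Finset.sum_filter, ← Finset.sum_filter, Finset.filter_and]
        refine Finset.sum_congr ?_ fun _ _ => rfl
        ext x; simp
      simp only [eval_lit, eval_var, e3, e4]
      intro v hvj
      by_cases hvj' : v = j
      · subst hvj'; exact write_same _ _ _ _
      · have : (v : ℕ) ≠ j := fun h => hvj' (Fin.ext h)
        simp only [Mem.write, this, and_false, if_false]
        rw [hfr2' dst hd2.1 hd2.2.1]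
        exact hI v (by omega)
  · intro m' hI _ v
    exact hI v v.2

/-- Replace the set in array `20` by its core relative to the set in array `21`. The numbers of
neighbours in the union of the two sets are stored in array `22`. -/
def coreP : Prog :=
  .seq (setv 15 (.lit 1)) (.loop (var 15)
    (.seq (nbrP 22 (.add (row 20 11) (row 21 11)))
    (.seq (findP 15 13 (.sub (row 20 13) (.sub (row 22 13) (.lit 1))))
      (.ite (var 15) (.set 20 (.lit 0) (.sub (var 15) (.lit 1)) (.lit 0)) .skip))))

/-- Removing a vertex with at most one neighbour preserves the core by `core_erase`; when no such
vertex is left, the set is closed and `core_eq` applies. -/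
theorem wp_core {M F : Finset (Fin n)} (hG : HasGraph G m) (hM : Has (m 20 0) M)
    (hF : Has (m 21 0) F) (hd : Disjoint M F) :
    WP n coreP m (fun m' => Has (m' 20 0) (core G F M) ∧
      ∀ v : Fin n, m' 22 0 v = nb G (core G F M ∪ F) v) := by
  refine wp_seq (R := fun m' => m' 15 0 0 = 1) (wp_setv (write_same _ _ _ _)) ?_
  intro m₁ h₁ fr₁
  have hcard : M.card ≤ n := by simpa using Finset.card_le_univ M
  -- The measure is the size of the current set, plus one for the final round that finds nothing to
  -- remove.
  refine wp_loop (fun j m' => ∃ M' : Finset (Fin n), M' ⊆ M ∧ core G F M' = core G F M ∧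
    Has (m' 20 0) M' ∧ (m' 15 0 0 = 0 → Closed G F M' ∧ ∀ v : Fin n, m' 22 0 v = nb G (M' ∪ F) v) ∧
    M'.card + (if m' 15 0 0 = 0 then 0 else 1) ≤ j) (M.card + 1) (by omega)
    ⟨M, subset_rfl, rfl, hM.of_eq (fr₁ 20 (by decide)), by simp [h₁], by simp [h₁]⟩ ?_ ?_
  · rintro j m₂ ⟨M', hsub, hcore, hM', -, hj⟩ fr₂ hne
    have hne' : m₂ 15 0 0 ≠ 0 := hne
    rw [if_neg hne'] at hj
    have fr : ∀ a, a ∉ coreP.writes → m₂ a = m a := fun a ha =>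
      (fr₂ a (fun h => ha (by simp only [coreP, Prog.writes, List.mem_append] at h ⊢; tauto))).trans
      (fr₁ a (fun h => ha (by simp only [coreP, Prog.writes, List.mem_append] at h ⊢; tauto)))
    have hG₂ := hG.of_eq (fr 0 (by decide)) (fr 2 (by decide))
    have hF₂ := hF.of_eq (fr 21 (by decide))
    have hd₂ := hd.mono_left hsub
    refine wp_seq (wp_nbr (M' ∪ F) hG₂ (by decide) ?_) ?_
    · intro m' u hfr hu
      simp only [eval_add, eval_row, hu]
      rw [hfr 20 (by decide) (by decide) (by decide) (by decide),
        hfr 21 (by decide) (by decide) (by decide) (by decide), hM' u, hF₂ u]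
      have : u ∈ M' → u ∉ F := fun h => Finset.disjoint_left.1 hd₂ h
      by_cases h1 : u ∈ M' <;> by_cases h2 : u ∈ F <;> simp_all
    · intro m₃ h₃ fr₃
      have hM₃ := hM'.of_eq (fr₃ 20 (by decide))
      refine wp_seq (wp_find (fun u => u ∈ M' ∧ nb G (M' ∪ F) u ≤ 1) ?_ (by decide)
        (by decide) (by decide) ?_) ?_
      · rw [fr₃ 0 (by decide)]; exact hG₂.1
      · intro m' u hfr hu
        simp only [eval_sub, eval_row, hu, eval_lit]
        rw [hfr 20 (by decide) (by decide), hfr 22 (by decide) (by decide), h₃ u, hM₃ u]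
        by_cases h1 : u ∈ M' <;> by_cases h2 : nb G (M' ∪ F) u ≤ 1 <;> simp [h1, h2]
        omega
      · intro m₄ h₄ fr₄
        have hM₄ := hM₃.of_eq (fr₄ 20 (by decide))
        refine wp_ite (fun he => wp_set ?_) (fun he => wp_skip ?_)
        · rcases h₄ with ⟨h5, -⟩ | ⟨u, h5, h6⟩
          · exact absurd h5 he
          · have h7 := h6
            have hc := Finset.card_erase_add_one h7.1
            refine ⟨M'.card, by omega, M'.erase u, (Finset.erase_subset _ _).trans hsub,
              (core_erase h7.2).trans hcore, ?_, ?_, ?_⟩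
            · simp only [eval_lit, eval_sub, eval_var, h5, Nat.add_sub_cancel]
              exact hM₄.erase u
            · intro h8
              rw [write_ne _ _ _ (by decide)] at h8
              exact absurd h8 he
            · rw [write_ne _ _ _ (by decide), if_neg (show m₄ 15 0 0 ≠ 0 from he)]
              omega
        · rcases h₄ with ⟨h5, h6⟩ | ⟨u, h5, h6⟩
          · refine ⟨M'.card, by omega, M', hsub, hcore, hM₄, fun _ => ⟨?_, ?_⟩,
              by rw [if_pos h5]; omega⟩
            · intro u hu
              by_contra hlt
              exact h6 u ⟨hu, by omega⟩
            · intro v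
              rw [fr₄ 22 (by decide)]
              exact h₃ v
          · have : m₄ 15 0 0 = 0 := he
            omega
  · rintro j m₂ ⟨M', hsub, hcore, hM', h5, -⟩ - he
    obtain ⟨h6, h7⟩ := h5 he
    have : M' = core G F M := core_eq hsub h6 (hcore ▸ core_subset F M')
    exact this ▸ ⟨hM', h7⟩

theorem wp_seq_set {a : ℕ} {i j e : Expr} {q : Prog} {Q : Mem → Prop}
    (h : WP n q (m.write a (i.eval m) (j.eval m) (e.eval m)) Q) :
    WP n (.seq (.set a i j e) q) m Q :=
  wp_seq (R := fun m' => m' = m.write a (i.eval m) (j.eval m) (e.eval m)) (wp_set rfl)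
    (by rintro m' rfl _; exact h)

/-- Copy the row `0` of an array. -/
theorem wp_copy {A : Finset (Fin n)} {a i : ℕ} {e : Expr} (hn : m 0 0 0 = n) (ha : 0 ≠ a)
    (hi : 0 ≠ i) (hia : i ≠ a)
    (hf : ∀ m' : Mem, ∀ u : Fin n, (∀ b, b ≠ a → b ≠ i → m' b = m b) → m' a 0 u = m a 0 u →
      m' i 0 0 = u → e.eval m' = if u ∈ A then 1 else 0) :
    WP n (mapP a i e) m (fun m' => Has (m' a 0) A) :=
  wp_map (fun u => if u ∈ A then 1 else 0) hn ha hi hia hf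

theorem wp_card {A : Finset (Fin n)} {c i a : ℕ} (hn : m 0 0 0 = n) (hA : Has (m a 0) A)
    (hc : 0 ≠ c) (hi : 0 ≠ i) (hic : i ≠ c) (hac : a ≠ c) (hai : a ≠ i) :
    WP n (sumP c i (row a i)) m (fun m' => m' c 0 0 = A.card) := by
  refine (wp_sum (fun u => if u ∈ A then 1 else 0) hn hc hi hic ?_).mono ?_
  · intro m' u hb hu
    simp only [eval_row, hu, hb a hac hai, hA u]
  · intro m' h _
    rw [h, sum_mask]

/-! ### Local minimality by exchanges -/

/-- The memory holds the graph, the set `W` in the array `32` and the set `F` in the array `21`. -/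
def LocalEnv (G : SimpleGraph (Fin n)) [DecidableRel G.Adj] (F W : Finset (Fin n)) (m : Mem) :
    Prop := HasGraph G m ∧ Has (m 32 0) W ∧ Has (m 21 0) F

theorem LocalEnv.of_eq {F W : Finset (Fin n)} {m' : Mem} (h : LocalEnv G F W m) (h0 : m' 0 = m 0)
    (h2 : m' 2 = m 2) (h32 : m' 32 = m 32) (h21 : m' 21 = m 21) : LocalEnv G F W m' :=
  ⟨h.1.of_eq h0 h2, h.2.1.of_eq h32, h.2.2.of_eq h21⟩

/-- Test whether the exchange given by the variables `40`, `41` and `42` is possible; if it is, then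
carry it out and set the variable `43`. -/
def exchangeP : Prog :=
  -- A sum of three 0/1 values exceeds 2 only if all are 1. The sum of both truncated differences
  -- below vanishes only if the two vertices agree.
  .ite (.sub (.add (.add (row 33 40) (row 33 41)) (row 32 42)) (.lit 2))
    (.ite (.add (.sub (var 40) (var 41)) (.sub (var 41) (var 40)))
      (.seq (mapP 20 13 (row 33 13))
      (.seq (.set 20 (.lit 0) (var 40) (.lit 0))
      (.seq (.set 20 (.lit 0) (var 41) (.lit 0))
      (.seq (.set 20 (.lit 0) (var 42) (.lit 1))
      (.seq coreP
      (.seq (sumP 14 13 (row 20 13))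
        (.ite (var 14)
          (.seq (.set 33 (.lit 0) (var 40) (.lit 0))
          (.seq (.set 33 (.lit 0) (var 41) (.lit 0))
          (.seq (.set 33 (.lit 0) (var 42) (.lit 1))
            (setv 43 (.lit 1)))))
          .skip)))))))
      .skip)
    .skip

theorem wp_exchange {F W P : Finset (Fin n)} {p₁ p₂ w : Fin n} (hE : LocalEnv G F W m)
    (hd : Disjoint W F) (hPW : P ⊆ W) (hP : Has (m 33 0) P) (h₁ : m 40 0 0 = p₁)
    (h₂ : m 41 0 0 = p₂) (h₃ : m 42 0 0 = w) (h0 : m 43 0 0 = 0) :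
    WP n exchangeP m (fun m' => (m' 43 0 0 = 0 ∧ (LocalEnv G F W m' ∧ Has (m' 33 0) P) ∧
        ¬ (p₁ ∈ P ∧ p₂ ∈ P ∧ p₁ ≠ p₂ ∧ w ∈ W ∧ Cyc G F (insert w ((P.erase p₁).erase p₂)))) ∨
      (m' 43 0 0 ≠ 0 ∧ (LocalEnv G F W m' ∧ ∃ P' : Finset (Fin n), Has (m' 33 0) P' ∧
        P'.card < P.card ∧ P' ⊆ W ∧ Cyc G F P'))) := by
  refine wp_ite (fun he => ?_) (fun he => wp_skip (Or.inl ⟨h0, ⟨hE, hP⟩, ?_⟩))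
  swap
  · rintro ⟨hp₁, hp₂, -, hw, -⟩
    simp [h₁, h₂, h₃, hP p₁, hP p₂, hE.2.1 w, hp₁, hp₂, hw] at he
  have hmem : p₁ ∈ P ∧ p₂ ∈ P ∧ w ∈ W := by
    by_contra hno
    refine he ?_
    simp only [eval_sub, eval_add, eval_row, eval_lit, h₁, h₂, h₃, hP p₁, hP p₂, hE.2.1 w]
    by_cases h4 : p₁ ∈ P <;> by_cases h5 : p₂ ∈ P <;> by_cases h6 : w ∈ W <;> simp_all
  refine wp_ite (fun he₂ => ?_) (fun he₂ => wp_skip (Or.inl ⟨h0, ⟨hE, hP⟩, ?_⟩))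
  swap
  · rintro ⟨-, -, hne, -, -⟩
    refine hne (Fin.ext ?_)
    simp only [eval_sub, eval_add, eval_var, h₁, h₂] at he₂
    omega
  have hne : p₁ ≠ p₂ := by
    rintro rfl
    refine he₂ ?_
    simp [h₁, h₂]
  obtain ⟨hp₁, hp₂, hw⟩ := hmem
  refine wp_seq (wp_copy (A := P) hE.1.1 (by decide) (by decide) (by decide) ?_) ?_
  · intro m' u hb _ hu
    simp only [eval_row, hu, hb 33 (by decide) (by decide), hP u]
  intro m₁ hM₁ fr₁
  refine wp_seq_set (wp_seq_set (wp_seq_set ?_))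
  have e₁ : m₁ 40 0 0 = p₁ := by rw [fr₁ 40 (by decide), h₁]
  have e₂ : m₁ 41 0 0 = p₂ := by rw [fr₁ 41 (by decide), h₂]
  have e₃ : m₁ 42 0 0 = w := by rw [fr₁ 42 (by decide), h₃]
  simp only [eval_lit, eval_var, write_ne _ _ _ (show 41 ≠ 20 by decide),
    write_ne _ _ _ (show 42 ≠ 20 by decide), e₁, e₂, e₃]
  obtain ⟨m₂, hm₂⟩ : ∃ m₂, m₂ = ((m₁.write 20 0 p₁ 0).write 20 0 p₂ 0).write 20 0 w 1 := ⟨_, rfl⟩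
  have hM₂ : Has (m₂ 20 0) (insert w ((P.erase p₁).erase p₂)) := by
    rw [hm₂]; exact ((hM₁.erase p₁).erase p₂).insert w
  have fr₂ : ∀ a, a ≠ 20 → a ≠ 13 → m₂ a = m a := by
    intro a ha ha'
    rw [hm₂, write_ne _ _ _ ha, write_ne _ _ _ ha, write_ne _ _ _ ha]
    exact fr₁ a (by simp [mapP, forN, setv, Prog.writes, ha, ha'])
  rw [← hm₂]
  have hE₂ : LocalEnv G F W m₂ := hE.of_eq (fr₂ 0 (by decide) (by decide))
    (fr₂ 2 (by decide) (by decide)) (fr₂ 32 (by decide) (by decide))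
    (fr₂ 21 (by decide) (by decide))
  have hsub : insert w ((P.erase p₁).erase p₂) ⊆ W :=
    Finset.insert_subset hw (((Finset.erase_subset _ _).trans (Finset.erase_subset _ _)).trans hPW)
  refine wp_seq (wp_core hE₂.1 hM₂ hE₂.2.2 (hd.mono_left hsub)) ?_
  intro m₃ ⟨hM₃, _⟩ fr₃
  have hE₃ : LocalEnv G F W m₃ := hE₂.of_eq (fr₃ 0 (by decide)) (fr₃ 2 (by decide))
    (fr₃ 32 (by decide)) (fr₃ 21 (by decide))
  refine wp_seq (wp_card hE₃.1.1 hM₃ (by decide) (by decide) (by decide) (by decide) (by decide)) ?_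
  intro m₄ h₄ fr₄
  have hE₄ : LocalEnv G F W m₄ := hE₃.of_eq (fr₄ 0 (by decide)) (fr₄ 2 (by decide))
    (fr₄ 32 (by decide)) (fr₄ 21 (by decide))
  have hP₄ : Has (m₄ 33 0) P := by
    refine hP.of_eq ?_
    rw [fr₄ 33 (by decide), fr₃ 33 (by decide), fr₂ 33 (by decide) (by decide)]
  have hv : ∀ a, a ∉ coreP.writes → a ≠ 14 → a ≠ 13 → a ≠ 20 → m₄ a = m a := by
    intro a h5 h6 h7 h8
    rw [fr₄ a (by simp [sumP, forN, setv, Prog.writes, h6, h7]), fr₃ a h5, fr₂ a h8 h7]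
  refine wp_ite (fun he₃ => ?_) (fun he₃ => wp_skip (Or.inl ⟨?_, ⟨hE₄, hP₄⟩, ?_⟩))
  · have hcyc : Cyc G F (insert w ((P.erase p₁).erase p₂)) := by
      rw [← core_nonempty, ← Finset.card_pos, ← h₄]
      exact Nat.pos_of_ne_zero he₃
    refine wp_seq_set (wp_seq_set (wp_seq_set (wp_setv (Or.inr ⟨?_, ?_, ?_⟩))))
    · rw [write_same]; exact one_ne_zero
    · exact hE₄.of_eq rfl rfl rfl rfl
    · refine ⟨_, ?_, ?_, hsub, hcyc⟩
      · simp only [eval_lit, eval_var, write_ne _ _ _ (show 41 ≠ 33 by decide),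
          write_ne _ _ _ (show 42 ≠ 33 by decide), write_ne _ _ _ (show 33 ≠ 43 by decide)]
        rw [hv 40 (by decide) (by decide) (by decide) (by decide), h₁,
          hv 41 (by decide) (by decide) (by decide) (by decide), h₂,
          hv 42 (by decide) (by decide) (by decide) (by decide), h₃]
        exact ((hP₄.erase p₁).erase p₂).insert w
      · have := Finset.card_erase_add_one hp₁
        have := Finset.card_erase_add_one (Finset.mem_erase.2 ⟨hne.symm, hp₂⟩)
        have := Finset.card_insert_le w ((P.erase p₁).erase p₂)
        omega
  · rw [hv 43 (by decide) (by decide) (by decide) (by decide), h0]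
  · rintro ⟨-, -, -, -, hcyc⟩
    rw [← core_nonempty, ← Finset.card_pos, ← h₄] at hcyc
    have he₃' : m₄ 14 0 0 = 0 := he₃
    omega

/-- Carry out exchanges as long as possible. -/
def localP : Prog :=
  .seq (setv 43 (.lit 1)) (.loop (var 43) (.seq (setv 43 (.lit 0))
    (searchP 43 40 (searchP 43 41 (searchP 43 42 exchangeP)))))

/-- Each exchange makes `P` smaller, which bounds the rounds by `|P| + 1`; a round without exchange
has tried all triples, which is the field `exch`. -/
theorem wp_local {F W P : Finset (Fin n)} (hE : LocalEnv G F W m) (hd : Disjoint W F)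
    (hPW : P ⊆ W) (hP : Has (m 33 0) P) (hc : Cyc G F P) :
    WP n localP m (fun m' => ∃ P', Has (m' 33 0) P' ∧ LocMin G F W P') := by
  refine wp_seq (R := fun m' => m' 43 0 0 = 1) (wp_setv (write_same _ _ _ _)) ?_
  intro m₁ h₁ fr₁
  have hcard : P.card ≤ n := by simpa using Finset.card_le_univ P
  refine wp_loop (fun j m' => LocalEnv G F W m' ∧ ∃ P : Finset (Fin n), Has (m' 33 0) P ∧ P ⊆ W ∧
    Cyc G F P ∧ (m' 43 0 0 = 0 → LocMin G F W P) ∧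
    P.card + (if m' 43 0 0 = 0 then 0 else 1) ≤ j) (P.card + 1) (by omega)
    ⟨hE.of_eq (fr₁ 0 (by decide)) (fr₁ 2 (by decide)) (fr₁ 32 (by decide)) (fr₁ 21 (by decide)),
      P, hP.of_eq (fr₁ 33 (by decide)), hPW, hc, by simp [h₁], by simp [h₁]⟩ ?_ ?_
  · rintro j m₂ ⟨hE₂, P, hP, hPW, hc, -, hj⟩ - hne
    rw [if_neg (show m₂ 43 0 0 ≠ 0 from hne)] at hj
    refine wp_seq (R := fun m' => m' 43 0 0 = 0) (wp_setv (write_same _ _ _ _)) ?_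
    intro m₃ h₃ fr₃
    let I : Mem → Prop := fun m' => LocalEnv G F W m' ∧ Has (m' 33 0) P
    let R : Mem → Prop := fun m' => LocalEnv G F W m' ∧ ∃ P' : Finset (Fin n), Has (m' 33 0) P' ∧
      P'.card < P.card ∧ P' ⊆ W ∧ Cyc G F P'
    have hI : ∀ i, 39 < i → ∀ m x, I m → I (m.write i 0 0 x) := by
      intro i hi m x h
      refine ⟨h.1.of_eq ?_ ?_ ?_ ?_, h.2.of_eq ?_⟩ <;> exact write_ne _ _ _ (by omega)
    have hR : ∀ i, 39 < i → ∀ m x, R m → R (m.write i 0 0 x) := by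
      rintro i hi m x ⟨h, P', h', h''⟩
      refine ⟨h.of_eq ?_ ?_ ?_ ?_, P', h'.of_eq ?_, h''⟩ <;> exact write_ne _ _ _ (by omega)
    have hI₃ : I m₃ := ⟨hE₂.of_eq (fr₃ 0 (by decide)) (fr₃ 2 (by decide)) (fr₃ 32 (by decide))
      (fr₃ 21 (by decide)), hP.of_eq (fr₃ 33 (by decide))⟩
    refine (wp_search (fun p₁ => ∃ p₂ w, p₁ ∈ P ∧ p₂ ∈ P ∧ p₁ ≠ p₂ ∧ w ∈ W ∧
      Cyc G F (insert w ((P.erase p₁).erase p₂))) I R hI₃.1.1.1 (by decide) (by decide) (by decide)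
      (hI 40 (by decide)) (hR 40 (by decide)) h₃ hI₃ ?_).mono ?_
    · intro p₁ m₄ hI₄ hs₄ hp₁ _
      refine (wp_search (fun p₂ => ∃ w, p₁ ∈ P ∧ p₂ ∈ P ∧ p₁ ≠ p₂ ∧ w ∈ W ∧
        Cyc G F (insert w ((P.erase p₁).erase p₂))) I R hI₄.1.1.1 (by decide) (by decide)
        (by decide) (hI 41 (by decide)) (hR 41 (by decide)) hs₄ hI₄ ?_).mono ?_
      · intro p₂ m₅ hI₅ hs₅ hp₂ fr₅
        refine (wp_search (fun w => p₁ ∈ P ∧ p₂ ∈ P ∧ p₁ ≠ p₂ ∧ w ∈ W ∧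
          Cyc G F (insert w ((P.erase p₁).erase p₂))) I R hI₅.1.1.1 (by decide) (by decide)
          (by decide) (hI 42 (by decide)) (hR 42 (by decide)) hs₅ hI₅ ?_).mono ?_
        · intro w m₆ hI₆ hs₆ hw fr₆
          refine wp_exchange hI₆.1 hd hPW hI₆.2 ?_ ?_ hw hs₆
          · rw [fr₆ 40 (by decide), fr₅ 40 (by decide), hp₁]
          · rw [fr₆ 41 (by decide), hp₂]
        · rintro m₆ (⟨h4, h5, h6⟩ | h4) _
          · exact Or.inl ⟨h4, h5, fun ⟨w, hw⟩ => h6 w hw⟩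
          · exact Or.inr h4
      · rintro m₅ (⟨h4, h5, h6⟩ | h4) _
        · exact Or.inl ⟨h4, h5, fun ⟨p₂, w, hw⟩ => h6 p₂ ⟨w, hw⟩⟩
        · exact Or.inr h4
    · rintro m₅ (⟨h4, h5, h6⟩ | ⟨h4, h5, P', h6, h7, h8, h9⟩) _
      · refine ⟨P.card, by omega, h5.1, P, h5.2, hPW, hc, fun _ => ⟨hPW, hc, ?_⟩,
          by rw [if_pos h4]; omega⟩
        intro p₁ hp₁ p₂ hp₂ hne w hw hcy
        exact h6 p₁ ⟨p₂, w, hp₁, hp₂, hne, hw, hcy⟩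
      · exact ⟨P.card, by omega, h5, P', h6, h8, h9, fun h => absurd h h4, by rw [if_neg h4]; omega⟩
  · rintro j m₂ ⟨-, P', hP', -, -, h, -⟩ - he
    exact ⟨P', hP', h he⟩

/-! ### Constructing the frame -/

/-- The vertices outside `S` without neighbours in `X`. -/
def outer (G : SimpleGraph (Fin n)) [DecidableRel G.Adj] (S X : Finset (Fin n)) :
    Finset (Fin n) := Finset.univ.filter fun w => w ∉ S ∧ nb G X w = 0

theorem mem_outer {S X : Finset (Fin n)} {w : Fin n} :
    w ∈ outer G S X ↔ w ∉ S ∧ nb G X w = 0 := by simp [outer]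

theorem disjoint_outer (S X : Finset (Fin n)) : Disjoint (outer G S X) (S \ X) := by
  rw [Finset.disjoint_left]
  intro w hw hF
  exact (mem_outer.1 hw).1 (Finset.mem_sdiff.1 hF).1

theorem wp_nbr_mask {dst a : ℕ} {A : Finset (Fin n)} (hG : HasGraph G m) (hA : Has (m a 0) A)
    (hd : 12 < dst) (ha : 12 < a) (hda : a ≠ dst) :
    WP n (nbrP dst (row a 11)) m (fun m' => ∀ v : Fin n, m' dst 0 v = nb G A v) := by
  refine wp_nbr A hG hd ?_
  intro m' u hb hu
  simp only [eval_row, hu, hb a (by omega) (by omega) (by omega) hda, hA u]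

/-- From the sets in the arrays `30` and `31`, compute the free part of the former, the vertices
outside, and the size of the core of the set of these. -/
def prepareP : Prog :=
  .seq (mapP 21 13 (.sub (row 30 13) (row 31 13)))
  (.seq (nbrP 34 (row 31 11))
  (.seq (mapP 32 13 (.sub (.lit 1) (.add (row 30 13) (row 34 13))))
  (.seq (mapP 20 13 (row 32 13))
  (.seq coreP (sumP 44 13 (row 20 13))))))

/-- The state after `prepareP`. -/
structure Prepared (G : SimpleGraph (Fin n)) [DecidableRel G.Adj] (S X : Finset (Fin n)) (m : Mem) :
    Prop where
  graph : HasGraph G m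
  hasS : Has (m 30 0) S
  hasX : Has (m 31 0) X
  free : Has (m 21 0) (S \ X)
  out : Has (m 32 0) (outer G S X)
  nbX : ∀ v : Fin n, m 34 0 v = nb G X v
  go : m 44 0 0 = 0 ↔ ¬ Cyc G (S \ X) (outer G S X)

theorem wp_prepare {S X : Finset (Fin n)} (hG : HasGraph G m) (hS : Has (m 30 0) S)
    (hX : Has (m 31 0) X) : WP n prepareP m (Prepared G S X) := by
  refine wp_seq (wp_copy (A := S \ X) hG.1 (by decide) (by decide) (by decide) ?_) ?_
  · intro m' u hb _ hu
    simp only [eval_sub, eval_row, hu, hb 30 (by decide) (by decide), hb 31 (by decide) (by decide),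
      hS u, hX u, Finset.mem_sdiff]
    by_cases h1 : u ∈ S <;> by_cases h2 : u ∈ X <;> simp [h1, h2]
  intro m₁ h₁ fr₁
  have hG₁ := hG.of_eq (fr₁ 0 (by decide)) (fr₁ 2 (by decide))
  refine wp_seq (wp_nbr_mask hG₁ (hX.of_eq (fr₁ 31 (by decide))) (by decide) (by decide)
    (by decide)) ?_
  intro m₂ h₂ fr₂
  have hG₂ := hG₁.of_eq (fr₂ 0 (by decide)) (fr₂ 2 (by decide))
  have hS₂ : Has (m₂ 30 0) S := hS.of_eq ((fr₂ 30 (by decide)).trans (fr₁ 30 (by decide)))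
  refine wp_seq (wp_copy (A := outer G S X) hG₂.1 (by decide) (by decide) (by decide) ?_) ?_
  · intro m' u hb _ hu
    simp only [eval_sub, eval_add, eval_lit, eval_row, hu, hb 30 (by decide) (by decide),
      hb 34 (by decide) (by decide), hS₂ u, h₂ u, mem_outer]
    by_cases h1 : u ∈ S <;> by_cases h2 : nb G X u = 0 <;> simp [h1, h2]
    omega
  intro m₃ h₃ fr₃
  have hG₃ := hG₂.of_eq (fr₃ 0 (by decide)) (fr₃ 2 (by decide))
  refine wp_seq (wp_copy (A := outer G S X) hG₃.1 (by decide) (by decide) (by decide) ?_) ?_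
  · intro m' u hb _ hu
    simp only [eval_row, hu, hb 32 (by decide) (by decide), h₃ u]
  intro m₄ h₄ fr₄
  have hG₄ := hG₃.of_eq (fr₄ 0 (by decide)) (fr₄ 2 (by decide))
  have hF₄ : Has (m₄ 21 0) (S \ X) := h₁.of_eq ((fr₄ 21 (by decide)).trans
    ((fr₃ 21 (by decide)).trans (fr₂ 21 (by decide))))
  refine wp_seq (wp_core hG₄ h₄ hF₄ (disjoint_outer S X)) ?_
  intro m₅ ⟨h₅, _⟩ fr₅
  have hG₅ := hG₄.of_eq (fr₅ 0 (by decide)) (fr₅ 2 (by decide))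
  refine (wp_card hG₅.1 h₅ (by decide) (by decide) (by decide) (by decide) (by decide)).mono ?_
  intro m₆ h₆ fr₆
  have fr : ∀ a, a ∉ prepareP.writes → m₆ a = m a := by
    intro a ha
    simp only [prepareP, Prog.writes, List.mem_append, not_or] at ha
    obtain ⟨a1, a2, a3, a4, a5, a6⟩ := ha
    rw [fr₆ a a6, fr₅ a a5, fr₄ a a4, fr₃ a a3, fr₂ a a2, fr₁ a a1]
  refine ⟨hG₅.of_eq (fr₆ 0 (by decide)) (fr₆ 2 (by decide)), hS.of_eq (fr 30 (by decide)),
    hX.of_eq (fr 31 (by decide)), ?_, ?_, ?_, ?_⟩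
  · exact hF₄.of_eq ((fr₆ 21 (by decide)).trans (fr₅ 21 (by decide)))
  · exact h₃.of_eq ((fr₆ 32 (by decide)).trans ((fr₅ 32 (by decide)).trans (fr₄ 32 (by decide))))
  · intro v
    rw [fr₆ 34 (by decide), fr₅ 34 (by decide), fr₄ 34 (by decide), fr₃ 34 (by decide)]
    exact h₂ v
  · rw [h₆, ← core_nonempty, Finset.not_nonempty_iff_eq_empty, Finset.card_eq_zero]

/-- One step of the construction of the induced subgraph of bounded degree. -/
def extendP : Prog :=
  .seq (mapP 33 13 (row 32 13))
  (.seq localP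
  (.seq (nbrP 35 (row 21 11))
  (.seq (nbrP 36 (row 33 11))
  (.seq (findP 15 13 (row 33 13))
  -- The form `1 - (1 - x)` truncates `x` to 0 or 1, acting as disjunction on sums; `x - (1 - y)`
  -- keeps a 0/1 value `x` exactly when `y` is positive.
  (.seq (mapP 31 13 (.sub (.lit 1) (.sub (.lit 1) (.add (row 31 13)
    (.add (.sub (row 33 13) (.sub (.lit 1) (row 35 13)))
      (.sub (row 21 13) (.sub (.lit 1) (row 36 13))))))))
  (.seq (.set 31 (.lit 0) (.sub (var 15) (.lit 1)) (.lit 1))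
    (mapP 30 13 (.add (row 30 13) (row 33 13)))))))))

theorem wp_extend {S X : Finset (Fin n)} (h : Prepared G S X m) (hf : Frame G S X)
    (hgo : m 44 0 0 ≠ 0) :
    WP n extendP m (fun m' => HasGraph G m' ∧ ∃ S' X', Has (m' 30 0) S' ∧ Has (m' 31 0) X' ∧
      Frame G S' X' ∧ S.card < S'.card) := by
  have hcyc : Cyc G (S \ X) (outer G S X) := by
    by_contra hno
    exact hgo (h.go.2 hno)
  refine wp_seq (wp_copy (A := outer G S X) h.graph.1 (by decide) (by decide) (by decide) ?_) ?_
  · intro m' u hb _ hu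
    simp only [eval_row, hu, hb 32 (by decide) (by decide), h.out u]
  intro m₁ h₁ fr₁
  have hE₁ : LocalEnv G (S \ X) (outer G S X) m₁ :=
    ⟨h.graph.of_eq (fr₁ 0 (by decide)) (fr₁ 2 (by decide)), h.out.of_eq (fr₁ 32 (by decide)),
      h.free.of_eq (fr₁ 21 (by decide))⟩
  refine wp_seq (wp_local hE₁ (disjoint_outer S X) subset_rfl h₁ hcyc) ?_
  rintro m₂ ⟨P, hP₂, hmin⟩ fr₂
  have hG₂ := hE₁.1.of_eq (fr₂ 0 (by decide)) (fr₂ 2 (by decide))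
  have hF₂ := hE₁.2.2.of_eq (fr₂ 21 (by decide))
  refine wp_seq (wp_nbr_mask hG₂ hF₂ (by decide) (by decide) (by decide)) ?_
  intro m₃ h₃ fr₃
  have hG₃ := hG₂.of_eq (fr₃ 0 (by decide)) (fr₃ 2 (by decide))
  have hP₃ := hP₂.of_eq (fr₃ 33 (by decide))
  refine wp_seq (wp_nbr_mask hG₃ hP₃ (by decide) (by decide) (by decide)) ?_
  intro m₄ h₄ fr₄
  have hG₄ := hG₃.of_eq (fr₄ 0 (by decide)) (fr₄ 2 (by decide))
  have hP₄ := hP₃.of_eq (fr₄ 33 (by decide))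
  refine wp_seq (wp_find (fun u => u ∈ P) hG₄.1 (by decide) (by decide) (by decide) ?_) ?_
  · intro m' u hb hu
    simp only [eval_row, hu, hb 33 (by decide) (by decide), hP₄ u]
    by_cases hu : u ∈ P <;> simp [hu]
  intro m₅ h₅ fr₅
  have hG₅ := hG₄.of_eq (fr₅ 0 (by decide)) (fr₅ 2 (by decide))
  obtain ⟨p, hpv, hp⟩ : ∃ p : Fin n, m₅ 15 0 0 = p + 1 ∧ p ∈ P := by
    rcases h₅ with ⟨-, h5⟩ | h5
    · obtain ⟨U, hU, ⟨x, hx⟩, -⟩ := hmin.cyc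
      exact absurd (hU hx) (h5 x)
    · exact h5
  have hP₅ := hP₄.of_eq (fr₅ 33 (by decide))
  have hF₅ : Has (m₅ 21 0) (S \ X) := hF₂.of_eq ((fr₅ 21 (by decide)).trans
    ((fr₄ 21 (by decide)).trans (fr₃ 21 (by decide))))
  have hX₅ : Has (m₅ 31 0) X := h.hasX.of_eq (by
    rw [fr₅ 31 (by decide), fr₄ 31 (by decide), fr₃ 31 (by decide), fr₂ 31 (by decide),
      fr₁ 31 (by decide)])
  have hS₅ : Has (m₅ 30 0) S := h.hasS.of_eq (by
    rw [fr₅ 30 (by decide), fr₄ 30 (by decide), fr₃ 30 (by decide), fr₂ 30 (by decide),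
      fr₁ 30 (by decide)])
  have h35 : ∀ v : Fin n, m₅ 35 0 v = nb G (S \ X) v := fun v => by
    rw [fr₅ 35 (by decide), fr₄ 35 (by decide)]; exact h₃ v
  have h36 : ∀ v : Fin n, m₅ 36 0 v = nb G P v := fun v => by
    rw [fr₅ 36 (by decide)]; exact h₄ v
  refine wp_seq (wp_copy (A := X ∪ (P.filter (fun v => 0 < nb G (S \ X) v) ∪
      (S \ X).filter (fun v => 0 < nb G P v))) hG₅.1 (by decide) (by decide) (by decide) ?_) ?_
  · intro m' u hb h31 hu
    simp only [eval_sub, eval_add, eval_lit, eval_row, hu, h31, hb 33 (by decide) (by decide),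
      hb 35 (by decide) (by decide), hb 36 (by decide) (by decide), hb 21 (by decide) (by decide),
      hX₅ u, hP₅ u, hF₅ u, h35 u, h36 u, Finset.mem_union, Finset.mem_filter]
    by_cases h1 : u ∈ X <;> by_cases h2 : u ∈ P <;> by_cases h3 : u ∈ S \ X <;>
      rcases Nat.eq_zero_or_pos (nb G (S \ X) u) with h4 | h4 <;>
      rcases Nat.eq_zero_or_pos (nb G P u) with h5 | h5 <;>
      simp only [h1, h2, h3, h4, h5, if_true, if_false, lt_irrefl, and_true, and_false, or_true,
        or_false] <;> omega
  intro m₆ h₆ fr₆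
  refine wp_seq_set ?_
  have e15 : m₆ 15 0 0 = p + 1 := by rw [fr₆ 15 (by decide), hpv]
  simp only [eval_lit, eval_var, eval_sub, e15, Nat.add_sub_cancel]
  have hX₇ := h₆.insert p
  have hG₆ := hG₅.of_eq (fr₆ 0 (by decide)) (fr₆ 2 (by decide))
  have hdPS : Disjoint S P := by
    rw [Finset.disjoint_right]
    intro w hw
    exact (mem_outer.1 (hmin.sub hw)).1
  refine (wp_copy (A := S ∪ P) (by exact hG₆.1) (by decide) (by decide) (by decide) ?_).mono ?_
  · intro m' u hb h30 hu
    simp only [eval_add, eval_row, hu, h30, hb 33 (by decide) (by decide),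
      write_ne _ _ _ (show 30 ≠ 31 by decide), write_ne _ _ _ (show 33 ≠ 31 by decide)]
    rw [fr₆ 30 (by decide), fr₆ 33 (by decide), hS₅ u, hP₅ u]
    have : u ∈ S → u ∉ P := fun h => Finset.disjoint_left.1 hdPS h
    by_cases h1 : u ∈ S <;> by_cases h2 : u ∈ P <;> simp_all
  intro m₇ h₇ fr₇
  refine ⟨hG₆.of_eq (fr₇ 0 (by decide)) (fr₇ 2 (by decide)), _, _, h₇,
    hX₇.of_eq (fr₇ 31 (by decide)),
    hf.step (fun w => mem_outer) hmin hp, ?_⟩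
  rw [Finset.card_union_of_disjoint hdPS]
  have := Finset.card_pos.2 ⟨p, hp⟩
  omega

/-- Construct an induced subgraph of bounded degree with a set of marked vertices. -/
def frameP : Prog := .seq prepareP (.loop (var 44) (.seq extendP prepareP))

theorem wp_frame (hG : HasGraph G m) (hS : Has (n := n) (m 30 0) ∅) (hX : Has (n := n) (m 31 0) ∅) :
    WP n frameP m (fun m' => ∃ S X, Prepared G S X m' ∧ Frame G S X ∧
      ¬ Cyc G (S \ X) (outer G S X)) := by
  refine wp_seq (wp_prepare hG hS hX) ?_
  intro m₁ h₁ _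
  -- Every extension adds a nonempty `P` to `S`, so `n - |S|` bounds the remaining rounds.
  refine wp_loop (fun j m' => ∃ S X, Prepared G S X m' ∧ Frame G S X ∧ j + S.card = n) n
    (by omega) ⟨∅, ∅, h₁, Frame.empty, by simp⟩ ?_ ?_
  · rintro j m₂ ⟨S, X, hp, hf, hj⟩ - hne
    refine wp_seq (wp_extend hp hf hne) ?_
    rintro m₃ ⟨hG₃, S', X', hS', hX', hf', hlt⟩ -
    refine (wp_prepare hG₃ hS' hX').mono ?_
    intro m₄ h₄ _
    have : S'.card ≤ n := by simpa using Finset.card_le_univ S'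
    exact ⟨n - S'.card, by omega, S', X', h₄, hf', by omega⟩
  · rintro j m₂ ⟨S, X, hp, hf, hj⟩ - he
    exact ⟨S, X, hp, hf, hp.go.1 he⟩

/-! ### Growing a search tree until it closes a cycle -/

/-- The memory holds the graph, the set `A` in the array `50` and the weights in the array `55`. -/
structure GrowEnv (G : SimpleGraph (Fin n)) [DecidableRel G.Adj] (A : Finset (Fin n)) (m : Mem) :
    Prop where
  graph : HasGraph G m
  hasA : Has (m 50 0) A
  hasWt : ∀ v : Fin n, m 55 0 v = wt G A v

theorem GrowEnv.of_eq {A : Finset (Fin n)} {m' : Mem} (h : GrowEnv G A m) (h0 : m' 0 = m 0)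
    (h2 : m' 2 = m 2) (h50 : m' 50 = m 50) (h55 : m' 55 = m 55) : GrowEnv G A m' :=
  ⟨h.graph.of_eq h0 h2, h.hasA.of_eq h50, by rw [h55]; exact h.hasWt⟩

/-- The array `52` holds a set whose core is nonempty and has few vertices of degree at least three
in `A`. -/
def GrowDone (G : SimpleGraph (Fin n)) [DecidableRel G.Adj] (A : Finset (Fin n)) (m : Mem) : Prop :=
  ∃ (M : Finset (Fin n)) (d : ℕ), Has (m 52 0) M ∧ M ⊆ A ∧ Cyc G ∅ M ∧
    (core G ∅ M ∩ branch G A).card ≤ 20 * d + 21 ∧ (d ≤ 1 ∨ 2 ^ (d - 1) ≤ (branch G A).card)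

/-- The search tree in the memory. -/
def GrowState (G : SimpleGraph (Fin n)) [DecidableRel G.Adj] (A : Finset (Fin n)) (r : Fin n)
    (d b : ℕ) (m : Mem) : Prop :=
  ∃ B : Finset (Fin n), Has (m 52 0) B ∧ Grown G A B r (fun v => m 53 0 v) d ∧ m 53 0 r = 0 ∧
    m 54 0 0 = d ∧ B.card = b

theorem GrowDone.of_eq {A : Finset (Fin n)} {m' : Mem} (h : GrowDone G A m) (he : m' 52 = m 52) :
    GrowDone G A m' := by
  obtain ⟨M, d, h1, h2⟩ := h
  exact ⟨M, d, h1.of_eq he, h2⟩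

theorem GrowState.of_eq {A : Finset (Fin n)} {r : Fin n} {d b : ℕ} {m' : Mem}
    (h : GrowState G A r d b m) (h52 : m' 52 = m 52) (h53 : m' 53 = m 53) (h54 : m' 54 = m 54) :
    GrowState G A r d b m' := by
  obtain ⟨B, h1, h2, h3, h4, h5⟩ := h
  exact ⟨B, h1.of_eq h52, by rw [h53]; exact h2, by rw [h53]; exact h3, by rw [h54]; exact h4, h5⟩

/-- Try to extend the tree by the edge between the vertices in the variables `45` and `46`. -/
def growEdgeP : Prog :=
  -- The first part is 1 exactly if `u` is in the tree, `w` is in `A` outside the tree and they are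
  -- adjacent; what is subtracted vanishes exactly if `w` is due at the current level.
  .ite (.sub (.sub (.add (.add (row 52 45) (.sub (row 50 46) (row 52 46)))
      (.get 2 (var 45) (var 46))) (.lit 2))
      (.sub (.add (row 53 45) (row 55 46)) (var 54)))
    (.seq (.set 52 (.lit 0) (var 46) (.lit 1))
    (.seq (setv 58 (.lit 1))
      (.ite (.sub (row 56 46) (.lit 1)) (setv 57 (.lit 1))
        (.set 53 (.lit 0) (var 46) (var 54)))))
    .skip

/-- The counts in array `56` refer to the tree at the start of the search; they remain valid because
the search stops at the first success. Two neighbours in the tree close a cycle, one extends the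
tree. In both cases array `52` receives `w`. -/
theorem wp_growEdge {A B : Finset (Fin n)} {r u w : Fin n} {d : ℕ} (hA : Closed G ∅ A)
    (hD : ∀ v ∈ A, nb G A v ≤ 20) (hE : GrowEnv G A m) (hB : Has (m 52 0) B)
    (hg : Grown G A B r (fun v => m 53 0 v) d) (hr : m 53 0 r = 0) (h54 : m 54 0 0 = d)
    (h57 : m 57 0 0 = 0) (h58 : m 58 0 0 = 0) (h56 : ∀ v : Fin n, m 56 0 v = nb G B v)
    (hu : m 45 0 0 = u) (hw : m 46 0 0 = w) :
    WP n growEdgeP m (fun m' => (m' 58 0 0 = 0 ∧ m' = m ∧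
        ¬ (u ∈ B ∧ w ∈ A ∧ w ∉ B ∧ G.Adj u w ∧ m 53 0 u + wt G A w ≤ d)) ∨
      (m' 58 0 0 ≠ 0 ∧ GrowEnv G A m' ∧ ((m' 57 0 0 = 0 ∧ GrowState G A r d (B.card + 1) m') ∨
        (m' 57 0 0 ≠ 0 ∧ GrowDone G A m')))) := by
  have hcond : ((((row 52 45).add ((row 50 46).sub (row 52 46))).add
      (.get 2 (var 45) (var 46))).sub (.lit 2) |>.sub
      (((row 53 45).add (row 55 46)).sub (var 54))).eval m ≠ 0 ↔
      (u ∈ B ∧ w ∈ A ∧ w ∉ B ∧ G.Adj u w ∧ m 53 0 u + wt G A w ≤ d) := by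
    simp only [eval_sub, eval_add, eval_row, eval_get, eval_var, eval_lit, hu, hw, hB u, hB w,
      hE.hasA w, hE.graph.2.1 u w, hE.hasWt w, h54]
    by_cases h1 : u ∈ B <;> by_cases h2 : w ∈ A <;> by_cases h3 : w ∈ B <;>
      by_cases h4 : G.Adj u w <;> simp [h1, h2, h3, h4]
    omega
  refine wp_ite (fun he => ?_) (fun he => wp_skip (Or.inl ⟨h58, rfl, ?_⟩))
  · obtain ⟨huB, hwA, hwB, hadj, hkey⟩ := hcond.1 he
    refine wp_seq_set (wp_seq_set ?_)
    simp only [eval_lit, eval_var, hw]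
    have hB' : Has (((m.write 52 0 w 1).write 58 0 0 1) 52 0) (insert w B) := by
      rw [write_ne _ _ _ (by decide)]; exact hB.insert w
    have hE' : GrowEnv G A ((m.write 52 0 w 1).write 58 0 0 1) := hE.of_eq rfl rfl rfl rfl
    have e56 : (((m.write 52 0 w 1).write 58 0 0 1) 56 0 w) = nb G B w := h56 w
    have e46 : (((m.write 52 0 w 1).write 58 0 0 1) 46 0 0) = w := hw
    refine wp_ite (fun h2 => wp_setv (Or.inr ⟨?_, hE'.of_eq rfl rfl rfl rfl, Or.inr ⟨?_, ?_⟩⟩))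
      (fun h2 => wp_set (Or.inr ⟨?_, ?_, Or.inl ⟨?_, ?_⟩⟩))
    · rw [write_ne _ _ _ (by decide), write_same]; exact one_ne_zero
    · rw [write_same]; exact one_ne_zero
    · simp only [eval_sub, eval_row, eval_lit, e46, e56] at h2
      obtain ⟨h3, h4⟩ := hg.close hD hwA hwB (by omega)
      refine ⟨insert w B, d, hB'.of_eq rfl, ?_, h3, h4, ?_⟩
      · obtain ⟨par, anc, hg⟩ := hg
        exact Finset.insert_subset hwA hg.sub
      · rcases Nat.lt_or_ge d 2 with hd | hd
        · exact Or.inl (by omega)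
        · exact Or.inr (hg.two_pow_le hA hr hd)
    · rw [write_ne _ _ _ (by decide), write_same]; exact one_ne_zero
    · exact hE'.of_eq rfl rfl rfl rfl
    · exact h57
    · simp only [eval_sub, eval_row, eval_lit, e46, e56] at h2
      have e54 : (((m.write 52 0 w 1).write 58 0 0 1) 54 0 0) = d := h54
      simp only [eval_lit, eval_var, e46, e54]
      have hadd := hg.add huB hwA hwB hadj hkey (by omega)
      have hrB : r ∈ B := by obtain ⟨par, anc, hg⟩ := hg; exact hg.root
      have hdep : ∀ v : Fin n, Mem.write ((m.write 52 0 w 1).write 58 0 0 1) 53 0 w d 53 0 v =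
          Function.update (fun v : Fin n => m 53 0 v) w d v := by
        intro v
        by_cases hv : v = w
        · subst hv; rw [write_same, Function.update_self]
        · have : (v : ℕ) ≠ w := fun e => hv (Fin.ext e)
          rw [Function.update_of_ne hv]
          simp [Mem.write, this]
      refine ⟨insert w B, hB'.of_eq rfl, hadd.congr fun v _ => (hdep v).symm, ?_, h54, ?_⟩
      · rw [hdep, Function.update_of_ne (fun e : r = w => hwB (e ▸ hrB))]; exact hr
      · exact Finset.card_insert_of_notMem hwB
  · intro h
    exact hcond.2 h he

/-- Grow a search tree in the set in the array `50` until it closes a cycle. -/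
def growP : Prog :=
  .seq (findP 15 13 (row 50 13))
  (.seq (mapP 52 13 (.lit 0))
  (.seq (.set 52 (.lit 0) (.sub (var 15) (.lit 1)) (.lit 1))
  (.seq (.set 53 (.lit 0) (.sub (var 15) (.lit 1)) (.lit 0))
  (.seq (setv 54 (.lit 0))
  -- The weight `1 - (3 - degree)` is 1 exactly from degree three on.
  (.seq (mapP 55 13 (.sub (.lit 1) (.sub (.lit 3) (row 22 13))))
  (.seq (setv 57 (.lit 0))
    (.loop (.sub (.lit 1) (var 57))
      (.seq (nbrP 56 (row 52 11))
      (.seq (setv 58 (.lit 0))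
      (.seq (searchP 58 45 (searchP 58 46 growEdgeP))
        (.ite (var 58) .skip (setv 54 (.add (var 54) (.lit 1))))))))))))))

theorem wp_grow {A : Finset (Fin n)} (hG : HasGraph G m) (hA : Closed G ∅ A)
    (hD : ∀ v ∈ A, nb G A v ≤ 20) (hne : A.Nonempty) (h50 : Has (m 50 0) A)
    (h22 : ∀ v : Fin n, m 22 0 v = nb G A v) : WP n growP m (GrowDone G A) := by
  refine wp_seq (wp_find (fun u => u ∈ A) hG.1 (by decide) (by decide) (by decide) ?_) ?_
  · intro m' u hb hu
    simp only [eval_row, hu, hb 50 (by decide) (by decide), h50 u]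
    by_cases hu : u ∈ A <;> simp [hu]
  intro m₁ h₁ fr₁
  obtain ⟨r, hrv, hrA⟩ : ∃ r : Fin n, m₁ 15 0 0 = r + 1 ∧ r ∈ A := by
    rcases h₁ with ⟨-, h5⟩ | h5
    · obtain ⟨x, hx⟩ := hne
      exact absurd hx (h5 x)
    · exact h5
  have hG₁ := hG.of_eq (fr₁ 0 (by decide)) (fr₁ 2 (by decide))
  refine wp_seq (wp_copy (A := ∅) hG₁.1 (by decide) (by decide) (by decide) ?_) ?_
  · intro m' u _ _ _
    simp
  intro m₂ h₂ fr₂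
  have hG₂ := hG₁.of_eq (fr₂ 0 (by decide)) (fr₂ 2 (by decide))
  refine wp_seq_set (wp_seq_set (wp_seq_set ?_))
  have e15 : m₂ 15 0 0 = r + 1 := by rw [fr₂ 15 (by decide), hrv]
  simp only [eval_lit, eval_var, eval_sub, write_ne _ _ _ (show 15 ≠ 52 by decide), e15,
    Nat.add_sub_cancel]
  obtain ⟨m₃, hm₃⟩ : ∃ m₃, m₃ = ((m₂.write 52 0 r 1).write 53 0 r 0).write 54 0 0 0 := ⟨_, rfl⟩
  rw [← hm₃]
  have fr₃ : ∀ a, a ≠ 52 → a ≠ 53 → a ≠ 54 → m₃ a = m₂ a := by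
    intro a h1 h2 h3
    rw [hm₃, write_ne _ _ _ h3, write_ne _ _ _ h2, write_ne _ _ _ h1]
  have hG₃ : HasGraph G m₃ := hG₂.of_eq (fr₃ 0 (by decide) (by decide) (by decide))
    (fr₃ 2 (by decide) (by decide) (by decide))
  have h52 : Has (m₃ 52 0) ({r} : Finset (Fin n)) := by
    have := h₂.insert r
    rw [hm₃, write_ne _ _ _ (by decide), write_ne _ _ _ (by decide)]
    simpa using this
  have h53 : m₃ 53 0 r = 0 := by
    rw [hm₃, write_ne _ _ _ (by decide), write_same]
  have h54 : m₃ 54 0 0 = 0 := by rw [hm₃, write_same]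
  refine wp_seq (wp_map (fun u => wt G A u) hG₃.1 (by decide) (by decide) (by decide) ?_) ?_
  · intro m' u hb _ hu
    simp only [eval_sub, eval_row, eval_lit, hu, hb 22 (by decide) (by decide),
      fr₃ 22 (by decide) (by decide) (by decide), fr₂ 22 (by decide), fr₁ 22 (by decide), h22 u, wt]
    split_ifs <;> omega
  intro m₄ h₄ fr₄
  refine wp_seq_set ?_
  simp only [eval_lit]
  have hE : GrowEnv G A (m₄.write 57 0 0 0) := by
    refine ⟨(hG₃.of_eq (fr₄ 0 (by decide)) (fr₄ 2 (by decide))).of_eq rfl rfl, ?_, ?_⟩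
    · refine h50.of_eq ?_
      rw [write_ne _ _ _ (by decide), fr₄ 50 (by decide),
        fr₃ 50 (by decide) (by decide) (by decide), fr₂ 50 (by decide), fr₁ 50 (by decide)]
    · rw [write_ne _ _ _ (by decide)]; exact h₄
  have hS : GrowState G A r 0 1 (m₄.write 57 0 0 0) := by
    have : GrowState G A r 0 1 m₃ :=
      ⟨{r}, h52, Grown.init hrA _ h53, h53, h54, Finset.card_singleton r⟩
    exact this.of_eq (fr₄ 52 (by decide)) (fr₄ 53 (by decide)) (fr₄ 54 (by decide))
  have hbound : ∀ {d b : ℕ} {m' : Mem}, GrowState G A r d b m' → d ≤ b ∧ b ≤ n := by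
    rintro d b m' ⟨B, -, hg, -, -, rfl⟩
    exact ⟨hg.level_le hA, by simpa using Finset.card_le_univ B⟩
  have hn1 := (hbound hS).2
  -- Every unfinished round adds a vertex to the tree or raises the level, and level and size are at
  -- most `n`.
  refine wp_loop (fun j m' => GrowEnv G A m' ∧
    ((m' 57 0 0 = 0 ∧ ∃ d b, GrowState G A r d b m' ∧ b + d + j = 2 * n + 2) ∨
      (m' 57 0 0 ≠ 0 ∧ GrowDone G A m'))) (2 * n + 1) (by omega)
    ⟨hE, Or.inl ⟨write_same _ _ _ _, 0, 1, hS, by omega⟩⟩ ?_ ?_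
  · rintro j m₅ ⟨hE₅, h⟩ - he
    have h57 : m₅ 57 0 0 = 0 := by
      simp only [eval_sub, eval_lit, eval_var] at he
      omega
    rcases h with ⟨-, d, b, hS₅, hj⟩ | ⟨h, -⟩
    swap
    · exact absurd h57 h
    have hb₅ := hbound hS₅
    obtain ⟨B, hB, hg, hr0, h54, hbB⟩ := hS₅
    refine wp_seq (wp_nbr_mask hE₅.graph hB (by decide) (by decide) (by decide)) ?_
    intro m₆ h₆ fr₆
    refine wp_seq_set ?_
    simp only [eval_lit]
    obtain ⟨m₇, hm₇⟩ : ∃ m₇, m₇ = m₆.write 58 0 0 0 := ⟨_, rfl⟩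
    rw [← hm₇]
    have h58 : m₇ 58 0 0 = 0 := by rw [hm₇, write_same]
    have fr₇ : ∀ a, a ∉ 58 :: (nbrP 56 (row 52 11)).writes → m₇ a = m₅ a := by
      intro a ha
      rw [List.mem_cons, not_or] at ha
      rw [hm₇, write_ne _ _ _ ha.1, fr₆ a ha.2]
    have h56 : ∀ v : Fin n, m₇ 56 0 v = nb G B v := by
      rw [hm₇, write_ne _ _ _ (by decide)]; exact h₆
    let K : Mem → Prop := fun m' => m' 0 = m₇ 0 ∧ m' 2 = m₇ 2 ∧ m' 50 = m₇ 50 ∧ m' 55 = m₇ 55 ∧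
      m' 52 = m₇ 52 ∧ m' 53 = m₇ 53 ∧ m' 54 = m₇ 54 ∧ m' 56 = m₇ 56 ∧ m' 57 = m₇ 57
    let R : Mem → Prop := fun m' => GrowEnv G A m' ∧
      ((m' 57 0 0 = 0 ∧ GrowState G A r d (b + 1) m') ∨ (m' 57 0 0 ≠ 0 ∧ GrowDone G A m'))
    have hK : ∀ i, i = 45 ∨ i = 46 → ∀ m x, K m → K (m.write i 0 0 x) := by
      rintro i hi m x ⟨h1, h2, h3, h4, h5, h6, h7, h8, h9⟩
      refine ⟨?_, ?_, ?_, ?_, ?_, ?_, ?_, ?_, ?_⟩ <;> rw [write_ne _ _ _ (by omega)] <;> assumption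
    have hR : ∀ i, i = 45 ∨ i = 46 → ∀ m x, R m → R (m.write i 0 0 x) := by
      rintro i hi m x ⟨h1, h2⟩
      refine ⟨h1.of_eq ?_ ?_ ?_ ?_, ?_⟩
      · exact write_ne _ _ _ (by omega)
      · exact write_ne _ _ _ (by omega)
      · exact write_ne _ _ _ (by omega)
      · exact write_ne _ _ _ (by omega)
      · rw [write_ne _ _ _ (show 57 ≠ i by omega)]
        rcases h2 with ⟨h3, h4⟩ | ⟨h3, h4⟩
        · refine Or.inl ⟨h3, h4.of_eq ?_ ?_ ?_⟩ <;> exact write_ne _ _ _ (by omega)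
        · exact Or.inr ⟨h3, h4.of_eq (write_ne _ _ _ (by omega))⟩
    have hK₇ : K m₇ := ⟨rfl, rfl, rfl, rfl, rfl, rfl, rfl, rfl, rfl⟩
    have hE₇ : GrowEnv G A m₇ := hE₅.of_eq (fr₇ 0 (by decide)) (fr₇ 2 (by decide))
      (fr₇ 50 (by decide)) (fr₇ 55 (by decide))
    let φ : Fin n → Fin n → Prop := fun u w =>
      u ∈ B ∧ w ∈ A ∧ w ∉ B ∧ G.Adj u w ∧ m₇ 53 0 u + wt G A w ≤ d
    have e53 : m₇ 53 = m₅ 53 := fr₇ 53 (by decide)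
    refine wp_seq (wp_search (fun u => ∃ w, φ u w) K R hE₇.graph.1 (by decide) (by decide)
      (by decide) (hK 45 (by decide)) (hR 45 (by decide)) h58 hK₇ ?_) ?_
    · intro u m₈ hK₈ hs₈ hu₈ _
      refine (wp_search (φ u) K R ?_ (by decide) (by decide) (by decide) (hK 46 (by decide))
        (hR 46 (by decide)) hs₈ hK₈ ?_).mono ?_
      · rw [hK₈.1]; exact hE₇.graph.1
      · intro w m₉ hK₉ hs₉ hw₉ fr₉
        obtain ⟨k0, k2, k50, k55, k52, k53, k54, k56, k57⟩ := hK₉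
        refine (wp_growEdge (B := B) (r := r) (u := u) (w := w) (d := d) hA hD
          (hE₇.of_eq k0 k2 k50 k55) ?_ ?_ ?_ ?_ ?_ hs₉ ?_ ?_ hw₉).mono ?_
        · exact hB.of_eq (k52.trans (fr₇ 52 (by decide)))
        · rw [k53, e53]; exact hg
        · rw [k53, e53]; exact hr0
        · rw [k54, fr₇ 54 (by decide)]; exact h54
        · rw [k57, fr₇ 57 (by decide)]; exact h57
        · rw [k56]; exact h56
        · rw [fr₉ 45 (by decide), hu₈]
        · rintro m' (⟨h1, rfl, h2⟩ | ⟨h1, h2, h3⟩) _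
          · refine Or.inl ⟨h1, ⟨k0, k2, k50, k55, k52, k53, k54, k56, k57⟩, ?_⟩
            rwa [k53] at h2
          · exact Or.inr ⟨h1, h2, hbB ▸ h3⟩
      · rintro m' (⟨h1, h2, h3⟩ | h1) _
        · exact Or.inl ⟨h1, h2, fun ⟨w, hw⟩ => h3 w hw⟩
        · exact Or.inr h1
    · rintro m₈ (⟨h1, hK₈, h3⟩ | ⟨h1, hE₈, h3⟩) _
      · refine wp_ite (fun he => absurd h1 he) (fun _ => wp_setv ?_)
        obtain ⟨k0, k2, k50, k55, k52, k53, k54, k56, k57⟩ := hK₈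
        have e54 : m₈ 54 0 0 = d := by rw [k54, fr₇ 54 (by decide)]; exact h54
        simp only [eval_add, eval_var, eval_lit, e54]
        refine ⟨j - 1, by omega, (hE₇.of_eq k0 k2 k50 k55).of_eq rfl rfl rfl rfl, Or.inl ⟨?_, d + 1,
          b, ⟨B, ?_, ?_, ?_, write_same _ _ _ _, hbB⟩, by omega⟩⟩
        · rw [write_ne _ _ _ (by decide), k57, fr₇ 57 (by decide)]; exact h57
        · exact hB.of_eq ((write_ne _ _ _ (by decide)).trans (k52.trans (fr₇ 52 (by decide))))
        · rw [write_ne _ _ _ (by decide), k53, e53]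
          refine hg.level fun u hu w hw hwB hadj => ?_
          by_contra hlt
          exact h3 u ⟨w, hu, hw, hwB, hadj, by rw [e53]; omega⟩
        · rw [write_ne _ _ _ (by decide), k53, e53]; exact hr0
      · refine wp_ite (fun _ => wp_skip ?_) (fun he => absurd he h1)
        rcases h3 with ⟨h4, h5⟩ | h3
        · exact ⟨j - 1, by omega, hE₈, Or.inl ⟨h4, d, b + 1, h5, by omega⟩⟩
        · exact ⟨0, by omega, hE₈, Or.inr h3⟩
  · rintro j m₅ ⟨-, h⟩ - he
    rcases h with ⟨h, -⟩ | ⟨-, h⟩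
    · simp [h] at he
    · exact h

/-! ### Extracting a cycle from a closed set -/

/-- The array `70` holds a path `x 0, …, x l` in `C`, whose last index is in the variable `72`; the
array `71` holds the positions of the vertices on the path, counted from one. -/
structure PathState (G : SimpleGraph (Fin n)) (C : Finset (Fin n)) (l : ℕ) (x : ℕ → Fin n)
    (m : Mem) : Prop where
  len : m 72 0 0 = l
  cell : ∀ i ≤ l, m 70 0 i = x i
  mem : ∀ i ≤ l, x i ∈ C
  inj : ∀ i ≤ l, ∀ j ≤ l, x i = x j → i = j
  adj : ∀ i < l, G.Adj (x i) (x (i + 1))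
  pos : ∀ i ≤ l, m 71 0 (x i) = i + 1
  pos_zero : ∀ v : Fin n, (∀ i ≤ l, x i ≠ v) → m 71 0 v = 0

theorem PathState.lt {C : Finset (Fin n)} {l : ℕ} {x : ℕ → Fin n} (h : PathState G C l x m) :
    l < n := by
  have h1 : ((Finset.range (l + 1)).image x).card = l + 1 := by
    rw [Finset.card_image_of_injOn, Finset.card_range]
    intro a ha b hb hab
    simp only [Finset.coe_range, Set.mem_Iio] at ha hb
    exact h.inj a (by omega) b (by omega) hab
  have h2 : ((Finset.range (l + 1)).image x).card ≤ n := by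
    simpa using Finset.card_le_univ ((Finset.range (l + 1)).image x)
  omega

theorem PathState.of_eq {C : Finset (Fin n)} {l : ℕ} {x : ℕ → Fin n} {m' : Mem}
    (h : PathState G C l x m) (h70 : m' 70 = m 70) (h71 : m' 71 = m 71) (h72 : m' 72 = m 72) :
    PathState G C l x m' := by
  obtain ⟨h1, h2, h3, h4, h5, h6, h7⟩ := h
  exact ⟨by rw [h72]; exact h1, by rw [h70]; exact h2, h3, h4, h5, by rw [h71]; exact h6,
    by rw [h71]; exact h7⟩

/-- Extend the path by one vertex. -/
def pushP : Prog :=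
  .seq (setv 72 (.add (var 72) (.lit 1)))
  (.seq (.set 70 (.lit 0) (var 72) (.sub (var 73) (.lit 1)))
    (.set 71 (.lit 0) (.sub (var 73) (.lit 1)) (.add (var 72) (.lit 1))))

theorem wp_push {C : Finset (Fin n)} {l : ℕ} {x : ℕ → Fin n} {v : Fin n}
    (h : PathState G C l x m) (hv : v ∈ C) (hnew : ∀ i ≤ l, x i ≠ v) (hadj : G.Adj (x l) v)
    (h73 : m 73 0 0 = v + 1) :
    WP n pushP m (PathState G C (l + 1) (Function.update x (l + 1) v)) := by
  refine wp_seq_set (wp_seq_set (wp_set ?_))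
  simp only [eval_add, eval_sub, eval_var, eval_lit, write_ne _ _ _ (show 73 ≠ 72 by decide),
    write_ne _ _ _ (show 73 ≠ 70 by decide), write_ne _ _ _ (show 72 ≠ 70 by decide), write_same,
    h.len, h73, Nat.add_sub_cancel]
  have hup : ∀ i ≤ l, Function.update x (l + 1) v i = x i := fun i hi =>
    Function.update_of_ne (by omega) _ _
  have hupl : Function.update x (l + 1) v (l + 1) = v := Function.update_self _ _ _
  have hcase : ∀ i ≤ l + 1, i ≤ l ∨ i = l + 1 := fun i hi => by omega
  constructor
  · rw [write_ne _ _ _ (by decide), write_ne _ _ _ (by decide), write_same]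
  · intro i hi
    rw [write_ne _ _ _ (by decide)]
    rcases hcase i hi with h1 | rfl
    · have : i ≠ l + 1 := by omega
      simp only [Mem.write, this, and_false, if_false, hup i h1]
      exact h.cell i h1
    · rw [write_same, hupl]
  · intro i hi
    rcases hcase i hi with h1 | rfl
    · rw [hup i h1]; exact h.mem i h1
    · rw [hupl]; exact hv
  · intro i hi j hj hij
    rcases hcase i hi with h1 | rfl <;> rcases hcase j hj with h2 | rfl
    · rw [hup i h1, hup j h2] at hij; exact h.inj i h1 j h2 hij
    · rw [hup i h1, hupl] at hij; exact absurd hij (hnew i h1)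
    · rw [hup j h2, hupl] at hij; exact absurd hij.symm (hnew j h2)
    · rfl
  · intro i hi
    rcases Nat.lt_or_ge i l with h1 | h1
    · rw [hup i (by omega), hup (i + 1) (by omega)]; exact h.adj i h1
    · obtain rfl : i = l := by omega
      rw [hup i le_rfl, hupl]; exact hadj
  · intro i hi
    rcases hcase i hi with h1 | rfl
    · rw [hup i h1]
      have : (x i : ℕ) ≠ v := fun e => hnew i h1 (Fin.ext e)
      simp only [Mem.write, this, and_false, if_false]
      exact h.pos i h1
    · rw [hupl, write_same]
  · intro w hw
    have h1 : (w : ℕ) ≠ v := fun e => hw (l + 1) le_rfl (by rw [hupl]; exact (Fin.ext e).symm)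
    simp only [Mem.write, h1, and_false, if_false]
    refine h.pos_zero w fun i hi => ?_
    have := hw i (by omega)
    rwa [hup i hi] at this

/-- Walk in the core of the set in the array `52` until the path cannot be extended. -/
def pathP : Prog :=
  .seq (mapP 20 13 (row 52 13))
  (.seq coreP
  (.seq (findP 15 13 (row 20 13))
  (.seq (mapP 71 13 (.lit 0))
  (.seq (.set 70 (.lit 0) (.lit 0) (.sub (var 15) (.lit 1)))
  (.seq (.set 71 (.lit 0) (.sub (var 15) (.lit 1)) (.lit 1))
  (.seq (setv 72 (.lit 0))
  (.seq (setv 73 (.lit 1))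
    (.loop (var 73)
      (.seq (findP 73 13 (.sub (.sub (.add (row 20 13) (.get 2 (row 70 72) (var 13))) (.lit 1))
          (row 71 13)))
        (.ite (var 73) pushP .skip))))))))))

/-- Position 0 in array `71` means not on the path, so subtracting the position from the adjacency
test excludes used vertices. Paths have fewer than `n` edges, which bounds the walk. -/
theorem wp_path {M : Finset (Fin n)} (hG : HasGraph G m) (h21 : Has (n := n) (m 21 0) ∅)
    (h52 : Has (m 52 0) M) (hc : Cyc G ∅ M) :
    WP n pathP m (fun m' => ∃ l x, PathState G (core G ∅ M) l x m' ∧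
      ∀ v ∈ core G ∅ M, G.Adj (x l) v → ∃ i ≤ l, x i = v) := by
  refine wp_seq (wp_copy (A := M) hG.1 (by decide) (by decide) (by decide) ?_) ?_
  · intro m' u hb _ hu
    simp only [eval_row, hu, hb 52 (by decide) (by decide), h52 u]
  intro m₁ h₁ fr₁
  have hG₁ := hG.of_eq (fr₁ 0 (by decide)) (fr₁ 2 (by decide))
  refine wp_seq (wp_core hG₁ h₁ (h21.of_eq (fr₁ 21 (by decide))) (by simp)) ?_
  intro m₂ ⟨h₂, _⟩ fr₂
  obtain ⟨C, hC⟩ : ∃ C, C = core G ∅ M := ⟨_, rfl⟩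
  rw [← hC] at h₂ ⊢
  have hG₂ := hG₁.of_eq (fr₂ 0 (by decide)) (fr₂ 2 (by decide))
  refine wp_seq (wp_find (fun u => u ∈ C) hG₂.1 (by decide) (by decide) (by decide) ?_) ?_
  · intro m' u hb hu
    simp only [eval_row, hu, hb 20 (by decide) (by decide), h₂ u]
    by_cases hu : u ∈ C <;> simp [hu]
  intro m₃ h₃ fr₃
  obtain ⟨r, hrv, hrC⟩ : ∃ r : Fin n, m₃ 15 0 0 = r + 1 ∧ r ∈ C := by
    rcases h₃ with ⟨-, h5⟩ | h5
    · obtain ⟨x, hx⟩ := core_nonempty.2 hc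
      exact absurd (hC ▸ hx) (h5 x)
    · exact h5
  have hG₃ := hG₂.of_eq (fr₃ 0 (by decide)) (fr₃ 2 (by decide))
  refine wp_seq (wp_copy (A := ∅) hG₃.1 (by decide) (by decide) (by decide) ?_) ?_
  · intro m' u _ _ _
    simp
  intro m₄ h₄ fr₄
  have e15 : m₄ 15 0 0 = r + 1 := by rw [fr₄ 15 (by decide), hrv]
  refine wp_seq_set (wp_seq_set (wp_seq_set (wp_seq_set ?_)))
  simp only [eval_lit, eval_var, eval_sub, write_ne _ _ _ (show 15 ≠ 70 by decide), e15,
    Nat.add_sub_cancel]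
  obtain ⟨m₅, hm₅⟩ : ∃ m₅, m₅ = (((m₄.write 70 0 0 r).write 71 0 r 1).write 72 0 0 0).write
    73 0 0 1 := ⟨_, rfl⟩
  rw [← hm₅]
  have fr₅ : ∀ a, a ≠ 70 → a ≠ 71 → a ≠ 72 → a ≠ 73 → m₅ a = m₄ a := by
    intro a h1 h2 h3 h4
    rw [hm₅, write_ne _ _ _ h4, write_ne _ _ _ h3, write_ne _ _ _ h2, write_ne _ _ _ h1]
  have hP : PathState G C 0 (fun _ => r) m₅ := by
    have e70 : m₅ 70 0 0 = r := by
      rw [hm₅, write_ne _ _ _ (by decide), write_ne _ _ _ (by decide), write_ne _ _ _ (by decide),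
        write_same]
    have e71 : m₅ 71 = (m₄.write 71 0 r 1) 71 := by
      rw [hm₅, write_ne _ _ _ (by decide), write_ne _ _ _ (by decide)]
      rfl
    constructor
    · rw [hm₅, write_ne _ _ _ (by decide), write_same]
    · intro i hi
      obtain rfl : i = 0 := by omega
      exact e70
    · exact fun _ _ => hrC
    · intro i hi j hj _; omega
    · intro i hi; omega
    · intro i hi
      obtain rfl : i = 0 := by omega
      rw [e71, write_same]
    · intro v hv
      have : (v : ℕ) ≠ r := fun e => hv 0 le_rfl (Fin.ext e).symm
      rw [e71]
      simp only [Mem.write, this, and_false, if_false]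
      simpa using h₄ v
  have hG₅ : HasGraph G m₅ := (hG₃.of_eq (fr₄ 0 (by decide)) (fr₄ 2 (by decide))).of_eq
    (fr₅ 0 (by decide) (by decide) (by decide) (by decide))
    (fr₅ 2 (by decide) (by decide) (by decide) (by decide))
  have hC₅ : Has (m₅ 20 0) C := h₂.of_eq (by
    rw [fr₅ 20 (by decide) (by decide) (by decide) (by decide), fr₄ 20 (by decide),
      fr₃ 20 (by decide)])
  refine wp_loop (fun j m' => ∃ l x, PathState G C l x m' ∧
    (m' 73 0 0 = 0 → ∀ v ∈ C, G.Adj (x l) v → ∃ i ≤ l, x i = v) ∧ (m' 73 0 0 ≠ 0 → l + j = n)) n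
    (by omega) ⟨0, _, hP, fun h => ?_, fun _ => by omega⟩ ?_ ?_
  · rw [hm₅, write_same] at h; omega
  · rintro j m₆ ⟨l, x, hP₆, -, hj⟩ fr₆ he
    have hj' := hj he
    have hlt := hP₆.lt
    have hG₆ := hG₅.of_eq (fr₆ 0 (by decide)) (fr₆ 2 (by decide))
    have hC₆ := hC₅.of_eq (fr₆ 20 (by decide))
    refine wp_seq (wp_find (fun v => v ∈ C ∧ G.Adj (x l) v ∧ ∀ i ≤ l, x i ≠ v) hG₆.1 (by decide)
      (by decide) (by decide) ?_) ?_
    · intro m' u hb hu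
      simp only [eval_sub, eval_add, eval_row, eval_get, eval_var, eval_lit, hu,
        hb 20 (by decide) (by decide), hb 2 (by decide) (by decide), hb 70 (by decide) (by decide),
        hb 71 (by decide) (by decide), hb 72 (by decide) (by decide), hP₆.len, hP₆.cell l le_rfl,
        hC₆ u, hG₆.2.1 (x l) u]
      by_cases h3 : ∀ i ≤ l, x i ≠ u
      · rw [hP₆.pos_zero u h3]
        by_cases h1 : u ∈ C <;> by_cases h2 : G.Adj (x l) u <;> simp [h1, h2]
        exact h3
      · have h3' := h3
        push Not at h3'
        obtain ⟨i, hi, rfl⟩ := h3'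
        rw [hP₆.pos i hi]
        simp only [h3, and_false, iff_false, not_not]
        split_ifs <;> omega
    intro m₇ h₇ fr₇
    have hP₇ := hP₆.of_eq (fr₇ 70 (by decide)) (fr₇ 71 (by decide)) (fr₇ 72 (by decide))
    refine wp_ite (fun he₇ => ?_) (fun he₇ => wp_skip ?_)
    · rcases h₇ with ⟨h5, -⟩ | ⟨v, h5, hvC, hadj, hnew⟩
      · exact absurd h5 he₇
      · refine (wp_push hP₇ hvC hnew hadj h5).mono ?_
        intro m₈ hP₈ fr₈
        have h73 : m₈ 73 0 0 ≠ 0 := by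
          rw [fr₈ 73 (by decide)]; exact he₇
        exact ⟨j - 1, by omega, l + 1, _, hP₈, fun h => absurd h h73, fun _ => by omega⟩
    · have h73 : m₇ 73 0 0 = 0 := he₇
      rcases h₇ with ⟨-, h6⟩ | ⟨v, h5, -⟩
      · refine ⟨0, by omega, l, x, hP₇, fun _ v hv hadj => ?_, fun h => absurd h73 h⟩
        by_contra hno
        push Not at hno
        exact h6 v ⟨hv, hadj, hno⟩
      · omega
  · rintro j m₆ ⟨l, x, hP₆, h, -⟩ _ he
    exact ⟨l, x, hP₆, h he⟩

/-- Close the path to a cycle, output the cycle, and remove it and its neighbours from the set in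
the array `50`. -/
def emitP : Prog :=
  -- An adjacency bit minus `(i + 2) - l` is nonzero only for an adjacent vertex with `i + 2 ≤ l`,
  -- which excludes the predecessor on the path.
  .seq (findP 74 13 (.sub (.get 2 (row 70 72) (row 70 13))
    (.sub (.add (var 13) (.lit 2)) (var 72))))
  (.seq (forN 13 (.set 5 (var 51) (var 13)
    (.get 70 (.lit 0) (.add (var 13) (.sub (var 74) (.lit 1))))))
  (.seq (.set 5 (var 51) (.sub (.add (var 72) (.lit 2)) (var 74))
    (.get 70 (.lit 0) (.sub (var 74) (.lit 1))))
  (.seq (.set 4 (.lit 0) (var 51) (.sub (.add (var 72) (.lit 2)) (var 74)))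
  (.seq (mapP 75 13 (.sub (.lit 1) (.sub (var 74) (row 71 13))))
  (.seq (nbrP 76 (row 75 11))
  (.seq (mapP 50 13 (.sub (row 50 13) (.add (row 75 13) (row 76 13))))
    (setv 51 (.add (var 51) (.lit 1)))))))))

/-- What remains of `A` when a cycle and its neighbours are removed. -/
def remainder (G : SimpleGraph (Fin n)) [DecidableRel G.Adj] (A : Finset (Fin n)) (l : ℕ)
    (y : ℕ → Fin n) : Finset (Fin n) :=
  A.filter fun v => v ∉ cycSet l y ∧ nb G (cycSet l y) v = 0

/-- The memory `m'` contains the cycle number `c` and otherwise the same cycles as `m`. -/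
structure Emitted (c l : ℕ) (y : ℕ → Fin n) (m m' : Mem) : Prop where
  len : m' 4 0 c = l
  cell : ∀ i ≤ l, m' 5 c i = y i
  len_ne : ∀ c', c' ≠ c → m' 4 0 c' = m 4 0 c'
  cell_ne : ∀ c', c' ≠ c → ∀ i, m' 5 c' i = m 5 c' i

theorem wp_emit {A C : Finset (Fin n)} {l c : ℕ} {x : ℕ → Fin n} (hG : HasGraph G m)
    (hP : PathState G C l x m) (hC : Closed G ∅ C)
    (hstuck : ∀ v ∈ C, G.Adj (x l) v → ∃ i ≤ l, x i = v) (h50 : Has (m 50 0) A)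
    (h51 : m 51 0 0 = c) :
    WP n emitP m (fun m' => m' 51 0 0 = c + 1 ∧ ∃ l y, IsCycSeq G l y ∧ cycSet l y ⊆ C ∧
      Emitted c l y m m' ∧ Has (m' 50 0) (remainder G A l y)) := by
  have hlt := hP.lt
  refine wp_seq (wp_find (fun j : Fin n => (j : ℕ) + 2 ≤ l ∧ G.Adj (x l) (x j)) hG.1 (by decide)
    (by decide) (by decide) ?_) ?_
  · intro m' u hb hu
    simp only [eval_sub, eval_add, eval_row, eval_get, eval_var, eval_lit, hu,
      hb 2 (by decide) (by decide), hb 70 (by decide) (by decide), hb 72 (by decide) (by decide),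
      hP.len, hP.cell l le_rfl]
    by_cases h1 : (u : ℕ) + 2 ≤ l
    · rw [hP.cell u (by omega), hG.2.1]
      by_cases h2 : G.Adj (x l) (x u) <;> simp [h1, h2]
    -- Beyond the end of the path, array `70` may hold stale values that are not vertices; the bound
    -- 1 on every matrix cell still makes the test fail.
    · have := hG.2.2 (x l) (m 70 0 u)
      simp only [h1, false_and, iff_false, not_not]
      omega
  intro m₁ h₁ fr₁
  obtain ⟨j, h74, hjl, hback⟩ : ∃ j : ℕ, m₁ 74 0 0 = j + 1 ∧ j + 2 ≤ l ∧ G.Adj (x l) (x j) := by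
    rcases h₁ with ⟨-, h2⟩ | ⟨u, h2⟩
    · obtain ⟨j, hj, hadj⟩ := exists_back_edge hC (hP.mem l le_rfl) hstuck
      exact absurd ⟨hj, hadj⟩ (h2 ⟨j, by omega⟩)
    · exact ⟨u, h2⟩
  have hG₁ := hG.of_eq (fr₁ 0 (by decide)) (fr₁ 2 (by decide))
  have hP₁ := hP.of_eq (fr₁ 70 (by decide)) (fr₁ 71 (by decide)) (fr₁ 72 (by decide))
  have e51 : m₁ 51 0 0 = c := by rw [fr₁ 51 (by decide), h51]
  -- The copy covers `n` cells, stale ones included. Only those before index `l + 1 - j` matter, and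
  -- that cell receives the repeated first vertex next.
  refine wp_seq (R := fun m' => (∀ i : ℕ, i < n → m' 5 c i = m 70 0 (i + j)) ∧
    ∀ c', c' ≠ c → ∀ i, m' 5 c' i = m 5 c' i) (wp_for
      (fun k m' => (∀ i : ℕ, i < k → m' 5 c i = m 70 0 (i + j)) ∧
        ∀ c', c' ≠ c → ∀ i, m' 5 c' i = m 5 c' i) hG₁.1 (by decide) (by decide) ?_ ?_ ?_ ?_) ?_
  · intro k m x h
    simpa [write_ne _ _ _ (show 5 ≠ 13 by decide)] using h
  · refine ⟨by simp, fun c' _ i => ?_⟩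
    rw [fr₁ 5 (by decide)]
  · intro k m' hI hk fr
    refine wp_set ?_
    have h1 : m' 51 0 0 = c := by rw [fr 51 (by decide), e51]
    have h2 : m' 74 0 0 = j + 1 := by rw [fr 74 (by decide), h74]
    have h3 : m' 70 = m 70 := by rw [fr 70 (by decide), fr₁ 70 (by decide)]
    simp only [eval_var, eval_get, eval_add, eval_sub, eval_lit, h1, h2, h3, hk, Nat.add_sub_cancel]
    constructor
    · intro i hi
      by_cases hik : i = k
      · subst hik; exact write_same _ _ _ _
      · simp only [Mem.write, hik, and_false, if_false]
        exact hI.1 i (by omega)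
    · intro c' hc' i
      simp only [Mem.write, hc', and_false, false_and, if_false]
      exact hI.2 c' hc' i
  · intro m' hI _
    exact hI
  intro m₂ ⟨h₂, h₂'⟩ fr₂
  have fr₂' : ∀ a, a ≠ 5 → a ≠ 13 → m₂ a = m₁ a := fun a h1 h2 =>
    fr₂ a (by simp [forN, setv, Prog.writes, h1, h2])
  refine wp_seq_set (wp_seq_set ?_)
  have f51 : m₂ 51 0 0 = c := by rw [fr₂ 51 (by decide), e51]
  have f74 : m₂ 74 0 0 = j + 1 := by rw [fr₂ 74 (by decide), h74]
  have f72 : m₂ 72 0 0 = l := by rw [fr₂ 72 (by decide), hP₁.len]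
  have f70 : m₂ 70 0 j = x j := by rw [fr₂ 70 (by decide), hP₁.cell j (by omega)]
  simp only [eval_var, eval_get, eval_add, eval_sub, eval_lit, f51, f74, f72, Nat.add_sub_cancel,
    write_ne _ _ _ (show 51 ≠ 5 by decide), write_ne _ _ _ (show 74 ≠ 5 by decide),
    write_ne _ _ _ (show 72 ≠ 5 by decide), f70, show l + 2 - (j + 1) = l + 1 - j by omega]
  obtain ⟨m₃, hm₃⟩ : ∃ m₃, m₃ = (m₂.write 5 c (l + 1 - j) (x j)).write 4 0 c (l + 1 - j) :=
    ⟨_, rfl⟩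
  rw [← hm₃]
  obtain ⟨y, hy⟩ : ∃ y : ℕ → Fin n, y = fun i => if i < l + 1 - j then x (i + j) else x j :=
    ⟨_, rfl⟩
  have hcyc : IsCycSeq G (l + 1 - j) y := hy ▸ isCycSeq_of_back_edge hP.inj hP.adj hjl hback
  have fr₃ : ∀ a, a ≠ 4 → a ≠ 5 → m₃ a = m₂ a := by
    intro a h1 h2
    rw [hm₃, write_ne _ _ _ h1, write_ne _ _ _ h2]
  have hem : Emitted c (l + 1 - j) y m m₃ := by
    have h4 : m₂ 4 = m 4 := by rw [fr₂ 4 (by decide), fr₁ 4 (by decide)]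
    constructor
    · rw [hm₃, write_same]
    · intro i hi
      rw [hm₃, write_ne _ _ _ (by decide), hy]
      by_cases h1 : i = l + 1 - j
      · subst h1
        rw [write_same]; simp
      · simp only [Mem.write, h1, and_false, if_false]
        rw [h₂ i (by omega), hP.cell _ (by omega), if_pos (by omega)]
    · intro c' hc'
      rw [hm₃]
      simp only [Mem.write, hc', and_false, if_false, h4]
      simp
    · intro c' hc' i
      rw [hm₃, write_ne _ _ _ (by decide)]
      simp only [Mem.write, hc', and_false, false_and, if_false]
      exact h₂' c' hc' i
  have hmem : ∀ v, v ∈ cycSet (l + 1 - j) y ↔ ∃ i, j ≤ i ∧ i ≤ l ∧ x i = v := by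
    intro v
    rw [mem_cycSet]
    constructor
    · rintro ⟨i, hi, rfl⟩
      refine ⟨i + j, by omega, by omega, ?_⟩
      rw [hy]; simp [hi]
    · rintro ⟨i, h1, h2, rfl⟩
      refine ⟨i - j, by omega, ?_⟩
      rw [hy]
      simp only [show i - j < l + 1 - j by omega, if_true, Nat.sub_add_cancel h1]
  have hsub : cycSet (l + 1 - j) y ⊆ C := by
    intro v hv
    obtain ⟨i, -, hi, rfl⟩ := (hmem v).1 hv
    exact hP.mem i hi
  have hG₃ : HasGraph G m₃ := (hG₁.of_eq (fr₂ 0 (by decide)) (fr₂ 2 (by decide))).of_eq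
    (fr₃ 0 (by decide) (by decide)) (fr₃ 2 (by decide) (by decide))
  refine wp_seq (wp_copy (A := cycSet (l + 1 - j) y) hG₃.1 (by decide) (by decide)
    (by decide) ?_) ?_
  · intro m' u hb _ hu
    have g74 : m' 74 0 0 = j + 1 := by
      rw [hb 74 (by decide) (by decide), fr₃ 74 (by decide) (by decide), f74]
    have g71 : m' 71 = m 71 := by
      rw [hb 71 (by decide) (by decide), fr₃ 71 (by decide) (by decide), fr₂ 71 (by decide),
        fr₁ 71 (by decide)]
    simp only [eval_sub, eval_lit, eval_var, eval_row, hu, g74, g71]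
    by_cases h1 : ∃ i ≤ l, x i = u
    · obtain ⟨i, hi, rfl⟩ := h1
      rw [hP.pos i hi]
      by_cases h2 : j ≤ i
      · rw [if_pos ((hmem _).2 ⟨i, h2, hi, rfl⟩)]; omega
      · rw [if_neg]
        · omega
        · intro h3
          obtain ⟨i', h4, h5, h6⟩ := (hmem _).1 h3
          have := hP.inj _ h5 _ hi h6
          omega
    · push Not at h1
      rw [hP.pos_zero u h1, if_neg]
      · omega
      · intro h3
        obtain ⟨i', h4, h5, h6⟩ := (hmem _).1 h3
        exact h1 i' h5 h6
  intro m₄ h₄ fr₄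
  have hG₄ := hG₃.of_eq (fr₄ 0 (by decide)) (fr₄ 2 (by decide))
  refine wp_seq (wp_nbr_mask hG₄ h₄ (by decide) (by decide) (by decide)) ?_
  intro m₅ h₅ fr₅
  have hG₅ := hG₄.of_eq (fr₅ 0 (by decide)) (fr₅ 2 (by decide))
  have h75 := h₄.of_eq (fr₅ 75 (by decide))
  have h50' : Has (m₅ 50 0) A := h50.of_eq (by
    rw [fr₅ 50 (by decide), fr₄ 50 (by decide), fr₃ 50 (by decide) (by decide), fr₂ 50 (by decide),
      fr₁ 50 (by decide)])
  refine wp_seq (wp_copy (A := remainder G A (l + 1 - j) y) hG₅.1 (by decide) (by decide)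
    (by decide) ?_) ?_
  · intro m' u hb hu' hu
    simp only [eval_sub, eval_add, eval_row, hu, hu', hb 75 (by decide) (by decide),
      hb 76 (by decide) (by decide), h75 u, h₅ u, h50' u, remainder, Finset.mem_filter]
    by_cases h1 : u ∈ A <;> by_cases h2 : u ∈ cycSet (l + 1 - j) y <;>
      rcases Nat.eq_zero_or_pos (nb G (cycSet (l + 1 - j) y) u) with h3 | h3 <;>
      simp [h1, h2, h3, Nat.ne_of_gt]
    all_goals omega
  intro m₆ h₆ fr₆
  refine wp_setv ⟨?_, _, y, hcyc, hsub, ?_, h₆.of_eq rfl⟩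
  · rw [write_same]
    simp only [eval_add, eval_var, eval_lit]
    rw [fr₆ 51 (by decide), fr₅ 51 (by decide), fr₄ 51 (by decide),
      fr₃ 51 (by decide) (by decide), f51]
  · have g4 : ∀ v, (m₆.write 51 0 0 v) 4 = m₃ 4 := fun v => by
      rw [write_ne _ _ _ (by decide), fr₆ 4 (by decide), fr₅ 4 (by decide), fr₄ 4 (by decide)]
    have g5 : ∀ v, (m₆.write 51 0 0 v) 5 = m₃ 5 := fun v => by
      rw [write_ne _ _ _ (by decide), fr₆ 5 (by decide), fr₅ 5 (by decide), fr₄ 5 (by decide)]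
    obtain ⟨a1, a2, a3, a4⟩ := hem
    exact ⟨by rw [g4]; exact a1, by rw [g5]; exact a2, by rw [g4]; exact a3, by rw [g5]; exact a4⟩

/-! ### The greedy packing and its hitting set -/

/-- The memory holds the closed set `A`, its degrees, the number `c` of cycles found so far and the
number `k` of cycles wanted. -/
structure WorkEnv (G : SimpleGraph (Fin n)) [DecidableRel G.Adj] (k : ℕ) (A : Finset (Fin n))
    (c : ℕ) (m : Mem) : Prop where
  graph : HasGraph G m
  zero : Has (n := n) (m 21 0) ∅
  hasA : Has (m 50 0) A
  closed : Closed G ∅ A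
  hasNb : ∀ v : Fin n, m 22 0 v = nb G A v
  num : m 51 0 0 = c
  goal : m 1 0 0 = k
  go : m 78 0 0 ≠ 0 ↔ A.Nonempty ∧ c < k

/-- Replace the set in the array `50` by its core and test whether to continue. -/
def reduceP : Prog :=
  .seq (mapP 20 13 (row 50 13))
  (.seq coreP
  (.seq (mapP 50 13 (row 20 13))
  (.seq (sumP 77 13 (row 50 13))
    (setv 78 (.sub (.add (.sub (.lit 1) (.sub (.lit 1) (var 77)))
      (.sub (.lit 1) (.sub (.lit 1) (.sub (var 1) (var 51))))) (.lit 1))))))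

theorem wp_reduce {A : Finset (Fin n)} {k c : ℕ} (hG : HasGraph G m)
    (h21 : Has (n := n) (m 21 0) ∅) (h50 : Has (m 50 0) A) (h51 : m 51 0 0 = c)
    (h1 : m 1 0 0 = k) : WP n reduceP m (WorkEnv G k (core G ∅ A) c) := by
  refine wp_seq (wp_copy (A := A) hG.1 (by decide) (by decide) (by decide) ?_) ?_
  · intro m' u hb _ hu
    simp only [eval_row, hu, hb 50 (by decide) (by decide), h50 u]
  intro m₁ h₁ fr₁
  have hG₁ := hG.of_eq (fr₁ 0 (by decide)) (fr₁ 2 (by decide))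
  refine wp_seq (wp_core hG₁ h₁ (h21.of_eq (fr₁ 21 (by decide))) (by simp)) ?_
  intro m₂ ⟨h₂, h₂'⟩ fr₂
  have hG₂ := hG₁.of_eq (fr₂ 0 (by decide)) (fr₂ 2 (by decide))
  refine wp_seq (wp_copy (A := core G ∅ A) hG₂.1 (by decide) (by decide) (by decide) ?_) ?_
  · intro m' u hb _ hu
    simp only [eval_row, hu, hb 20 (by decide) (by decide), h₂ u]
  intro m₃ h₃ fr₃
  have hG₃ := hG₂.of_eq (fr₃ 0 (by decide)) (fr₃ 2 (by decide))
  refine wp_seq (wp_card hG₃.1 h₃ (by decide) (by decide) (by decide) (by decide) (by decide)) ?_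
  intro m₄ h₄ fr₄
  have hG₄ := hG₃.of_eq (fr₄ 0 (by decide)) (fr₄ 2 (by decide))
  have e51 : m₄ 51 0 0 = c := by
    rw [fr₄ 51 (by decide), fr₃ 51 (by decide), fr₂ 51 (by decide), fr₁ 51 (by decide), h51]
  have e1 : m₄ 1 0 0 = k := by
    rw [fr₄ 1 (by decide), fr₃ 1 (by decide), fr₂ 1 (by decide), fr₁ 1 (by decide), h1]
  refine wp_setv ⟨hG₄.of_eq rfl rfl, ?_, (h₃.of_eq (fr₄ 50 (by decide))).of_eq rfl,
    core_closed _ _, ?_, e51, e1, ?_⟩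
  · refine h21.of_eq ?_
    rw [write_ne _ _ _ (by decide), fr₄ 21 (by decide), fr₃ 21 (by decide), fr₂ 21 (by decide),
      fr₁ 21 (by decide)]
  · intro v
    rw [write_ne _ _ _ (by decide), fr₄ 22 (by decide), fr₃ 22 (by decide), h₂' v,
      Finset.union_empty]
  · rw [write_same, ← Finset.card_pos]
    simp only [eval_sub, eval_add, eval_lit, eval_var, h₄, e51, e1]
    omega

/-- The memory holds an induced packing of `c` cycles, with no edges between these and `A`. -/
structure Packing (G : SimpleGraph (Fin n)) (A : Finset (Fin n)) (c : ℕ) (l : ℕ → ℕ)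
    (y : ℕ → ℕ → Fin n) (m : Mem) : Prop where
  isCyc : ∀ i < c, IsCycSeq G (l i) (y i)
  len : ∀ i < c, m 4 0 i = l i
  cell : ∀ i < c, ∀ j ≤ l i, m 5 i j = y i j
  apart : ∀ i < c, ∀ j < c, i ≠ j → ∀ u ∈ cycSet (l i) (y i), ∀ v ∈ cycSet (l j) (y j),
    u ≠ v ∧ ¬ G.Adj u v
  apart_rest : ∀ i < c, ∀ u ∈ cycSet (l i) (y i), ∀ v ∈ A, u ≠ v ∧ ¬ G.Adj u v

theorem Packing.of_eq {A : Finset (Fin n)} {c : ℕ} {l : ℕ → ℕ} {y : ℕ → ℕ → Fin n} {m' : Mem}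
    (h : Packing G A c l y m) (h4 : m' 4 = m 4) (h5 : m' 5 = m 5) : Packing G A c l y m' := by
  obtain ⟨a1, a2, a3, a4, a5⟩ := h
  exact ⟨a1, by rw [h4]; exact a2, by rw [h5]; exact a3, a4, a5⟩

/-- The new cycle lies in `A`, which is already apart from the older cycles; the new rest avoids the
new cycle and its neighbours. -/
theorem Packing.emit {A A' : Finset (Fin n)} {c l₀ : ℕ} {l : ℕ → ℕ} {y : ℕ → ℕ → Fin n}
    {y₀ : ℕ → Fin n} {m' : Mem} (h : Packing G A c l y m) (hc : IsCycSeq G l₀ y₀)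
    (hsub : cycSet l₀ y₀ ⊆ A) (he : Emitted c l₀ y₀ m m') (hA' : A' ⊆ remainder G A l₀ y₀) :
    Packing G A' (c + 1) (Function.update l c l₀) (Function.update y c y₀) m' := by
  have hlt : ∀ i < c + 1, i ≠ c → i < c := fun i _ _ => by omega
  constructor
  · intro i hi
    by_cases hic : i = c
    · subst hic; simpa using hc
    · simpa [hic] using h.isCyc i (hlt i hi hic)
  · intro i hi
    by_cases hic : i = c
    · subst hic; simpa using he.len
    · simpa [hic, he.len_ne i hic] using h.len i (hlt i hi hic)
  · intro i hi
    by_cases hic : i = c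
    · subst hic; simpa using he.cell
    · simpa [hic, he.cell_ne i hic] using h.cell i (hlt i hi hic)
  · intro i hi j hj hij
    by_cases hic : i = c
    · have hjc : j ≠ c := fun e => hij (hic.trans e.symm)
      subst hic
      simp only [Function.update_self, Function.update_of_ne hjc]
      intro u hu v hv
      obtain ⟨h1, h2⟩ := h.apart_rest j (hlt j hj hjc) v hv u (hsub hu)
      exact ⟨h1.symm, fun e => h2 e.symm⟩
    · by_cases hjc : j = c
      · subst hjc
        simp only [Function.update_self, Function.update_of_ne hic]
        exact fun u hu v hv => h.apart_rest i (hlt i hi hic) u hu v (hsub hv)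
      · simp only [Function.update_of_ne hic, Function.update_of_ne hjc]
        exact h.apart i (hlt i hi hic) j (hlt j hj hjc) hij
  · intro i hi u hu v hv
    obtain ⟨hvA, hvc, hv0⟩ := Finset.mem_filter.1 (hA' hv)
    by_cases hic : i = c
    · subst hic
      simp only [Function.update_self] at hu
      exact ⟨fun e => hvc (e ▸ hu), fun e => nb_eq_zero.1 hv0 u hu e.symm⟩
    · simp only [Function.update_of_ne hic] at hu
      exact h.apart_rest i (hlt i hi hic) u hu v hvA

/-- There is a set of at most `c * (420 * D + 442)` vertices of which every union with a set hitting
the cycles in `A` hits the cycles in `S`, where `D` is logarithmic in the number of vertices needed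
to hit the cycles in `S`. -/
def Hitting (G : SimpleGraph (Fin n)) [DecidableRel G.Adj] (S A : Finset (Fin n)) (c : ℕ) : Prop :=
  ∃ (Z' : Finset (Fin n)) (D : ℕ), Z'.card ≤ c * (420 * D + 442) ∧
    (∀ Z, ¬ Cyc G ∅ (A \ Z) → ¬ Cyc G ∅ (S \ (Z ∪ Z'))) ∧
    (D ≤ 1 ∨ ∀ Z, ¬ Cyc G ∅ (S \ Z) → 2 ^ (D - 1) ≤ 40 * Z.card)

theorem hitting_core (S : Finset (Fin n)) : Hitting G S (core G ∅ S) 0 :=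
  ⟨∅, 0, by simp, fun Z hZ h => hZ (by rw [Finset.union_empty] at h; exact h.of_core),
    Or.inl zero_le_one⟩

theorem Hitting.step {S A : Finset (Fin n)} {c d l : ℕ} {y : ℕ → Fin n} (h : Hitting G S A c)
    (hA : Closed G ∅ A) (hAS : A ⊆ S) (hD : ∀ v ∈ A, nb G A v ≤ 20) (hy : IsCycSeq G l y)
    (hsub : cycSet l y ⊆ A) (hb : (cycSet l y ∩ branch G A).card ≤ 20 * d + 21)
    (hd : d ≤ 1 ∨ 2 ^ (d - 1) ≤ (branch G A).card) :
    Hitting G S (core G ∅ (remainder G A l y)) (c + 1) := by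
  obtain ⟨Z₁, D, h1, h2, h3⟩ := h
  obtain ⟨Z₂, h4, h5⟩ := hy.exists_hits (A' := remainder G A l y) hD hsub hb
    (fun v => by simp [remainder])
  -- The new cost is `21 * (20 * d + 21) + 1 = 420 * d + 442`; taking the maximum of the levels
  -- gives one bound for all rounds.
  refine ⟨Z₂ ∪ Z₁, max D d, ?_, ?_, ?_⟩
  · have h6 := Finset.card_union_le Z₂ Z₁
    have h7 : c * (420 * D + 442) ≤ c * (420 * max D d + 442) :=
      Nat.mul_le_mul_left _ (by have := le_max_left D d; omega)
    have h8 := le_max_right D d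
    rw [add_mul, one_mul]
    omega
  · intro Z hZ
    rw [← Finset.union_assoc]
    exact h2 _ (h5 Z fun h => hZ h.of_core)
  · have hd' : d ≤ 1 ∨ ∀ Z, ¬ Cyc G ∅ (S \ Z) → 2 ^ (d - 1) ≤ 40 * Z.card := by
      refine hd.imp_right fun h Z hZ => h.trans (card_branch_le hA hD fun h' => hZ ?_)
      exact h'.mono (Finset.sdiff_subset_sdiff hAS subset_rfl)
    rcases le_total D d with hle | hle
    · rwa [max_eq_right hle]
    · rwa [max_eq_left hle]

/-- Find one more cycle. -/
def roundP : Prog := .seq growP (.seq pathP (.seq emitP reduceP))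

/-- The found cycle has at least three vertices and leaves `A`, so the core shrinks in every round.
-/
theorem wp_round {S A : Finset (Fin n)} {k c : ℕ} {l : ℕ → ℕ} {y : ℕ → ℕ → Fin n}
    (hE : WorkEnv G k A c m) (hne : A.Nonempty) (hAS : A ⊆ S) (hD : ∀ v ∈ S, nb G S v ≤ 20)
    (hP : Packing G A c l y m) (hH : Hitting G S A c) :
    WP n roundP m (fun m' => ∃ A' l y, A'.card < A.card ∧ A' ⊆ S ∧ WorkEnv G k A' (c + 1) m' ∧
      Packing G A' (c + 1) l y m' ∧ Hitting G S A' (c + 1)) := by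
  have hDA : ∀ v ∈ A, nb G A v ≤ 20 := fun v hv => (nb_mono hAS v).trans (hD v (hAS hv))
  refine wp_seq (wp_grow hE.graph hE.closed hDA hne hE.hasA hE.hasNb) ?_
  intro m₁ ⟨M, d, h52, hMA, hcM, hbM, hd⟩ fr₁
  have hG₁ := hE.graph.of_eq (fr₁ 0 (by decide)) (fr₁ 2 (by decide))
  refine wp_seq (wp_path hG₁ (hE.zero.of_eq (fr₁ 21 (by decide))) h52 hcM) ?_
  intro m₂ ⟨lp, x, hpath, hstuck⟩ fr₂
  have hG₂ := hG₁.of_eq (fr₂ 0 (by decide)) (fr₂ 2 (by decide))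
  have h50 : Has (m₂ 50 0) A := hE.hasA.of_eq (by rw [fr₂ 50 (by decide), fr₁ 50 (by decide)])
  have h51 : m₂ 51 0 0 = c := by rw [fr₂ 51 (by decide), fr₁ 51 (by decide), hE.num]
  refine wp_seq (wp_emit hG₂ hpath (core_closed _ _) hstuck h50 h51) ?_
  intro m₃ ⟨h51', l₀, y₀, hcyc, hsub, hem, hrem⟩ fr₃
  have hG₃ := hG₂.of_eq (fr₃ 0 (by decide)) (fr₃ 2 (by decide))
  have hsubA : cycSet l₀ y₀ ⊆ A := hsub.trans ((core_subset _ _).trans hMA)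
  have h21 : Has (n := n) (m₃ 21 0) ∅ := hE.zero.of_eq (by
    rw [fr₃ 21 (by decide), fr₂ 21 (by decide), fr₁ 21 (by decide)])
  have h1 : m₃ 1 0 0 = k := by
    rw [fr₃ 1 (by decide), fr₂ 1 (by decide), fr₁ 1 (by decide), hE.goal]
  refine (wp_reduce hG₃ h21 hrem h51' h1).mono ?_
  intro m₄ h₄ fr₄
  have hrA : core G ∅ (remainder G A l₀ y₀) ⊆ A :=
    (core_subset _ _).trans (Finset.filter_subset _ _)
  refine ⟨_, _, _, Finset.card_lt_card ?_, hrA.trans hAS, h₄,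
    ((hP.of_eq (by rw [fr₂ 4 (by decide), fr₁ 4 (by decide)])
      (by rw [fr₂ 5 (by decide), fr₁ 5 (by decide)])).emit hcyc hsubA hem (core_subset _ _)).of_eq
      (fr₄ 4 (by decide)) (fr₄ 5 (by decide)), ?_⟩
  · refine (Finset.ssubset_iff_of_subset hrA).2 ⟨y₀ 0, ?_⟩
    have h0 : y₀ 0 ∈ cycSet l₀ y₀ := mem_cycSet.2 ⟨0, by have := hcyc.three_le; omega, rfl⟩
    exact ⟨hsubA h0, fun h => (Finset.mem_filter.1 (core_subset _ _ h)).2.1 h0⟩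
  · exact hH.step hE.closed hAS hDA hcyc hsubA
      ((Finset.card_le_card (Finset.inter_subset_inter_right hsub)).trans hbM) hd

/-! ### The whole program -/

/-- The program: construct the frame, output the marked vertices and their neighbours, find disjoint
cycles in the frame, and set the flag if there are enough of these. -/
def packP : Prog :=
  .seq frameP
  (.seq (mapP 6 13 (.sub (.lit 1) (.sub (.lit 1) (.add (row 31 13) (row 34 13)))))
  (.seq (mapP 21 13 (.lit 0))
  (.seq (mapP 50 13 (row 30 13))
  (.seq reduceP
  (.seq (.loop (var 78) roundP)
    (.ite (.sub (var 1) (var 51)) .skip (setv 3 (.lit 1))))))))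

/-- The set `X` together with its neighbours. -/
def neighborhood (G : SimpleGraph (Fin n)) [DecidableRel G.Adj] (X : Finset (Fin n)) :
    Finset (Fin n) := Finset.univ.filter fun v => v ∈ X ∨ 0 < nb G X v

theorem card_neighborhood_le {t : ℕ} (ht : 1 ≤ t) (hG : G.maxDegree ≤ t) (X : Finset (Fin n)) :
    (neighborhood G X).card ≤ 2 * t * X.card := by
  have hsub : neighborhood G X ⊆ X.biUnion fun v => insert v (G.neighborFinset v) := by
    intro v hv
    rcases (Finset.mem_filter.1 hv).2 with h | h
    · exact Finset.mem_biUnion.2 ⟨v, h, Finset.mem_insert_self _ _⟩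
    · obtain ⟨u, hu, hadj⟩ := nb_pos.1 h
      exact Finset.mem_biUnion.2 ⟨u, hu, Finset.mem_insert_of_mem (by simpa using hadj.symm)⟩
  refine (Finset.card_le_card hsub).trans ((Finset.card_biUnion_le_card_mul _ _ (2 * t) ?_).trans
    (by rw [mul_comm]))
  intro v _
  refine (Finset.card_insert_le _ _).trans ?_
  have : (G.neighborFinset v).card ≤ t := by
    rw [SimpleGraph.card_neighborFinset_eq_degree]
    exact (G.degree_le_maxDegree v).trans hG
  omega

theorem wp_pack {k : ℕ} (hk : 1 ≤ k) (hG : HasGraph G m) (h30 : Has (n := n) (m 30 0) ∅)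
    (h31 : Has (n := n) (m 31 0) ∅) (h51 : m 51 0 0 = 0) (h1 : m 1 0 0 = k) (h3 : m 3 0 0 = 0) :
    WP n packP m (fun m' => (m' 3 0 0 = 1 ∧ ∃ A l y, Packing G A k l y m') ∨
      (m' 3 0 0 = 0 ∧ ∃ S X c D, ∃ Z : Finset (Fin n), Frame G S X ∧
        ¬ Cyc G (S \ X) (outer G S X) ∧ Has (m' 6 0) (neighborhood G X) ∧ c + 1 ≤ k ∧
        Z.card ≤ c * (420 * D + 442) ∧ ¬ Cyc G ∅ (S \ Z) ∧
        (D ≤ 1 ∨ 2 ^ (D - 1) ≤ 40 * Z.card))) := by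
  refine wp_seq (wp_frame hG h30 h31) ?_
  intro m₁ ⟨S, X, h₁, hF, hno⟩ fr₁
  refine wp_seq (wp_copy (A := neighborhood G X) h₁.graph.1 (by decide) (by decide)
    (by decide) ?_) ?_
  · intro m' u hb _ hu
    simp only [eval_row, eval_sub, eval_add, eval_lit, hu, hb 31 (by decide) (by decide),
      hb 34 (by decide) (by decide), h₁.hasX u, h₁.nbX u, neighborhood, Finset.mem_filter,
      Finset.mem_univ, true_and]
    by_cases h2 : u ∈ X
    · simp [h2]
    · by_cases h3 : 0 < nb G X u <;> simp only [h2, h3, if_false, if_true, false_or] <;> omega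
  intro m₂ h₂ fr₂
  have hG₂ := h₁.graph.of_eq (fr₂ 0 (by decide)) (fr₂ 2 (by decide))
  refine wp_seq (wp_copy (A := ∅) hG₂.1 (by decide) (by decide) (by decide) ?_) ?_
  · intro m' u _ _ _
    simp
  intro m₃ h₃ fr₃
  have hG₃ := hG₂.of_eq (fr₃ 0 (by decide)) (fr₃ 2 (by decide))
  refine wp_seq (wp_copy (A := S) hG₃.1 (by decide) (by decide) (by decide) ?_) ?_
  · intro m' u hb _ hu
    simp only [eval_row, hu, hb 30 (by decide) (by decide), fr₃ 30 (by decide), fr₂ 30 (by decide),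
      h₁.hasS u]
  intro m₄ h₄ fr₄
  have hG₄ := hG₃.of_eq (fr₄ 0 (by decide)) (fr₄ 2 (by decide))
  have fr : ∀ a, a ∉ frameP.writes → a ≠ 6 → a ≠ 13 → a ≠ 21 → a ≠ 50 → m₄ a = m a := by
    intro a ha h1 h2 h3 h4
    rw [fr₄ a (by simp [mapP, forN, setv, Prog.writes, h2, h4]),
      fr₃ a (by simp [mapP, forN, setv, Prog.writes, h2, h3]),
      fr₂ a (by simp [mapP, forN, setv, Prog.writes, h1, h2]), fr₁ a ha]
  have e51 : m₄ 51 0 0 = 0 := by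
    rw [fr 51 (by decide) (by decide) (by decide) (by decide) (by decide), h51]
  have e1 : m₄ 1 0 0 = k := by
    rw [fr 1 (by decide) (by decide) (by decide) (by decide) (by decide), h1]
  refine wp_seq (wp_reduce hG₄ (h₃.of_eq (fr₄ 21 (by decide))) h₄ e51 e1) ?_
  intro m₅ h₅ fr₅
  refine wp_seq (R := fun m' => ∃ A c, WorkEnv G k A c m' ∧ (c = 0 ∨ ∃ l y, Packing G A c l y m') ∧
    Hitting G S A c ∧ c ≤ k ∧ m' 78 0 0 = 0) (wp_loop (fun j m' => ∃ A c, WorkEnv G k A c m' ∧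
      (c = 0 ∨ ∃ l y, Packing G A c l y m') ∧ Hitting G S A c ∧ c ≤ k ∧ A ⊆ S ∧ A.card = j)
      (core G ∅ S).card ?_ ?_ ?_ ?_) ?_
  · have : (core G ∅ S).card ≤ n := by simpa using Finset.card_le_univ (core G ∅ S)
    omega
  · exact ⟨_, 0, h₅, Or.inl rfl, hitting_core S, Nat.zero_le _, core_subset _ _, rfl⟩
  · rintro j m₆ ⟨A, c, hE, hP, hH, -, hAS, rfl⟩ - he
    obtain ⟨hne, hck⟩ := hE.go.1 he
    -- With `c = 0` a packing is vacuous but still requires functions into `Fin n`, which need not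
    -- exist for `n = 0`; hence the separate case in the invariant. Here `A` supplies a vertex.
    obtain ⟨l, y, hP⟩ : ∃ l y, Packing G A c l y m₆ := by
      rcases hP with rfl | hP
      · obtain ⟨v, -⟩ := hne
        exact ⟨fun _ => 0, fun _ _ => v, by constructor <;> intro i hi <;> omega⟩
      · exact hP
    refine (wp_round hE hne hAS hF.deg hP hH).mono ?_
    rintro m₇ ⟨A', l', y', hlt, hAS', hE', hP', hH'⟩ -
    exact ⟨_, hlt, A', c + 1, hE', Or.inr ⟨l', y', hP'⟩, hH', hck, hAS', rfl⟩
  · rintro j m₆ ⟨A, c, hE, hP, hH, hck, -, -⟩ - he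
    exact ⟨A, c, hE, hP, hH, hck, he⟩
  rintro m₆ ⟨A, c, hE, hP, hH, hck, h78⟩ fr₆
  have e3 : m₆ 3 0 0 = 0 := by
    rw [fr₆ 3 (by decide), fr₅ 3 (by decide),
      fr 3 (by decide) (by decide) (by decide) (by decide) (by decide), h3]
  have hgo : ¬ (A.Nonempty ∧ c < k) := fun h => hE.go.2 h h78
  refine wp_ite (fun he => wp_skip (Or.inr ⟨e3, ?_⟩))
    (fun he => wp_setv (Or.inl ⟨write_same _ _ _ _, ?_⟩))
  · simp only [eval_sub, eval_var, hE.goal, hE.num] at he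
    have hck' : c + 1 ≤ k := by omega
    have hA : A = ∅ := Finset.not_nonempty_iff_eq_empty.1 fun h => hgo ⟨h, hck'⟩
    subst hA
    obtain ⟨Z, D, hz, hh, hD⟩ := hH
    -- Nothing is left to hit in the empty core, so the accumulated vertices alone hit all cycles in
    -- `S`.
    have hhit : ¬ Cyc G ∅ (S \ Z) := by
      simpa using hh ∅ (by simpa using not_cyc_empty _)
    refine ⟨S, X, c, D, Z, hF, hno, h₂.of_eq ?_, hck', hz, hhit, hD.imp_right fun h => h Z hhit⟩
    rw [fr₆ 6 (by decide), fr₅ 6 (by decide), fr₄ 6 (by decide), fr₃ 6 (by decide)]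
  · simp only [eval_sub, eval_var, hE.goal, hE.num] at he
    obtain rfl : c = k := by omega
    obtain ⟨l, y, hP⟩ := hP.resolve_left (by omega)
    exact ⟨A, l, y, hP.of_eq rfl rfl⟩

theorem hasGraph_inputMem (G : SimpleGraph (Fin n)) [DecidableRel G.Adj] (k : ℕ) :
    HasGraph G (inputMem G k) := by
  refine ⟨by simp [inputMem], fun u v => ?_, fun i j => ?_⟩
  · have : (∃ u' : Fin n, (u' : ℕ) = u ∧ ∃ v' : Fin n, (v' : ℕ) = v ∧ G.Adj u' v') ↔
        G.Adj u v := by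
      constructor
      · rintro ⟨u', h1, v', h2, h⟩
        rwa [← Fin.ext h1, ← Fin.ext h2]
      · exact fun h => ⟨u, rfl, v, rfl, h⟩
    simp [inputMem, this]
  · simp only [inputMem]
    split_ifs <;> simp_all

theorem inputMem_eq_zero (k : ℕ) {a : ℕ} (ha : 2 < a) (i j : ℕ) : inputMem G k a i j = 0 := by
  have h0 : a ≠ 0 := by omega
  have h1 : a ≠ 1 := by omega
  have h2 : a ≠ 2 := by omega
  simp [inputMem, h0, h1, h2]

theorem Packing.exists_outputsCycles {A : Finset (Fin n)} {k : ℕ} {l : ℕ → ℕ}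
    {y : ℕ → ℕ → Fin n} (h : Packing G A k l y m) (h3 : m 3 0 0 = 1) :
    ∃ F : Fin k → Σ v : Fin n, G.Walk v v, OutputsCycles m F ∧ IsInducedCyclePacking G F := by
  have hsup : ∀ (c : Fin k) (v : Fin n), v ∈ (seqWalk (y c) (l c) (h.isCyc c c.2).adj).support →
      v ∈ cycSet (l c) (y c) := by
    intro c v hv
    obtain ⟨j, hj, rfl⟩ := (mem_support_seqWalk _ _ _).1 hv
    have h3 := (h.isCyc c c.2).three_le
    rcases hj.lt_or_eq with hj | rfl
    · exact mem_cycSet.2 ⟨j, hj, rfl⟩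
    · exact mem_cycSet.2 ⟨0, by omega, (h.isCyc c c.2).last.symm⟩
  refine ⟨fun c => ⟨y c 0, (seqWalk (y c) (l c) (h.isCyc c c.2).adj).copy rfl
    (h.isCyc c c.2).last⟩, ⟨h3, fun c => ⟨?_, fun j hj => ?_⟩⟩, fun c => ?_, ?_⟩
  · rw [SimpleGraph.Walk.length_copy, length_seqWalk]
    exact h.len c c.2
  · rw [SimpleGraph.Walk.length_copy, length_seqWalk] at hj
    rw [SimpleGraph.Walk.getVert_copy, getVert_seqWalk _ _ _ hj]
    exact h.cell c c.2 j hj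
  · exact (h.isCyc c c.2).isCycle_seqWalk
  · intro c d hcd u hu v hv
    rw [SimpleGraph.Walk.support_copy] at hu hv
    exact h.apart c c.2 d d.2 (fun e => hcd (Fin.ext e)) u (hsup c u hu) v (hsup d v hv)

end RAM

/-! ### Assembling the bounds -/

theorem corollary1p3 :
    ∃ (C : ℝ) (P : RAM.Prog) (p : Polynomial ℕ),
      ∀ (k t n : ℕ) (G : SimpleGraph (Fin n)) [DecidableRel G.Adj],
        1 ≤ k → 1 ≤ t → G.maxDegree ≤ t →
          ∃ m : RAM.Mem, RAM.HaltsWithin P (inputMem G k) (p.eval n) m ∧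
            ((∃ F : Fin k → Σ v : Fin n, G.Walk v v,
                OutputsCycles m F ∧ IsInducedCyclePacking G F) ∨
              (∃ X : Finset (Fin n), OutputsVertexSet m X ∧
                (X.card : ℝ) ≤ C * (t * (k * Real.log k)) ∧
                (G.induce {v : Fin n | v ∉ X}).IsAcyclic)) := by
  -- The factors come from the neighbourhood of `X` (`2 * t` per marked vertex), from comparing `X`
  -- with a hitting set of `S`, and from `hits_bound`.
  refine ⟨2 * 861 * 30000, RAM.packP, RAM.packP.bound, ?_⟩
  intro k t n G _ hk ht hG
  have h0 : ∀ a, 2 < a → RAM.Has (n := n) (inputMem G k a 0) ∅ := fun a ha v => by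
    simpa using RAM.inputMem_eq_zero k ha 0 v
  obtain ⟨m, hm, hQ⟩ := RAM.wp_pack hk (RAM.hasGraph_inputMem G k) (h0 30 (by decide))
    (h0 31 (by decide)) (RAM.inputMem_eq_zero k (by decide) 0 0) (by simp [inputMem])
    (RAM.inputMem_eq_zero k (by decide) 0 0)
  refine ⟨m, hm, ?_⟩
  rcases hQ with ⟨h3, A, l, y, hP⟩ | ⟨h3, S, X, c, D, Z, hF, hno, h6, hck, hz, hhit, hD⟩
  · exact Or.inl (hP.exists_outputsCycles h3)
  · refine Or.inr ⟨RAM.neighborhood G X, ⟨h3, h6⟩, ?_, ?_⟩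
    · have h1 := RAM.card_neighborhood_le ht hG X
      have h2 := hF.card_le hhit
      have h4 : (RAM.neighborhood G X).card ≤ 2 * t * (861 * Z.card) :=
        h1.trans (Nat.mul_le_mul_left _ h2)
      have h5 : ((RAM.neighborhood G X).card : ℝ) ≤ 2 * t * (861 * Z.card) := by exact_mod_cast h4
      have h7 := CycleCore.hits_bound hck hz hD
      calc ((RAM.neighborhood G X).card : ℝ) ≤ 2 * t * (861 * Z.card) := h5
        _ ≤ 2 * t * (861 * (30000 * (k * Real.log k))) := by gcongr
        _ = _ := by ring
    · refine CycleCore.isAcyclic_of_not_cyc (U := Finset.univ.filter (· ∉ RAM.neighborhood G X))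
        (fun v hv => by simpa using hv)
        (hF.acyclic_outside (fun w => RAM.mem_outer) hno ?_)
      intro u hu
      have hu' := (Finset.mem_filter.1 hu).2
      simp only [RAM.neighborhood, Finset.mem_filter, Finset.mem_univ, true_and, not_or,
        not_lt, Nat.le_zero] at hu'
      exact hu'
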